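/- **Setting.** Let $0=s_0<s_1<s_2<\cdots$, $A_j=(s_{j-1},s_j]$, and suppose that for some integer $d\ge 1$ one has $|A_{j+d}|=|A_j|$ for all $j\ge1$; put $\tau=\sum_{j=1}^d|A_j|>0$ and $\mathfrak D_j=\bigcup_{k\ge0}A_{j+kd}$ for $1\le j\le d$. Let $\lambda_1,\dots,\lambda_d\ge0$, $\lambda(u)=\sum_{j=1}^d\lambda_j\mathbf 1_{\mathfrak D_j}(u)$ and $\Lambda(t)=\int_0^t\lambda(u)\,du$. Let $(N(t))_{t\ge0}$ be a non-homogeneous Poisson process with mean function $\Lambda$ and $n$-th arrival time $\Upsilon_n$. Let $Z^{(j)}_n$ ($1\le j\le d$, $n\ge1$) be independent random variables, jointly independent of $N$, with $Z^{(j)}_n$ of law $F_j$ and $\int z^2F_j(dz)<\infty$. Put $Z_n=\sum_{j=1}^dZ_n^{(j)}\mathbf 1_{\{\Upsilon_n\in\mathfrak D_j\}}$ and, for $\delta\in\mathbb R$, $$S_t=\delta t+\sum_{n=1}^{N(t)}Z_n,\qquad [S,S]_t=\sum_{n=1}^{N(t)}Z_n^2 .$$ Let $q\ge p\ge1$ be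 integers, $\alpha_0>0$, $\alpha_1,\dots,\alpha_q,\beta_1,\dots,\beta_q\in\mathbb R$ with $\alpha_p\ne0$, $\beta_q\ne0$ and $\alpha_{p+1}=\dots=\alpha_q=0$. Let $\mathbf a=(\alpha_1,\dots,\alpha_q)'$, $\mathbf e=(0,\dots,0,1)'\in\mathbb R^q$, and let $B$ be the $q\times q$ companion matrix with ones on the superdiagonal, last row $(-\beta_q,\dots,-\beta_1)$ and zeros elsewhere. Let $(\mathbf Y_t)_{t\ge0}$ be the càdlàg solution of $$d\mathbf Y_t=B\mathbf Y_{t^-}\,dt+\mathbf e(\alpha_0+\mathbf a'\mathbf Y_{t^-})\,d[S,S]_t,\qquad t>0,$$ with $\mathbf Y_0$ independent of $(S_t)_{t\ge0}$. Put $V_t=\alpha_0+\mathbf a'\mathbf Y_{t^-}$ for $t>0$ and $V_0=\alpha_0+\mathbf a'\mathbf Y_0$; assume that almost surely $V_t\ge0$ for all $t\ge 0$, and for $l>0$ let $$G_t^{(l)}=\int_{(t,t+l]}\sqrt{V_u}\,dS_u .$$ **Assumptions.** (i) The eigenvalues of $B$ are distinct and have strictly negative real parts; $\eta<0$ denotes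 the largest of these real parts. (ii) There are $r\in[1,\infty]$ and an invertible complex matrix $P$ with $P^{-1}BP$ diagonal such that for all $t\in[0,\tau]$ and $1\le j\le d$ $$\int_{\mathbb R}\log\bigl(1+\|P^{-1}\mathbf e\mathbf a'P\|_r\,z^2\bigr)F_j(dz)<-\frac{\eta\tau}{\Lambda(t+\tau)-\Lambda(t)},$$ where $\|\cdot\|_r$ is the operator norm induced by the $L^r$-norm on $\mathbb C^q$, and the right side is $+\infty$ if the denominator vanishes. (iii) $E(S_t)=0$ for all $t\ge0$. Say that $\operatorname{cov}(X,X')$ *exists* if $X$, $X'$ and $XX'$ are integrable. **Conclusion.** For all $t\ge0$ and $h\ge l>0$: (a) if $G_t^{(l)}$ is integrable, then $E\bigl(G_t^{(l)}\bigr)=0$; and if $\operatorname{cov}\bigl(G_t^{(l)},G_{t+h}^{(l)}\bigr)$ exists, it equals $0$. (b) Suppose in addition that $(\mathbf Y_t)$ is in its periodic regime, i.e. for each $v\in[0,\tau)$ one has $\mathbf Y_v\overset{d}{=}\mathbf U^{(v)}$, where $\mathbf U^{(v)}$ is the limit in distribution of $\mathbf Y_{v+m\tau}$ as $m\to\infty$.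 Then $$E\bigl((G_t^{(l)})^2\bigr)=E\bigl((G_{t+\tau}^{(l)})^2\bigr)\quad\text{in }[0,\infty],$$ and if $\operatorname{cov}\bigl((G_t^{(l)})^2,(G_{t+h}^{(l)})^2\bigr)$ exists, then so does $\operatorname{cov}\bigl((G_{t+\tau}^{(l)})^2,(G_{t+h+\tau}^{(l)})^2\bigr)$ and the two are equal. -/

import Mathlib

open MeasureTheory ProbabilityTheory Filter Topology
open scoped NNReal ENNReal Matrix

noncomputable section

namespace SLDCogarch

/-! ### The semi-Lévy compound Poisson driving process -/

/-- `0 = s 0 < s 1 < ...` cuts the positive half-line into the intervals `(s j, s (j+1)]`, whose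
lengths are repeated after `d` steps; `τ > 0` is the total length of the first `d` intervals. -/
structure IsPeriodicPartition (s : ℕ → ℝ) (d : ℕ) (τ : ℝ) : Prop where
  zero : s 0 = 0
  strictMono : StrictMono s
  periodic : ∀ j, s (j + 1) - s j = s (j + d + 1) - s (j + d)
  period_eq : τ = ∑ j ∈ Finset.range d, (s (j + 1) - s j)
  period_pos : 0 < τ

/-- The union over all periods `k` of the copies of the `j`-th interval, `j = 0, ..., d - 1`. -/
def phaseSet (s : ℕ → ℝ) (d : ℕ) (j : Fin d) : Set ℝ :=
  ⋃ k : ℕ, Set.Ioc (s (j + k * d)) (s (j + k * d + 1))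

/-- The piecewise constant intensity, equal to `lam j` on the `j`-th phase set. -/
def intensity (s : ℕ → ℝ) (d : ℕ) (lam : Fin d → ℝ) (u : ℝ) : ℝ :=
  ∑ j : Fin d, (phaseSet s d j).indicator (fun _ => lam j) u

/-- The cumulative intensity `Λ(t) = ∫₀ᵗ λ(u) du`. -/
def cumIntensity (s : ℕ → ℝ) (d : ℕ) (lam : Fin d → ℝ) (t : ℝ) : ℝ :=
  ∫ u in (0 : ℝ)..t, intensity s d lam u

variable {Ω : Type*} [MeasurableSpace Ω]

/-- Non-homogeneous Poisson process `(N t)_{t ≥ 0}` with cumulative intensity `Λ`: almost surely a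
right-continuous counting path from `0` with unit jumps, independent increments, and
`N t - N s` Poisson with mean `Λ t - Λ s`. Only the times `t ≥ 0` matter. -/
structure IsPoissonProcess (μ : Measure Ω) (Λ : ℝ → ℝ) (N : ℝ → Ω → ℕ) : Prop where
  measurable : ∀ t, 0 ≤ t → Measurable (N t)
  zero : ∀ᵐ ω ∂μ, N 0 ω = 0
  mono : ∀ᵐ ω ∂μ, MonotoneOn (fun t => N t ω) (Set.Ici 0)
  right_cont : ∀ᵐ ω ∂μ, ∀ t, 0 ≤ t → ContinuousWithinAt (fun u => N u ω) (Set.Ici t) t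
  unit_jump : ∀ᵐ ω ∂μ, ∀ t, 0 < t → ∀ᶠ u in 𝓝[<] t, N t ω ≤ N u ω + 1
  indep_increments : HasIndepIncrements (fun t : ℝ≥0 => N t) μ
  law : ∀ s t, 0 ≤ s → s ≤ t →
    HasLaw (fun ω => N t ω - N s ω) (poissonMeasure (Λ t - Λ s).toNNReal) μ

/-- Arrival time of the jump with index `n`, `n = 0, 1, ...` (so `n = 0` is the first jump).
It is only ever used for `n < N t ω`, where the set is non-empty. -/
def arrivalTime (N : ℝ → Ω → ℕ) (n : ℕ) (ω : Ω) : ℝ :=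
  sInf {t : ℝ | 0 ≤ t ∧ n + 1 ≤ N t ω}

/-- The size of the jump with index `n`: it is `Z j n` if the jump arrives in phase `j`. -/
def jumpSize (s : ℕ → ℝ) (d : ℕ) (N : ℝ → Ω → ℕ) (Z : Fin d → ℕ → Ω → ℝ) (n : ℕ) (ω : Ω) : ℝ :=
  ∑ j : Fin d, (phaseSet s d j).indicator (fun _ => Z j n ω) (arrivalTime N n ω)

/-- `S t = δ t +` the sum of the first `N t` jump sizes `ζ`. -/
def drivingProcess (δ : ℝ) (N : ℝ → Ω → ℕ) (ζ : ℕ → Ω → ℝ) (t : ℝ) (ω : Ω) : ℝ :=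
  δ * t + ∑ n ∈ Finset.range (N t ω), ζ n ω

/-- The data of a semi-Lévy compound Poisson process: semi-Lévy Poisson counting process `N`, and
independent marks `Z j n` with law `F j` having a finite second moment, independent of `N`. -/
structure IsSLCP (μ : Measure Ω) (s : ℕ → ℝ) (d : ℕ) (τ : ℝ) (lam : Fin d → ℝ)
    (F : Fin d → Measure ℝ) (N : ℝ → Ω → ℕ) (Z : Fin d → ℕ → Ω → ℝ) : Prop where
  partition : IsPeriodicPartition s d τ
  intensity_nonneg : ∀ j, 0 ≤ lam j
  poisson : IsPoissonProcess μ (cumIntensity s d lam) N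
  marks_measurable : ∀ j n, Measurable (Z j n)
  marks_law : ∀ j n, HasLaw (Z j n) (F j) μ
  marks_indep : iIndepFun (fun i : Fin d × ℕ => Z i.1 i.2) μ
  second_moment : ∀ j, Integrable (fun z : ℝ => z ^ 2) (F j)
  marks_indep_count :
    IndepFun (fun ω (t : ℝ≥0) => N t ω) (fun ω (i : Fin d × ℕ) => Z i.1 i.2 ω) μ

/-! ### Pathwise integrals

The driving path is a drift plus finitely many jumps on bounded intervals, so integrals against it,
and against its quadratic variation `[S,S]_t = ∑_{n < N t} (ζ n)²`, are Lebesgue–Stieltjes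
integrals along the path. -/

/-- `∫_{(s,t]} H_u dS_u`. -/
def integralS (δ : ℝ) (N : ℝ → Ω → ℕ) (ζ : ℕ → Ω → ℝ) (H : ℝ → Ω → ℝ) (s t : ℝ) (ω : Ω) : ℝ :=
  δ * (∫ u in s..t, H u ω) +
    ∑ n ∈ Finset.Ico (N s ω) (N t ω), H (arrivalTime N n ω) ω * ζ n ω

/-- `∫_{(0,t]} H_u d[S,S]_u`. -/
def integralQV (N : ℝ → Ω → ℕ) (ζ : ℕ → Ω → ℝ) (H : ℝ → Ω → ℝ) (t : ℝ) (ω : Ω) : ℝ :=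
  ∑ n ∈ Finset.range (N t ω), H (arrivalTime N n ω) ω * ζ n ω ^ 2

/-! ### The COGARCH state, volatility and price processes -/

/-- The companion matrix with last row `-β_q, ..., -β_1`, where `β i` stands for `β_{i+1}`. -/
def companion {q : ℕ} (β : Fin q → ℝ) : Matrix (Fin q) (Fin q) ℝ :=
  Matrix.of fun i j =>
    if (i : ℕ) + 1 = q then -β j.rev else if (j : ℕ) = (i : ℕ) + 1 then 1 else 0

/-- The last standard basis vector. -/
def lastVec (q : ℕ) : Fin q → ℝ := fun i => if (i : ℕ) + 1 = q then 1 else 0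

/-- The parameters of a COGARCH(p,q) model; `a i` stands for `α_{i+1}`. -/
structure IsCogarchParam (p q : ℕ) (α₀ : ℝ) (a β : Fin q → ℝ) : Prop where
  one_le : 1 ≤ p
  le : p ≤ q
  alpha_zero_pos : 0 < α₀
  alpha_ne : ∀ i : Fin q, (i : ℕ) + 1 = p → a i ≠ 0
  alpha_eq_zero : ∀ i : Fin q, p < (i : ℕ) + 1 → a i = 0
  beta_ne : ∀ i : Fin q, (i : ℕ) + 1 = q → β i ≠ 0

/-- `α₀ + a' Y_{t-}` for `t > 0`, and `α₀ + a' Y_0` at `t = 0`. -/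
def volatility {q : ℕ} (α₀ : ℝ) (a : Fin q → ℝ) (Y : ℝ → Ω → Fin q → ℝ) (t : ℝ) (ω : Ω) : ℝ :=
  α₀ + a ⬝ᵥ (if 0 < t then Function.leftLim (fun u => Y u ω) t else Y 0 ω)

/-- `Y` is a càdlàg solution of `dY_t = B Y_{t-} dt + e (α₀ + a' Y_{t-}) d[S,S]_t`, `t > 0`, whose
initial value is independent of the driving process `S` (with counting process `N` and jump
sizes `ζ`). -/
structure IsStateProcess {q : ℕ} (μ : Measure Ω) (α₀ : ℝ) (a β : Fin q → ℝ) (δ : ℝ)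
    (N : ℝ → Ω → ℕ) (ζ : ℕ → Ω → ℝ) (Y : ℝ → Ω → Fin q → ℝ) : Prop where
  measurable : ∀ t, 0 ≤ t → Measurable (Y t)
  initial_indep : IndepFun (Y 0) (fun ω (t : ℝ≥0) => drivingProcess δ N ζ t ω) μ
  right_cont : ∀ᵐ ω ∂μ, ∀ t, 0 ≤ t → ContinuousWithinAt (fun u => Y u ω) (Set.Ici t) t
  left_lim : ∀ᵐ ω ∂μ, ∀ t, 0 < t → ∃ y, Tendsto (fun u => Y u ω) (𝓝[<] t) (𝓝 y)
  equation : ∀ᵐ ω ∂μ, ∀ t, 0 ≤ t →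
    Y t ω = Y 0 ω + (∫ u in (0 : ℝ)..t, companion β *ᵥ Function.leftLim (fun v => Y v ω) u)
      + integralQV N ζ (volatility α₀ a Y) t ω • lastVec q

/-- `G_t^{(l)} = ∫_{(t,t+l]} √V_u dS_u`, the increment of `G` over `(t, t+l]`. -/
def priceIncrement (δ : ℝ) (N : ℝ → Ω → ℕ) (ζ : ℕ → Ω → ℝ) (V : ℝ → Ω → ℝ) (l t : ℝ) (ω : Ω) : ℝ :=
  integralS δ N ζ (fun u ω => √(V u ω)) t (t + l) ω

/-! ### The stability conditions -/

/-- The operator norm on `ℂ^q` induced by the `L^r` vector norm. -/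
def matrixLpNorm {q : ℕ} (r : ℝ≥0∞) (C : Matrix (Fin q) (Fin q) ℂ) : ℝ :=
  ⨆ c : {c : Fin q → ℂ // c ≠ 0}, ‖WithLp.toLp r (C *ᵥ c.1)‖ / ‖WithLp.toLp r c.1‖

/-- The companion matrix as a complex matrix. -/
def companionC {q : ℕ} (β : Fin q → ℝ) : Matrix (Fin q) (Fin q) ℂ :=
  (companion β).map Complex.ofReal

/-- The largest real part of an eigenvalue of the companion matrix. -/
def spectralAbscissa {q : ℕ} (β : Fin q → ℝ) : ℝ :=
  sSup (Complex.re '' spectrum ℂ (companionC β))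

/-- The eigenvalues of the companion matrix (the roots of its characteristic polynomial) are
distinct and have strictly negative real parts. -/
def DistinctStableEigenvalues {q : ℕ} (β : Fin q → ℝ) : Prop :=
  (companionC β).charpoly.roots.Nodup ∧ ∀ z ∈ (companionC β).charpoly.roots, z.re < 0

/-- The log-moment condition: for some `r ∈ [1,∞]` and some `P` diagonalising the companion matrix
`B`, `∫ log (1 + ‖P⁻¹ e a' P‖_r z²) F_j(dz) < -η τ / (Λ(t+τ) - Λ(t))` for `t ∈ [0,τ]` and all `j`.
The denominator is nonnegative and is multiplied out, so that the bound is `+∞` if it vanishes. -/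
def LogMomentCondition {q : ℕ} (a β : Fin q → ℝ) (s : ℕ → ℝ) (d : ℕ) (τ : ℝ) (lam : Fin d → ℝ)
    (F : Fin d → Measure ℝ) : Prop :=
  ∃ (r : ℝ≥0∞) (P : Matrix (Fin q) (Fin q) ℂ), 1 ≤ r ∧ IsUnit P ∧
    (P⁻¹ * companionC β * P).IsDiag ∧
    ∀ t ∈ Set.Icc 0 τ, ∀ j : Fin d,
      (cumIntensity s d lam (t + τ) - cumIntensity s d lam t) *
        (∫ z, Real.log (1 + matrixLpNorm r
          (P⁻¹ * (Matrix.vecMulVec (lastVec q) a).map Complex.ofReal * P) * z ^ 2) ∂(F j))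
      < -spectralAbscissa β * τ

/-- The state process is in its periodic regime: for every `t ∈ [0,τ)`, the random vector `Y_t` has
the law of the limit in distribution of `Y_{t+mτ}` as `m → ∞`. -/
def HasLimitLaw {q : ℕ} (μ : Measure Ω) [IsProbabilityMeasure μ] (τ : ℝ)
    (Y : ℝ → Ω → Fin q → ℝ) : Prop :=
  ∀ t ∈ Set.Ico 0 τ,
    TendstoInDistribution (fun (m : ℕ) => Y (t + m * τ)) atTop (Y t) (fun _ => μ) μ

/-- The covariance of `X` and `X'` is defined: `X`, `X'` and `X X'` are integrable. -/
def CovExists (X X' : Ω → ℝ) (μ : Measure Ω) : Prop :=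
  Integrable X μ ∧ Integrable X' μ ∧ Integrable (fun ω => X ω * X' ω) μ

end SLDCogarch

end

/-! The driver `S` has centred increments that are independent of the past and have a `τ`-periodic
law. Heuristically, `G` is therefore a martingale transform of `S`, and `(Y, G)` is a Markov system
whose transitions repeat with period `τ`. The proof makes both statements rigorous by
discretisation. On almost every path `S` is a drift plus finitely many jumps on bounded intervals,
so `Y` and `∫ √V dS` are limits of one Euler scheme that sees only the increments of `S` on a
uniform grid (`IsPathSolution.tendsto_euler`, `IsStateProcess.isEulerLimit`). Each property of the
pair is proved for the scheme by induction on the steps and then passed to the limit.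

What the scheme needs from the driver is collected in `IsDriver` and proved in `IsSLCP.isDriver`.
Inside one phase, once the count `N u` is fixed, past and increment are functions of independent
blocks of counts and marks, and the increment is a drift plus a compound Poisson variable
(`IsSLCP.measure_past_inter_increment`). Longer intervals are cut at the partition points. The
filtration also contains `Y 0`.

For (a), let `W` be measurable at the left end of the window. The discrete integral times a bounded
`W` has mean zero, because each new increment is centred and independent of its coefficient. For a
bounded initial state the second moments are bounded uniformly in the mesh, which gives the uniform
integrability for the limit. Truncating the state and `W` on an event of the past and removing the
truncation by dominated convergence leaves only the integrability of the limit product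
(`IsDriver.integral_mul_eq_zero`). Taking `W = 1` gives the mean; taking for `W` the earlier window,
which is over by time `t + h` since `l ≤ h`, gives the covariance.

For (b), the schemes started at `u` and at `u + τ` have the same law when their initial values do
(`IsDriver.identDistrib_step`), so everything reduces to `Y 0` and `Y τ` having the same law. This
is invariance of a limit law under a Feller transition: one period maps a bounded Lipschitz `φ` to a
bounded Lipschitz `ψ`, the same for every period, so weak convergence of `Y (m τ)` to `Y 0` applies
to both (`IsDriver.exists_transition`, `IsDriver.identDistrib_period`). The pairs of increments then
have equal joint laws, hence so do their squares. -/

set_option linter.unusedSectionVars false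

noncomputable section

namespace SLDCogarch

/-! ### The Euler scheme for an affine equation driven by a jump path -/

/-- The coefficients of the equation `dY = B Y₋ dt + (α₀ + φ Y₋) e d[S,S]`, with `δ` the drift
of `S`. -/
structure Coeff (E : Type*) [NormedAddCommGroup E] [NormedSpace ℝ E] where
  drift : ℝ
  base : ℝ
  lin : E →L[ℝ] E
  form : E →L[ℝ] ℝ
  dir : E

namespace Coeff

variable {E : Type*} [NormedAddCommGroup E] [NormedSpace ℝ E] (c : Coeff E)

/-- The volatility `α₀ + φ y` of a state `y`. -/
def vol (y : E) : ℝ := c.base + c.form y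

/-- The state after a time step `h` in which the driver has increased by `x`. -/
def stateStep (h x : ℝ) (y : E) : E :=
  y + h • c.lin y + (c.vol y * (x - c.drift * h) ^ 2) • c.dir

/-- A step of the Euler scheme for the pair of the state and the integral `∫ √V dS`. -/
def step (h x : ℝ) (z : E × ℝ) : E × ℝ :=
  (c.stateStep h x z.1, z.2 + √(c.vol z.1) * x)

/-- The Euler scheme with time step `h`, driven by the increments `x`. -/
def euler (h : ℝ) (x : ℕ → ℝ) (z : E × ℝ) : ℕ → E × ℝ
  | 0 => z
  | k + 1 => c.step h (x k) (euler h x z k)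

end Coeff

/-- The increment of `S` over the `k`-th cell of length `h` after `u`. -/
def gridIncrement (S : ℝ → ℝ) (u h : ℝ) (k : ℕ) : ℝ := S (u + (k + 1 : ℕ) * h) - S (u + k * h)

/-- Induction with `1 + a ≤ exp a`; the exponential of the full sum also dominates the weight of
each new remainder `r k`. -/
lemma discrete_gronwall {e a r : ℕ → ℝ} {n : ℕ} (ha : ∀ k, 0 ≤ a k) (hr : ∀ k, 0 ≤ r k)
    (h0 : e 0 ≤ 0) (h : ∀ k < n, e (k + 1) ≤ (1 + a k) * e k + r k) :
    ∀ k ≤ n, e k ≤ Real.exp (∑ i ∈ Finset.range k, a i) * ∑ i ∈ Finset.range k, r i := by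
  intro k
  induction k with
  | zero => intro _; simpa using h0
  | succ k ih =>
    intro hk
    have h1 := ih (by omega)
    have h2 := h k (by omega)
    have ha' : ∀ m, 0 ≤ ∑ i ∈ Finset.range m, a i := fun m => Finset.sum_nonneg fun i _ => ha i
    have hr' : 0 ≤ ∑ i ∈ Finset.range k, r i := Finset.sum_nonneg fun i _ => hr i
    have h3 : 1 + a k ≤ Real.exp (a k) := by linarith [Real.add_one_le_exp (a k)]
    rw [Finset.sum_range_succ r k, mul_add]
    have h4 : r k ≤ Real.exp (∑ i ∈ Finset.range (k + 1), a i) * r k :=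
      le_mul_of_one_le_left (hr k) (Real.one_le_exp (ha' _))
    have h5 : (1 + a k) * e k ≤
        Real.exp (∑ i ∈ Finset.range (k + 1), a i) * ∑ i ∈ Finset.range k, r i := by
      rw [Finset.sum_range_succ, Real.exp_add, mul_comm (Real.exp _) (Real.exp (a k)), mul_assoc]
      calc (1 + a k) * e k ≤ (1 + a k) *
            (Real.exp (∑ i ∈ Finset.range k, a i) * ∑ i ∈ Finset.range k, r i) :=
            mul_le_mul_of_nonneg_left h1 (by linarith [ha k])
        _ ≤ _ := mul_le_mul_of_nonneg_right h3 (by positivity)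
    linarith

lemma sum_range_sum_Ico {M : Type*} [AddCommMonoid M] (f : ℕ → M) {m : ℕ → ℕ} (k : ℕ)
    (hm : ∀ i < k, m i ≤ m (i + 1)) :
    ∑ i ∈ Finset.range k, ∑ n ∈ Finset.Ico (m i) (m (i + 1)), f n =
      ∑ n ∈ Finset.Ico (m 0) (m k), f n := by
  have key : m 0 ≤ m k ∧ ∑ i ∈ Finset.range k, ∑ n ∈ Finset.Ico (m i) (m (i + 1)), f n =
      ∑ n ∈ Finset.Ico (m 0) (m k), f n := by
    induction k with
    | zero => simp
    | succ k ih =>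
      obtain ⟨h1, h2⟩ := ih fun i hi => hm i (by omega)
      have h3 := hm k (by omega)
      exact ⟨h1.trans h3, by rw [Finset.sum_range_succ, h2, Finset.sum_Ico_consecutive _ h1 h3]⟩
  exact key.2

/-- Hölder continuity of exponent 1/2, on all of `ℝ` because `√` vanishes on negative numbers. It
can thus be applied to Euler states, whose volatility may be negative. -/
lemma abs_sqrt_sub_sqrt_le (x y : ℝ) : |√x - √y| ≤ √|x - y| := by
  wlog hxy : y ≤ x generalizing x y
  · rw [abs_sub_comm, abs_sub_comm x]; exact this y x (by linarith)
  rw [abs_of_nonneg (by linarith : (0 : ℝ) ≤ x - y),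
    abs_of_nonneg (by linarith [Real.sqrt_le_sqrt hxy])]
  rcases le_or_gt y 0 with hy | hy
  · rw [Real.sqrt_eq_zero_of_nonpos hy, sub_zero]
    exact Real.sqrt_le_sqrt (by linarith)
  · rw [sub_le_iff_le_add]
    apply Real.sqrt_le_iff.2 ⟨by positivity, ?_⟩
    have h1 := Real.sq_sqrt hy.le
    have h2 := Real.sq_sqrt (by linarith : (0 : ℝ) ≤ x - y)
    nlinarith [Real.sqrt_nonneg y, Real.sqrt_nonneg (x - y)]

variable {E : Type*} [NormedAddCommGroup E] [NormedSpace ℝ E] [CompleteSpace E]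

/-- `Y` solves the equation with coefficients `c` on `[u, v]`, along a path with jump count `N`,
jump sizes `ζ` and jump times `arr`; `Yl` are the left limits. -/
structure IsPathSolution (c : Coeff E) (u v : ℝ) (N : ℝ → ℕ) (ζ arr : ℕ → ℝ) (Y Yl : ℝ → E)
    (M : ℝ) : Prop where
  mono : MonotoneOn N (Set.Icc u v)
  arr_le_iff : ∀ w ∈ Set.Icc u v, ∀ n, N u ≤ n → n < N v → (arr n ≤ w ↔ n < N w)
  arr_lt : ∀ n, N u ≤ n → n + 1 < N v → arr n < arr (n + 1)
  bound : ∀ w ∈ Set.Icc u v, ‖Y w‖ ≤ M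
  left_lim : ∀ w ∈ Set.Ioc u v, Tendsto Y (𝓝[<] w) (𝓝 (Yl w))
  meas : AEStronglyMeasurable Yl (volume.restrict (Set.Ioc u v))
  equation : ∀ a b, u ≤ a → a ≤ b → b ≤ v → Y b = Y a + (∫ r in a..b, c.lin (Yl r)) +
    (∑ n ∈ Finset.Ico (N a) (N b), c.vol (Yl (arr n)) * ζ n ^ 2) • c.dir

/-- `∫_{(a,b]} √V dS` along the path. -/
def pathIntegral (c : Coeff E) (N : ℝ → ℕ) (ζ arr : ℕ → ℝ) (Yl : ℝ → E) (a b : ℝ) : ℝ :=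
  c.drift * (∫ r in a..b, √(c.vol (Yl r))) +
    ∑ n ∈ Finset.Ico (N a) (N b), √(c.vol (Yl (arr n))) * ζ n

/-! ### Error of a single Euler step -/

namespace IsPathSolution

variable {c : Coeff E} {u v : ℝ} {N : ℝ → ℕ} {ζ arr : ℕ → ℝ} {Y Yl : ℝ → E} {M : ℝ}

lemma bound_left (H : IsPathSolution c u v N ζ arr Y Yl M) {w : ℝ} (hw : w ∈ Set.Ioc u v) :
    ‖Yl w‖ ≤ M := by
  refine le_of_tendsto (H.left_lim w hw).norm ?_
  filter_upwards [Ioo_mem_nhdsLT hw.1] with r hr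
  exact H.bound r ⟨hr.1.le, hr.2.le.trans hw.2⟩

lemma bound_nonneg (H : IsPathSolution c u v N ζ arr Y Yl M) (huv : u ≤ v) : 0 ≤ M :=
  (norm_nonneg _).trans (H.bound u ⟨le_rfl, huv⟩)

lemma integrable_comp (H : IsPathSolution c u v N ζ arr Y Yl M) {F : Type*}
    [NormedAddCommGroup F] {f : E → F} (hf : Continuous f) {K : ℝ}
    (hK : ∀ y, ‖y‖ ≤ M → ‖f y‖ ≤ K) {a b : ℝ} (ha : u ≤ a) (hab : a ≤ b) (hb : b ≤ v) :
    IntervalIntegrable (fun r => f (Yl r)) volume a b := by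
  rw [intervalIntegrable_iff_integrableOn_Ioc_of_le hab]
  have hsub : Set.Ioc a b ⊆ Set.Ioc u v := Set.Ioc_subset_Ioc ha hb
  have hm : AEStronglyMeasurable (fun r => f (Yl r)) (volume.restrict (Set.Ioc a b)) :=
    hf.comp_aestronglyMeasurable (H.meas.mono_measure (Measure.restrict_mono hsub le_rfl))
  refine ⟨hm, .of_bounded (C := K) ?_⟩
  filter_upwards [ae_restrict_mem measurableSet_Ioc] with w hw
  exact hK _ (H.bound_left (hsub hw))

lemma integrable_lin (H : IsPathSolution c u v N ζ arr Y Yl M) {a b : ℝ} (ha : u ≤ a)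
    (hab : a ≤ b) (hb : b ≤ v) : IntervalIntegrable (fun r => c.lin (Yl r)) volume a b :=
  H.integrable_comp c.lin.continuous (K := ‖c.lin‖ * M)
    (fun y hy => (c.lin.le_opNorm y).trans (by gcongr)) ha hab hb

lemma abs_vol_sub (y y' : E) : |c.vol y - c.vol y'| ≤ ‖c.form‖ * ‖y - y'‖ := by
  have : c.vol y - c.vol y' = c.form (y - y') := by simp [Coeff.vol]
  rw [this]
  exact c.form.le_opNorm _

lemma continuous_sqrt_vol : Continuous fun y => √(c.vol y) := by
  unfold Coeff.vol; fun_prop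

lemma abs_sqrt_vol_sub (y y' : E) : |√(c.vol y) - √(c.vol y')| ≤ √(‖c.form‖ * ‖y - y'‖) :=
  (abs_sqrt_sub_sqrt_le _ _).trans (Real.sqrt_le_sqrt (abs_vol_sub y y'))

lemma integrable_sqrt (H : IsPathSolution c u v N ζ arr Y Yl M) {a b : ℝ} (ha : u ≤ a)
    (hab : a ≤ b) (hb : b ≤ v) :
    IntervalIntegrable (fun r => √(c.vol (Yl r))) volume a b :=
  H.integrable_comp continuous_sqrt_vol (K := √(c.vol 0) + √(‖c.form‖ * M))
    (fun y hy => by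
      have h1 := abs_sqrt_vol_sub (c := c) y 0
      have h2 : √(‖c.form‖ * ‖y - 0‖) ≤ √(‖c.form‖ * M) :=
        Real.sqrt_le_sqrt (by rw [sub_zero]; gcongr)
      rw [Real.norm_eq_abs, abs_of_nonneg (Real.sqrt_nonneg _)]
      linarith [(abs_le.1 h1).2]) ha hab hb

/-- Without a jump in `[a, w)` only the drift moves the state; a jump at `w` itself does not reach
the left limit. -/
lemma left_sub_le (H : IsPathSolution c u v N ζ arr Y Yl M) {a w : ℝ} (ha : u ≤ a)
    (haw : a < w) (hw : w ≤ v) (hN : ∀ r, a ≤ r → r < w → N r = N a) :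
    ‖Yl w - Y a‖ ≤ ‖c.lin‖ * M * (w - a) := by
  have h1 := (H.left_lim w ⟨ha.trans_lt haw, hw⟩).sub_const (Y a)
  refine le_of_tendsto h1.norm ?_
  filter_upwards [Ioo_mem_nhdsLT haw] with r hr
  have h2 := H.equation a r ha hr.1.le (hr.2.le.trans hw)
  rw [hN r hr.1.le hr.2, Finset.Ico_self, Finset.sum_empty, zero_smul, add_zero] at h2
  rw [h2, add_sub_cancel_left]
  have h3 : ‖∫ r in a..r, c.lin (Yl r)‖ ≤ ‖c.lin‖ * M * |r - a| := by
    refine intervalIntegral.norm_integral_le_of_norm_le_const fun x hx => ?_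
    rw [Set.uIoc_of_le hr.1.le] at hx
    refine (c.lin.le_opNorm _).trans ?_
    have := H.bound_left (w := x) ⟨ha.trans_lt hx.1, hx.2.trans (hr.2.le.trans hw)⟩
    gcongr
  rw [abs_of_nonneg (by linarith [hr.1])] at h3
  have hM : 0 ≤ M := H.bound_nonneg (ha.trans (haw.le.trans hw))
  refine h3.trans ?_
  have := hr.2.le
  gcongr

/-- The integrand of the jump term is taken just before the jump, and up to then the state has only
drifted. This is why the frozen state `Y a` is accurate to order `b - a` even in a cell with a jump.
-/
lemma one_jump (H : IsPathSolution c u v N ζ arr Y Yl M) {a b : ℝ} (ha : u ≤ a)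
    (hab : a ≤ b) (hb : b ≤ v) (hN : N b = N a + 1) :
    a < arr (N a) ∧ arr (N a) ≤ b ∧ ‖Yl (arr (N a)) - Y a‖ ≤ ‖c.lin‖ * M * (b - a) := by
  have hua : N u ≤ N a := H.mono ⟨le_rfl, ha.trans (hab.trans hb)⟩ ⟨ha, hab.trans hb⟩ ha
  have hbv : N b ≤ N v :=
    H.mono ⟨ha.trans hab, hb⟩ ⟨ha.trans (hab.trans hb), le_rfl⟩ hb
  have key : ∀ r, a ≤ r → r ≤ b → (arr (N a) ≤ r ↔ N a < N r) := fun r h1 h2 =>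
    H.arr_le_iff r ⟨ha.trans h1, h2.trans hb⟩ (N a) hua (by omega)
  have h1 : a < arr (N a) := by
    by_contra! h
    exact lt_irrefl _ ((key a le_rfl hab).1 h)
  have h2 : arr (N a) ≤ b := (key b hab le_rfl).2 (by omega)
  refine ⟨h1, h2, (H.left_sub_le ha h1 (h2.trans hb) fun r hr1 hr2 => ?_).trans ?_⟩
  · have h3 : ¬ N a < N r := fun h => absurd ((key r hr1 (hr2.le.trans h2)).2 h) (not_le.2 hr2)
    have h4 : N a ≤ N r := H.mono ⟨ha, hab.trans hb⟩ ⟨ha.trans hr1, (hr2.le.trans h2).trans hb⟩ hr1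
    omega
  · have hM : 0 ≤ M := H.bound_nonneg (ha.trans (hab.trans hb))
    gcongr

/-- After a jump nothing better than `2 * M` is available. The factor `N b - N a` records that this
happens in few cells. -/
lemma left_sub_le' (H : IsPathSolution c u v N ζ arr Y Yl M) {a b w : ℝ} (ha : u ≤ a)
    (haw : a < w) (hwb : w ≤ b) (hb : b ≤ v) :
    ‖Yl w - Y a‖ ≤ ‖c.lin‖ * M * (b - a) + 2 * M * ((N b : ℝ) - N a) := by
  have hM : 0 ≤ M := H.bound_nonneg (ha.trans (haw.le.trans (hwb.trans hb)))
  have hm : ∀ r r', a ≤ r → r ≤ r' → r' ≤ b → N r ≤ N r' := fun r r' h1 h2 h3 =>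
    H.mono ⟨ha.trans h1, h2.trans (h3.trans hb)⟩ ⟨ha.trans (h1.trans h2), h3.trans hb⟩ h2
  have hab := hm a b le_rfl (haw.le.trans hwb) le_rfl
  have h0 : 0 ≤ ‖c.lin‖ * M * (b - a) := by
    have : 0 ≤ b - a := by linarith
    positivity
  rcases hab.eq_or_lt with h | h
  · have := H.left_sub_le ha haw (hwb.trans hb) fun r h1 h2 => by
      have h3 := hm a r le_rfl h1 (h2.le.trans hwb)
      have h4 := hm r b h1 (h2.le.trans hwb) le_rfl
      omega
    rw [h, sub_self, mul_zero, add_zero]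
    refine this.trans ?_
    gcongr
  · have h1 : (1 : ℝ) ≤ (N b : ℝ) - N a := by
      have : (N a : ℝ) + 1 ≤ N b := by exact_mod_cast h
      linarith
    have h2 : ‖Yl w - Y a‖ ≤ 2 * M := by
      have h3 := H.bound_left (w := w) ⟨ha.trans_lt haw, hwb.trans hb⟩
      have h4 := H.bound a ⟨ha, haw.le.trans (hwb.trans hb)⟩
      linarith [norm_sub_le (Yl w) (Y a)]
    nlinarith

/-- The bound carries a factor `b - a` times a quantity whose sum over all cells stays bounded as
the mesh shrinks, so the local errors add up to the order of the mesh. -/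
lemma state_cell (H : IsPathSolution c u v N ζ arr Y Yl M) {a b x : ℝ} (ha : u ≤ a)
    (hab : a ≤ b) (hb : b ≤ v) (hN : N b ≤ N a + 1)
    (hx : x = ∑ n ∈ Finset.Ico (N a) (N b), ζ n) :
    ‖Y b - (Y a + (b - a) • c.lin (Y a) + (c.vol (Y a) * x ^ 2) • c.dir)‖ ≤
      (‖c.lin‖ ^ 2 * M + 2 * ‖c.lin‖ * M + ‖c.form‖ * ‖c.lin‖ * M * ‖c.dir‖) *
        ((b - a) * ((b - a) + ((N b : ℝ) - N a) + x ^ 2)) := by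
  have hM : 0 ≤ M := H.bound_nonneg (ha.trans (hab.trans hb))
  have hba : 0 ≤ b - a := by linarith
  have hm : N a ≤ N b := H.mono ⟨ha, hab.trans hb⟩ ⟨ha.trans hab, hb⟩ hab
  have hm' : (0 : ℝ) ≤ (N b : ℝ) - N a := by
    have : (N a : ℝ) ≤ N b := by exact_mod_cast hm
    linarith
  have hI : ‖(∫ r in a..b, c.lin (Yl r)) - (b - a) • c.lin (Y a)‖ ≤
      ‖c.lin‖ * (‖c.lin‖ * M * (b - a) + 2 * M * ((N b : ℝ) - N a)) * (b - a) := by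
    have h1 : (∫ r in a..b, c.lin (Yl r)) - (b - a) • c.lin (Y a) =
        ∫ r in a..b, c.lin (Yl r) - c.lin (Y a) := by
      rw [intervalIntegral.integral_sub (H.integrable_lin ha hab hb)
        intervalIntegrable_const, intervalIntegral.integral_const]
    rw [h1]
    have h2 := intervalIntegral.norm_integral_le_of_norm_le_const (a := a) (b := b)
      (f := fun r => c.lin (Yl r) - c.lin (Y a))
      (C := ‖c.lin‖ * (‖c.lin‖ * M * (b - a) + 2 * M * ((N b : ℝ) - N a))) fun x hx => by
        rw [Set.uIoc_of_le hab] at hx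
        rw [← map_sub]
        refine (c.lin.le_opNorm _).trans ?_
        gcongr
        exact H.left_sub_le' ha hx.1 hx.2 hb
    rwa [abs_of_nonneg hba] at h2
  have hJ : ‖(∑ n ∈ Finset.Ico (N a) (N b), c.vol (Yl (arr n)) * ζ n ^ 2) • c.dir
      - (c.vol (Y a) * x ^ 2) • c.dir‖ ≤ ‖c.form‖ * (‖c.lin‖ * M * (b - a)) * x ^ 2 * ‖c.dir‖ := by
    rcases hm.eq_or_lt with h | h
    · rw [← h, Finset.Ico_self, Finset.sum_empty] at hx
      rw [← h, Finset.Ico_self, Finset.sum_empty, hx]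
      simp
    · have h' : N b = N a + 1 := by omega
      obtain ⟨-, -, h3⟩ := H.one_jump ha hab hb h'
      rw [h', Nat.Ico_succ_singleton, Finset.sum_singleton] at hx
      rw [h', Nat.Ico_succ_singleton, Finset.sum_singleton, ← sub_smul, norm_smul, ← hx, ← sub_mul,
        norm_mul, Real.norm_eq_abs, Real.norm_eq_abs, abs_of_nonneg (sq_nonneg x)]
      have h4 := abs_vol_sub (c := c) (Yl (arr (N a))) (Y a)
      gcongr
      exact h4.trans (by gcongr)
  have heq := H.equation a b ha hab hb
  have h5 : Y b - (Y a + (b - a) • c.lin (Y a) + (c.vol (Y a) * x ^ 2) • c.dir) =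
      ((∫ r in a..b, c.lin (Yl r)) - (b - a) • c.lin (Y a)) +
      ((∑ n ∈ Finset.Ico (N a) (N b), c.vol (Yl (arr n)) * ζ n ^ 2) • c.dir
      - (c.vol (Y a) * x ^ 2) • c.dir) := by
    rw [heq]; abel
  rw [h5]
  refine (norm_add_le _ _).trans ((add_le_add hI hJ).trans ?_)
  have e1 : 0 ≤ ‖c.lin‖ ^ 2 * M * ((b - a) * (((N b : ℝ) - N a) + x ^ 2)) := by positivity
  have e2 : 0 ≤ 2 * ‖c.lin‖ * M * ((b - a) * ((b - a) + x ^ 2)) := by positivity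
  have e3 : 0 ≤ ‖c.form‖ * ‖c.lin‖ * M * ‖c.dir‖ * ((b - a) * ((b - a) + ((N b : ℝ) - N a))) := by
    positivity
  nlinarith

/-- The jump term sees the state just before the jump, within drift and `ε` of the Euler state. The
drift term also sees the state after the jump, where the error is of order one, but it carries the
factor `b - a`; this is the last summand. -/
lemma pathIntegral_cell (H : IsPathSolution c u v N ζ arr Y Yl M) {a b x : ℝ} (ha : u ≤ a)
    (hab : a ≤ b) (hb : b ≤ v) (hN : N b ≤ N a + 1)
    (hx : x = ∑ n ∈ Finset.Ico (N a) (N b), ζ n) {y : E} {ε : ℝ} (hy : ‖Y a - y‖ ≤ ε) :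
    |pathIntegral c N ζ arr Yl a b - √(c.vol y) * (c.drift * (b - a) + x)| ≤
      (|c.drift| * (b - a) + |x|) * √(‖c.form‖ * (‖c.lin‖ * M * (b - a) + ε)) +
        |c.drift| * (b - a) * √(‖c.form‖ * (2 * M)) * ((N b : ℝ) - N a) := by
  have hM : 0 ≤ M := H.bound_nonneg (ha.trans (hab.trans hb))
  have hε : 0 ≤ ε := (norm_nonneg _).trans hy
  have hba : 0 ≤ b - a := by linarith
  have hm : N a ≤ N b := H.mono ⟨ha, hab.trans hb⟩ ⟨ha.trans hab, hb⟩ hab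
  set ω := √(‖c.form‖ * (‖c.lin‖ * M * (b - a) + ε)) with hω
  set R := √(‖c.form‖ * (2 * M)) with hR
  have hcell : ∀ w, a < w → w ≤ b →
      |√(c.vol (Yl w)) - √(c.vol y)| ≤ ω + R * ((N b : ℝ) - N a) := by
    intro w h1 h2
    have h3 := H.left_sub_le' ha h1 h2 hb
    have h4 : ‖Yl w - y‖ ≤ ‖c.lin‖ * M * (b - a) + 2 * M * ((N b : ℝ) - N a) + ε := by
      have : Yl w - y = (Yl w - Y a) + (Y a - y) := by abel
      rw [this]
      exact (norm_add_le _ _).trans (add_le_add h3 hy)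
    refine (abs_sqrt_vol_sub _ _).trans ?_
    refine (Real.sqrt_le_sqrt (mul_le_mul_of_nonneg_left h4 (norm_nonneg c.form))).trans ?_
    rcases hm.eq_or_lt with h | h
    · rw [h]; simp [hω]
    · have h' : N b = N a + 1 := by omega
      rw [h']
      push_cast
      rw [add_sub_cancel_left, mul_one, mul_one, hω, hR, add_right_comm, mul_add ‖c.form‖ (_ + ε)]
      -- Subadditivity `√(x + y) ≤ √x + √y`, read off from the Hölder bound.
      refine sub_le_iff_le_add.1 ((le_abs_self _).trans ((abs_sqrt_sub_sqrt_le _ _).trans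
        (Real.sqrt_le_sqrt ?_)))
      rw [add_sub_cancel_right, abs_of_nonneg (by positivity)]
  have hI : |(∫ r in a..b, √(c.vol (Yl r))) - √(c.vol y) * (b - a)| ≤
      (ω + R * ((N b : ℝ) - N a)) * (b - a) := by
    have h1 : (∫ r in a..b, √(c.vol (Yl r))) - √(c.vol y) * (b - a) =
        ∫ r in a..b, √(c.vol (Yl r)) - √(c.vol y) := by
      rw [intervalIntegral.integral_sub (H.integrable_sqrt ha hab hb)
        intervalIntegrable_const, intervalIntegral.integral_const, smul_eq_mul, mul_comm]
    rw [h1]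
    have h2 := intervalIntegral.norm_integral_le_of_norm_le_const (a := a) (b := b)
      (f := fun r => √(c.vol (Yl r)) - √(c.vol y))
      (C := ω + R * ((N b : ℝ) - N a)) fun x hx => by
        rw [Set.uIoc_of_le hab] at hx
        exact hcell x hx.1 hx.2
    rwa [abs_of_nonneg hba] at h2
  have hJ : |(∑ n ∈ Finset.Ico (N a) (N b), √(c.vol (Yl (arr n))) * ζ n) - √(c.vol y) * x| ≤
      |x| * ω := by
    rcases hm.eq_or_lt with h | h
    · rw [← h, Finset.Ico_self, Finset.sum_empty] at hx
      rw [← h, Finset.Ico_self, Finset.sum_empty, hx]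
      simp
    · have h' : N b = N a + 1 := by omega
      obtain ⟨-, -, h3⟩ := H.one_jump ha hab hb h'
      rw [h', Nat.Ico_succ_singleton, Finset.sum_singleton] at hx
      rw [h', Nat.Ico_succ_singleton, Finset.sum_singleton, ← hx, ← sub_mul, abs_mul, mul_comm]
      refine mul_le_mul_of_nonneg_left ?_ (abs_nonneg x)
      refine (abs_sqrt_vol_sub _ _).trans (Real.sqrt_le_sqrt ?_)
      gcongr
      have : Yl (arr (N a)) - y = (Yl (arr (N a)) - Y a) + (Y a - y) := by abel
      rw [this]
      exact (norm_add_le _ _).trans (add_le_add h3 hy)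
  have h5 : pathIntegral c N ζ arr Yl a b - √(c.vol y) * (c.drift * (b - a) + x) =
      c.drift * ((∫ r in a..b, √(c.vol (Yl r))) - √(c.vol y) * (b - a)) +
      ((∑ n ∈ Finset.Ico (N a) (N b), √(c.vol (Yl (arr n))) * ζ n) - √(c.vol y) * x) := by
    unfold pathIntegral; ring
  rw [h5]
  refine (abs_add_le _ _).trans ?_
  rw [abs_mul]
  have := mul_le_mul_of_nonneg_left hI (abs_nonneg c.drift)
  nlinarith

/-- There are finitely many jumps in the interval, at strictly increasing times, so their gaps have
a positive lower bound. -/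
lemma exists_gap (H : IsPathSolution c u v N ζ arr Y Yl M) :
    ∃ η > 0, ∀ a b, u ≤ a → a ≤ b → b ≤ v → b - a < η → N b ≤ N a + 1 := by
  have h1 : ∀ᶠ η in 𝓝[>] (0 : ℝ), ∀ n ∈ Finset.Ico (N u) (N v),
      n + 1 < N v → η < arr (n + 1) - arr n := by
    rw [Finset.eventually_all]
    intro n hn
    rw [Finset.mem_Ico] at hn
    by_cases h : n + 1 < N v
    · have h2 : (0 : ℝ) < arr (n + 1) - arr n := by linarith [H.arr_lt n hn.1 h]
      filter_upwards [Ioo_mem_nhdsGT h2] with η hη _ using hη.2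
    · exact .of_forall fun _ h' => absurd h' h
  obtain ⟨η, h2, h3⟩ := (h1.and self_mem_nhdsWithin).exists
  refine ⟨η, h3, fun a b ha hab hb hη => ?_⟩
  by_contra! h
  have huv := ha.trans (hab.trans hb)
  have hua : N u ≤ N a := H.mono ⟨le_rfl, huv⟩ ⟨ha, hab.trans hb⟩ ha
  have hbv : N b ≤ N v := H.mono ⟨ha.trans hab, hb⟩ ⟨huv, le_rfl⟩ hb
  have h4 := h2 (N a) (by rw [Finset.mem_Ico]; omega) (by omega)
  have h5 := (H.arr_le_iff b ⟨ha.trans hab, hb⟩ (N a + 1) (by omega) (by omega)).2 h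
  have h6 : ¬ arr (N a) ≤ a := fun h' =>
    lt_irrefl _ ((H.arr_le_iff a ⟨ha, hab.trans hb⟩ (N a) hua (by omega)).1 h')
  linarith

end IsPathSolution

end SLDCogarch

/-! ### Accumulation of the errors along a path -/

namespace SLDCogarch

variable {E : Type*} [NormedAddCommGroup E] [NormedSpace ℝ E] [CompleteSpace E]

/-- The step is affine in the state. Since `x - c.drift * h` is the jump part of the increment, the
excess of the Lipschitz constant over 1 has a bounded sum along the grid. -/
lemma Coeff.norm_stateStep_sub_le (c : Coeff E) {h : ℝ} (hh : 0 ≤ h) (x : ℝ) (y y' : E) :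
    ‖c.stateStep h x y - c.stateStep h x y'‖ ≤
      (1 + (h * ‖c.lin‖ + ‖c.form‖ * ‖c.dir‖ * (x - c.drift * h) ^ 2)) * ‖y - y'‖ := by
  have h1 : c.stateStep h x y - c.stateStep h x y' = (y - y') + h • c.lin (y - y') +
      (c.form (y - y') * (x - c.drift * h) ^ 2) • c.dir := by
    simp only [Coeff.stateStep, Coeff.vol, map_sub, smul_sub]
    module
  rw [h1]
  refine (norm_add₃_le).trans ?_
  rw [norm_smul, norm_smul, norm_mul, Real.norm_eq_abs, Real.norm_eq_abs, Real.norm_eq_abs,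
    abs_of_nonneg hh, abs_of_nonneg (sq_nonneg (x - c.drift * h))]
  have h2 := mul_le_mul_of_nonneg_left (c.lin.le_opNorm (y - y')) hh
  have h3 := c.form.le_opNorm (y - y')
  rw [Real.norm_eq_abs] at h3
  have h4 : |c.form (y - y')| * (x - c.drift * h) ^ 2 * ‖c.dir‖ ≤
      ‖c.form‖ * ‖y - y'‖ * (x - c.drift * h) ^ 2 * ‖c.dir‖ := by gcongr
  nlinarith

namespace IsPathSolution

variable {c : Coeff E} {u v : ℝ} {N : ℝ → ℕ} {ζ arr : ℕ → ℝ} {Y Yl : ℝ → E} {M : ℝ}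

lemma pathIntegral_add (H : IsPathSolution c u v N ζ arr Y Yl M) {a b d : ℝ} (ha : u ≤ a)
    (hab : a ≤ b) (hbd : b ≤ d) (hd : d ≤ v) :
    pathIntegral c N ζ arr Yl a d = pathIntegral c N ζ arr Yl a b + pathIntegral c N ζ arr Yl b d := by
  unfold pathIntegral
  rw [← intervalIntegral.integral_add_adjacent_intervals
    (H.integrable_sqrt ha hab (hbd.trans hd)) (H.integrable_sqrt (ha.trans hab) hbd hd),
    ← Finset.sum_Ico_consecutive _
      (H.mono ⟨ha, hab.trans (hbd.trans hd)⟩ ⟨ha.trans hab, hbd.trans hd⟩ hab)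
      (H.mono ⟨ha.trans hab, hbd.trans hd⟩ ⟨ha.trans (hab.trans hbd), hd⟩ hbd)]
  ring

/-- `D` is the Gronwall exponential times the summed local errors of the state, and `K` collects the
same sums for the integral. Both depend on the path but not on the mesh. The integral converges only
at the rate of the square root of the mesh, because of `√V`. -/
lemma euler_error (H : IsPathSolution c u v N ζ arr Y Yl M) (huv : u ≤ v) {S : ℝ → ℝ}
    (hS : ∀ a b, u ≤ a → a ≤ b → b ≤ v →
      S b - S a = c.drift * (b - a) + ∑ n ∈ Finset.Ico (N a) (N b), ζ n)
    {η : ℝ} (hη : ∀ a b, u ≤ a → a ≤ b → b ≤ v → b - a < η → N b ≤ N a + 1) :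
    ∃ K D : ℝ, 0 ≤ D ∧ ∀ (n : ℕ) (h g : ℝ), 0 ≤ h → n * h = v - u → h < η →
      ‖Y v - (c.euler h (gridIncrement S u h) (Y u, g) n).1‖ ≤ D * h ∧
      |g + pathIntegral c N ζ arr Yl u v - (c.euler h (gridIncrement S u h) (Y u, g) n).2| ≤
        K * (√(‖c.form‖ * (‖c.lin‖ * M * h + D * h)) + h) := by
  have hM : 0 ≤ M := H.bound_nonneg huv
  set κ := ‖c.lin‖ ^ 2 * M + 2 * ‖c.lin‖ * M + ‖c.form‖ * ‖c.lin‖ * M * ‖c.dir‖ with hκ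
  have hκ0 : 0 ≤ κ := by positivity
  set m : ℝ := (N v : ℝ) - N u with hm
  set Q : ℝ := ∑ n ∈ Finset.Ico (N u) (N v), ζ n ^ 2 with hQ
  set A : ℝ := ∑ n ∈ Finset.Ico (N u) (N v), |ζ n| with hA
  have hm0 : 0 ≤ m := by
    have : (N u : ℝ) ≤ N v := by
      exact_mod_cast H.mono ⟨le_rfl, huv⟩ ⟨huv, le_rfl⟩ huv
    linarith
  have hQ0 : 0 ≤ Q := Finset.sum_nonneg fun n _ => sq_nonneg _
  have hA0 : 0 ≤ A := Finset.sum_nonneg fun n _ => abs_nonneg _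
  have hT : 0 ≤ v - u := by linarith
  set D : ℝ := Real.exp ((v - u) * ‖c.lin‖ + ‖c.form‖ * ‖c.dir‖ * Q) *
    (κ * ((v - u) + m + Q)) with hD
  have hD0 : 0 ≤ D := by positivity
  set R := √(‖c.form‖ * (2 * M)) with hR
  refine ⟨|c.drift| * (v - u) + A + |c.drift| * R * m, D, hD0, fun n h g hh hn hlt => ?_⟩
  set t : ℕ → ℝ := fun k => u + k * h with ht
  have ht0 : t 0 = u := by simp [ht]
  have htn : t n = v := by simp only [ht]; linarith
  have htk : ∀ k, t (k + 1) - t k = h := fun k => by simp only [ht]; push_cast; ring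
  have htmono : Monotone t := monotone_nat_of_le_succ fun k => by linarith [htk k]
  have htu : ∀ k, u ≤ t k := fun k => ht0 ▸ htmono (Nat.zero_le k)
  have htv : ∀ k ≤ n, t k ≤ v := fun k hk => htn ▸ htmono hk
  have hcell : ∀ k < n, N (t (k + 1)) ≤ N (t k) + 1 := fun k hk =>
    hη _ _ (htu k) (htmono (Nat.le_succ k)) (htv _ hk) (by rw [htk]; exact hlt)
  have hNm : ∀ k < n, N (t k) ≤ N (t (k + 1)) := fun k hk =>
    H.mono ⟨htu k, htv _ hk.le⟩ ⟨htu _, htv _ hk⟩ (htmono (Nat.le_succ k))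
  set ξ : ℕ → ℝ := fun k => ∑ n ∈ Finset.Ico (N (t k)) (N (t (k + 1))), ζ n with hξ
  have hinc : ∀ k < n, gridIncrement S u h k = c.drift * h + ξ k := fun k hk => by
    have := hS _ _ (htu k) (htmono (Nat.le_succ k)) (htv _ hk)
    rw [htk] at this
    exact this
  -- sums over the cells
  have hone : ∀ k < n, ∀ f : ℝ → ℝ, f 0 = 0 →
      f (ξ k) = ∑ n ∈ Finset.Ico (N (t k)) (N (t (k + 1))), f (ζ n) := by
    intro k hk f hf
    have h1 := hcell k hk
    have h2 := hNm k hk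
    rcases h2.eq_or_lt with h3 | h3
    · simp [hξ, ← h3, hf]
    · have h4 : N (t (k + 1)) = N (t k) + 1 := by omega
      simp only [hξ, h4, Nat.Ico_succ_singleton, Finset.sum_singleton]
  have hsumsq : ∑ k ∈ Finset.range n, ξ k ^ 2 = Q := by
    rw [hQ, ← ht0, ← htn]
    rw [← sum_range_sum_Ico _ (m := fun k => N (t k)) n hNm]
    exact Finset.sum_congr rfl fun k hk =>
      hone k (Finset.mem_range.1 hk) (fun x => x ^ 2) (by simp)
  have hsumabs : ∑ k ∈ Finset.range n, |ξ k| = A := by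
    rw [hA, ← ht0, ← htn]
    rw [← sum_range_sum_Ico _ (m := fun k => N (t k)) n hNm]
    exact Finset.sum_congr rfl fun k hk =>
      hone k (Finset.mem_range.1 hk) (fun x => |x|) (by simp)
  have hsumN : ∑ k ∈ Finset.range n, ((N (t (k + 1)) : ℝ) - N (t k)) = m := by
    rw [Finset.sum_range_sub (fun k => (N (t k) : ℝ)), ht0, htn]
  have hsumh : ∑ k ∈ Finset.range n, h = v - u := by simp [hn]
  set z := c.euler h (gridIncrement S u h) (Y u, g) with hz
  have hzs : ∀ k, z (k + 1) = c.step h (gridIncrement S u h k) (z k) := fun k => rfl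
  have hz0 : z 0 = (Y u, g) := rfl
  -- Gronwall asks for `0 ≤ r k` for every `k`, whereas `N` is known to be monotone only on the
  -- first `n` cells; hence the positive part.
  set r : ℕ → ℝ := fun k => κ * (h * (h + max ((N (t (k + 1)) : ℝ) - N (t k)) 0 + ξ k ^ 2)) with hr
  have hr0 : ∀ k, 0 ≤ r k := fun k => by positivity
  set α : ℕ → ℝ := fun k => h * ‖c.lin‖ + ‖c.form‖ * ‖c.dir‖ * ξ k ^ 2 with hα
  have hα0 : ∀ k, 0 ≤ α k := fun k => by positivity
  have hmax : ∀ k < n, max ((N (t (k + 1)) : ℝ) - N (t k)) 0 = (N (t (k + 1)) : ℝ) - N (t k) := by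
    intro k hk
    apply max_eq_left
    have : (N (t k) : ℝ) ≤ N (t (k + 1)) := by exact_mod_cast hNm k hk
    linarith
  have hrec : ∀ k < n, ‖Y (t (k + 1)) - (z (k + 1)).1‖ ≤ (1 + α k) * ‖Y (t k) - (z k).1‖ + r k := by
    intro k hk
    have h1 := H.state_cell (htu k) (htmono (Nat.le_succ k)) (htv _ hk) (hcell k hk)
      (x := ξ k) rfl
    rw [htk] at h1
    have h2 : Y (t k) + h • c.lin (Y (t k)) + (c.vol (Y (t k)) * ξ k ^ 2) • c.dir =
        c.stateStep h (gridIncrement S u h k) (Y (t k)) := by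
      rw [hinc k hk, Coeff.stateStep, add_sub_cancel_left]
    rw [h2] at h1
    have h3 := c.norm_stateStep_sub_le hh (gridIncrement S u h k) (Y (t k)) (z k).1
    rw [hinc k hk, add_sub_cancel_left, ← hinc k hk] at h3
    have h4 : Y (t (k + 1)) - (z (k + 1)).1 =
        (c.stateStep h (gridIncrement S u h k) (Y (t k)) -
          c.stateStep h (gridIncrement S u h k) (z k).1) +
        (Y (t (k + 1)) - c.stateStep h (gridIncrement S u h k) (Y (t k))) := by
      rw [hzs]; simp only [Coeff.step]; abel
    rw [h4]
    refine (norm_add_le _ _).trans (add_le_add h3 ?_)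
    simpa only [hr, hmax k hk] using h1
  have hgron := discrete_gronwall (e := fun k => ‖Y (t k) - (z k).1‖) hα0 hr0
    (by simp [ht0, hz0]) hrec
  have hbound : ∀ k ≤ n, ‖Y (t k) - (z k).1‖ ≤ D * h := by
    intro k hk
    refine (hgron k hk).trans ?_
    have hsub : Finset.range k ⊆ Finset.range n := Finset.range_mono hk
    have h1 : ∑ i ∈ Finset.range k, α i ≤ (v - u) * ‖c.lin‖ + ‖c.form‖ * ‖c.dir‖ * Q := by
      refine (Finset.sum_le_sum_of_subset_of_nonneg hsub fun i _ _ => hα0 i).trans (le_of_eq ?_)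
      simp only [hα]
      rw [Finset.sum_add_distrib, ← Finset.sum_mul, ← Finset.mul_sum, hsumsq, hsumh]
    have h2 : ∑ i ∈ Finset.range k, r i ≤ κ * ((v - u) + m + Q) * h := by
      refine (Finset.sum_le_sum_of_subset_of_nonneg hsub fun i _ _ => hr0 i).trans (le_of_eq ?_)
      have h3 : ∑ i ∈ Finset.range n, r i = ∑ i ∈ Finset.range n,
          κ * (h * (h + ((N (t (i + 1)) : ℝ) - N (t i)) + ξ i ^ 2)) :=
        Finset.sum_congr rfl fun i hi => by
          simp only [hr]; rw [hmax i (Finset.mem_range.1 hi)]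
      rw [h3, ← Finset.mul_sum, ← Finset.mul_sum, Finset.sum_add_distrib, Finset.sum_add_distrib,
        hsumsq, hsumh, hsumN]
      ring
    rw [hD, mul_assoc]
    gcongr
  refine ⟨by simpa [htn] using hbound n le_rfl, ?_⟩
  set ω := √(‖c.form‖ * (‖c.lin‖ * M * h + D * h)) with hω
  have hint : ∀ k ≤ n, |g + pathIntegral c N ζ arr Yl u (t k) - (z k).2| ≤
      ∑ i ∈ Finset.range k, ((|c.drift| * h + |ξ i|) * ω +
        |c.drift| * h * R * ((N (t (i + 1)) : ℝ) - N (t i))) := by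
    intro k
    induction k with
    | zero => intro _; simp [ht0, hz0, pathIntegral]
    | succ k ih =>
      intro hk
      have h1 := ih (by omega)
      have h2 := H.pathIntegral_cell (htu k) (htmono (Nat.le_succ k)) (htv _ hk) (hcell k hk)
        (x := ξ k) rfl (hbound k (by omega))
      rw [htk, ← hinc k hk] at h2
      rw [Finset.sum_range_succ, H.pathIntegral_add le_rfl (htu k) (htmono (Nat.le_succ k))
        (htv _ hk), hzs]
      have h3 : g + (pathIntegral c N ζ arr Yl u (t k) +
          pathIntegral c N ζ arr Yl (t k) (t (k + 1))) -
          (c.step h (gridIncrement S u h k) (z k)).2 =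
          (g + pathIntegral c N ζ arr Yl u (t k) - (z k).2) +
          (pathIntegral c N ζ arr Yl (t k) (t (k + 1)) -
            √(c.vol (z k).1) * gridIncrement S u h k) := by
        simp only [Coeff.step]; ring
      rw [h3]
      exact (abs_add_le _ _).trans (add_le_add h1 h2)
  have h1 := hint n le_rfl
  rw [htn, Finset.sum_add_distrib, ← Finset.sum_mul, ← Finset.mul_sum, Finset.sum_add_distrib,
    ← Finset.mul_sum, hsumh, hsumabs, hsumN] at h1
  refine h1.trans ?_
  have hω0 : 0 ≤ ω := Real.sqrt_nonneg _
  have h2 : 0 ≤ (|c.drift| * (v - u) + A) * h := by positivity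
  have h3 : 0 ≤ |c.drift| * R * m * ω := by positivity
  nlinarith

theorem tendsto_euler (H : IsPathSolution c u v N ζ arr Y Yl M) (huv : u ≤ v) {S : ℝ → ℝ}
    (hS : ∀ a b, u ≤ a → a ≤ b → b ≤ v →
      S b - S a = c.drift * (b - a) + ∑ n ∈ Finset.Ico (N a) (N b), ζ n) (g : ℝ) :
    Tendsto (fun n : ℕ => c.euler ((v - u) / (n + 1 : ℕ))
      (gridIncrement S u ((v - u) / (n + 1 : ℕ))) (Y u, g) (n + 1)) atTop
      (𝓝 (Y v, g + pathIntegral c N ζ arr Yl u v)) := by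
  obtain ⟨η, hη0, hη⟩ := H.exists_gap
  obtain ⟨K, D, hD, hb⟩ := H.euler_error huv hS hη
  have hlim : Tendsto (fun n : ℕ => (v - u) / ((n + 1 : ℕ) : ℝ)) atTop (𝓝 0) :=
    (tendsto_const_div_atTop_nhds_zero_nat (v - u)).comp (tendsto_add_atTop_nat 1)
  have hev : ∀ᶠ n : ℕ in atTop, (v - u) / ((n + 1 : ℕ) : ℝ) < η := hlim.eventually_lt_const hη0
  have hall : ∀ᶠ n : ℕ in atTop, _ := hev.mono fun n hn =>
    hb (n + 1) ((v - u) / ((n + 1 : ℕ) : ℝ)) g (div_nonneg (by linarith) (by positivity))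
      (by field_simp) hn
  refine Tendsto.prodMk_nhds ?_ ?_
  · have h0 : Tendsto (fun n : ℕ => D * ((v - u) / ((n + 1 : ℕ) : ℝ))) atTop (𝓝 0) := by
      simpa only [mul_zero] using hlim.const_mul D
    exact tendsto_iff_norm_sub_tendsto_zero.2 (squeeze_zero' (.of_forall fun _ => norm_nonneg _)
      (hall.mono fun n hn => (norm_sub_rev _ _).trans_le hn.1) h0)
  · have hcont : Continuous fun h : ℝ => K * (√(‖c.form‖ * (‖c.lin‖ * M * h + D * h)) + h) := by
      fun_prop
    have h0 : Tendsto (fun n : ℕ => K * (√(‖c.form‖ * (‖c.lin‖ * M * ((v - u) / ((n + 1 : ℕ) : ℝ))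
        + D * ((v - u) / ((n + 1 : ℕ) : ℝ)))) + (v - u) / ((n + 1 : ℕ) : ℝ))) atTop (𝓝 0) := by
      have := (hcont.tendsto 0).comp hlim
      simp only [mul_zero, add_zero, Real.sqrt_zero] at this
      exact this
    exact tendsto_iff_norm_sub_tendsto_zero.2 (squeeze_zero' (.of_forall fun _ => norm_nonneg _)
      (hall.mono fun n hn => (norm_sub_rev _ _).trans_le hn.2) h0)

end IsPathSolution

end SLDCogarch

namespace SLDCogarch

/-! ### Càdlàg and counting paths -/

section Cadlag

variable {E : Type*} [NormedAddCommGroup E] {Y : ℝ → E}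

/-- Near each point the path is bounded on the right by right-continuity and on the left by the left
limit; compactness does the rest. At 0 only the right side lies in the interval. -/
lemma exists_bound_of_cadlag (hr : ∀ t, 0 ≤ t → ContinuousWithinAt Y (Set.Ici t) t)
    (hl : ∀ t, 0 < t → ∃ y, Tendsto Y (𝓝[<] t) (𝓝 y)) (T : ℝ) :
    ∃ M, ∀ w ∈ Set.Icc 0 T, ‖Y w‖ ≤ M := by
  have key : Bornology.IsBounded (Y '' Set.Icc 0 T) := by
    refine (isCompact_Icc (a := (0 : ℝ)) (b := T)).induction_on
      (p := fun s => Bornology.IsBounded (Y '' s)) (by simp)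
      (fun s t hst ht => ht.subset (Set.image_mono hst))
      (fun s t hs ht => by rw [Set.image_union]; exact hs.union ht) fun t ht => ?_
    have h1 : ∃ s ∈ 𝓝[≥] t, Bornology.IsBounded (Y '' s) := by
      refine ⟨_, (hr t ht.1).norm.eventually (eventually_le_nhds (lt_add_one ‖Y t‖)), ?_⟩
      refine isBounded_iff_forall_norm_le.2 ⟨‖Y t‖ + 1, ?_⟩
      rintro _ ⟨w, hw, rfl⟩
      exact hw
    obtain ⟨s, hs, hsb⟩ := h1
    rcases ht.1.eq_or_lt with h0 | h0
    · refine ⟨s, ?_, hsb⟩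
      rw [← h0] at hs ⊢
      exact nhdsWithin_mono _ Set.Icc_subset_Ici_self hs
    · obtain ⟨y, hy⟩ := hl t h0
      refine ⟨{w | ‖Y w‖ ≤ ‖y‖ + 1} ∪ s, ?_, ?_⟩
      · apply mem_nhdsWithin_of_mem_nhds
        rw [← nhdsLT_sup_nhdsGE]
        exact mem_sup.2 ⟨mem_of_superset
          (hy.norm.eventually (eventually_le_nhds (lt_add_one ‖y‖))) Set.subset_union_left,
          mem_of_superset hs Set.subset_union_right⟩
      · rw [Set.image_union]
        refine Bornology.IsBounded.union (isBounded_iff_forall_norm_le.2 ⟨‖y‖ + 1, ?_⟩) hsb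
        rintro _ ⟨w, hw, rfl⟩
        exact hw
  obtain ⟨M, hM⟩ := isBounded_iff_forall_norm_le.1 key
  exact ⟨M, fun w hw => hM _ ⟨w, hw, rfl⟩⟩

lemma tendsto_leftLim_of_exists {t : ℝ} (hl : ∃ y, Tendsto Y (𝓝[<] t) (𝓝 y)) :
    Tendsto Y (𝓝[<] t) (𝓝 (Function.leftLim Y t)) := by
  exact tendsto_leftLim_of_tendsto hl

/-- The points `(⌈(n+1) t⌉ - 1) / (n+1)` tend to `t` strictly from the left. Each approximant
factors through an integer-valued measurable function, so no measurability of `Y` is needed. -/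
lemma aestronglyMeasurable_leftLim [MeasurableSpace E] [BorelSpace E] [SecondCountableTopology E]
    (hl : ∀ t, 0 < t → ∃ y, Tendsto Y (𝓝[<] t) (𝓝 y)) {u v : ℝ} (hu : 0 ≤ u) :
    AEStronglyMeasurable (Function.leftLim Y) (volume.restrict (Set.Ioc u v)) := by
  set f : ℕ → ℝ → E := fun n t => Y (((⌈((n : ℝ) + 1) * t⌉ : ℝ) - 1) / ((n : ℝ) + 1)) with hf
  have hfm : ∀ n, AEStronglyMeasurable (f n) (volume.restrict (Set.Ioc u v)) := by
    intro n
    have h1 : Measurable fun t : ℝ => ⌈((n : ℝ) + 1) * t⌉ :=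
      Int.measurable_ceil.comp (measurable_const.mul measurable_id)
    have h2 : Measurable fun k : ℤ => Y (((k : ℝ) - 1) / ((n : ℝ) + 1)) := Measurable.of_discrete
    exact (h2.comp h1).aestronglyMeasurable
  refine aestronglyMeasurable_of_tendsto_ae atTop hfm ?_
  filter_upwards [ae_restrict_mem measurableSet_Ioc] with t ht
  refine (tendsto_leftLim_of_exists (hl t (hu.trans_lt ht.1))).comp ?_
  refine tendsto_nhdsWithin_iff.2 ⟨?_, .of_forall fun n => ?_⟩
  · have h1 : Tendsto (fun n : ℕ => t - 1 / ((n : ℝ) + 1)) atTop (𝓝 t) := by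
      simpa using (tendsto_one_div_add_atTop_nhds_zero_nat (𝕜 := ℝ)).const_sub t
    refine tendsto_of_tendsto_of_tendsto_of_le_of_le h1 tendsto_const_nhds
      (fun n => ?_) (fun n => ?_)
    · have hn : (0 : ℝ) < (n : ℝ) + 1 := by positivity
      simp only
      rw [le_div_iff₀ hn, sub_mul, one_div_mul_cancel hn.ne']
      linarith [Int.le_ceil (((n : ℝ) + 1) * t)]
    · have hn : (0 : ℝ) < (n : ℝ) + 1 := by positivity
      simp only
      rw [div_le_iff₀ hn]
      linarith [Int.ceil_lt_add_one (((n : ℝ) + 1) * t)]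
  · have hn : (0 : ℝ) < (n : ℝ) + 1 := by positivity
    rw [Set.mem_Iio, div_lt_iff₀ hn]
    linarith [Int.ceil_lt_add_one (((n : ℝ) + 1) * t)]

end Cadlag

/-! ### Arrival times of a counting path -/

section Counting

variable {Ω : Type*} {N : ℝ → Ω → ℕ} {ω : Ω}

lemma arrivalTime_nonneg (n : ℕ) : 0 ≤ arrivalTime N n ω :=
  Real.sInf_nonneg fun _ ht => ht.1

/-- Right-continuity with values in `ℕ` makes the infimum attained. The bound `n < N v ω` makes the
set nonempty, so that `sInf` is not its default value. -/
lemma arrivalTime_le_iff (hm : MonotoneOn (fun t => N t ω) (Set.Ici 0))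
    (hr : ∀ t, 0 ≤ t → ContinuousWithinAt (fun u => N u ω) (Set.Ici t) t)
    {n : ℕ} {v w : ℝ} (hv : 0 ≤ v) (hn : n < N v ω) (hw : 0 ≤ w) :
    arrivalTime N n ω ≤ w ↔ n < N w ω := by
  have hbdd : BddBelow {t : ℝ | 0 ≤ t ∧ n + 1 ≤ N t ω} := ⟨0, fun _ ht => ht.1⟩
  constructor
  · intro h
    refine lt_of_lt_of_le ?_ (hm (arrivalTime_nonneg n) hw h)
    have h1 := hr _ (arrivalTime_nonneg (N := N) (ω := ω) n)
    have h2 : ∀ᶠ u in 𝓝[≥] (arrivalTime N n ω), N u ω = N (arrivalTime N n ω) ω :=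
      h1.eventually (p := fun k => k = N (arrivalTime N n ω) ω) (by simp [nhds_discrete])
    obtain ⟨b, hb, hb2⟩ := mem_nhdsGE_iff_exists_Ico_subset.1 h2
    obtain ⟨x, hx, hxb⟩ := exists_lt_of_csInf_lt (⟨v, hv, hn⟩ :
      {t : ℝ | 0 ≤ t ∧ n + 1 ≤ N t ω}.Nonempty) (show sInf _ < b from hb)
    have h3 : N x ω = N (arrivalTime N n ω) ω := hb2 ⟨csInf_le hbdd hx, hxb⟩
    have := hx.2
    show n < N (arrivalTime N n ω) ω
    omega
  · intro h
    exact csInf_le hbdd ⟨hw, h⟩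

/-- Just before the arrival of index `n + 1` the count is at least `n + 1`, since jumps have size at
most one; so the arrival of index `n` is strictly earlier. -/
lemma arrivalTime_lt_succ (hm : MonotoneOn (fun t => N t ω) (Set.Ici 0))
    (hr : ∀ t, 0 ≤ t → ContinuousWithinAt (fun u => N u ω) (Set.Ici t) t)
    (hj : ∀ t, 0 < t → ∀ᶠ u in 𝓝[<] t, N t ω ≤ N u ω + 1)
    {n : ℕ} {u v : ℝ} (hu : 0 ≤ u) (hun : N u ω ≤ n) (hv : 0 ≤ v) (hn : n + 1 < N v ω) :
    arrivalTime N n ω < arrivalTime N (n + 1) ω := by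
  set T := arrivalTime N (n + 1) ω with hT
  have h1 : n + 1 < N T ω := (arrivalTime_le_iff hm hr hv hn (arrivalTime_nonneg _)).1 le_rfl
  have h2 : u < T := by
    by_contra! h
    have := (arrivalTime_le_iff hm hr hv hn hu).1 h
    omega
  have hT0 : 0 < T := hu.trans_lt h2
  obtain ⟨x, hx1, hx2⟩ := ((hj T hT0).and (Ioo_mem_nhdsLT hT0)).exists
  exact ((arrivalTime_le_iff hm hr hv (by omega) hx2.1.le).2 (by omega)).trans_lt hx2.2

end Counting

/-- The coefficients of the state equation of a COGARCH process. -/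
def cogarchCoeff {q : ℕ} (α₀ : ℝ) (a β : Fin q → ℝ) (δ : ℝ) : Coeff (Fin q → ℝ) where
  drift := δ
  base := α₀
  lin := LinearMap.toContinuousLinearMap (Matrix.mulVecLin (companion β))
  form := LinearMap.toContinuousLinearMap (dotProductBilin ℝ ℝ a)
  dir := lastVec q

/-! ### COGARCH paths as solutions of the pathwise equation -/

section State

variable {Ω : Type*} {q : ℕ} {α₀ δ : ℝ} {a β : Fin q → ℝ}
  {N : ℝ → Ω → ℕ} {ζ : ℕ → Ω → ℝ} {Y : ℝ → Ω → Fin q → ℝ} {ω : Ω}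

lemma cogarchCoeff_lin (y : Fin q → ℝ) :
    (cogarchCoeff α₀ a β δ).lin y = companion β *ᵥ y := rfl

lemma volatility_eq {t : ℝ} (ht : 0 < t) : volatility α₀ a Y t ω =
    (cogarchCoeff α₀ a β δ).vol (Function.leftLim (fun v => Y v ω) t) := by
  simp only [volatility, if_pos ht]
  rfl

/-- The equation from time 0 is subtracted at two times. Jumps counted in `(s, b]` arrive after `s ≥
0`, hence at positive times, where the volatility is given by the left limit. -/
lemma exists_isPathSolution (hm : MonotoneOn (fun t => N t ω) (Set.Ici 0))
    (hr : ∀ t, 0 ≤ t → ContinuousWithinAt (fun u => N u ω) (Set.Ici t) t)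
    (hj : ∀ t, 0 < t → ∀ᶠ u in 𝓝[<] t, N t ω ≤ N u ω + 1)
    (hYr : ∀ t, 0 ≤ t → ContinuousWithinAt (fun u => Y u ω) (Set.Ici t) t)
    (hYl : ∀ t, 0 < t → ∃ y, Tendsto (fun u => Y u ω) (𝓝[<] t) (𝓝 y))
    (hY : ∀ t, 0 ≤ t →
      Y t ω = Y 0 ω + (∫ u in (0 : ℝ)..t, companion β *ᵥ Function.leftLim (fun v => Y v ω) u)
        + integralQV N ζ (volatility α₀ a Y) t ω • lastVec q)
    {u v : ℝ} (hu : 0 ≤ u) (huv : u ≤ v) :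
    ∃ M, IsPathSolution (cogarchCoeff α₀ a β δ) u v (fun t => N t ω) (fun n => ζ n ω)
      (fun n => arrivalTime N n ω) (fun t => Y t ω) (Function.leftLim fun t => Y t ω) M := by
  obtain ⟨M, hM⟩ := exists_bound_of_cadlag hYr hYl v
  have hlim : ∀ w ∈ Set.Ioc 0 v, ‖Function.leftLim (fun t => Y t ω) w‖ ≤ M := by
    intro w hw
    refine le_of_tendsto (tendsto_leftLim_of_exists (hYl w hw.1)).norm ?_
    filter_upwards [Ioo_mem_nhdsLT hw.1] with r hr
    exact hM r ⟨hr.1.le, hr.2.le.trans hw.2⟩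
  have hint : ∀ b, 0 ≤ b → b ≤ v → IntervalIntegrable
      (fun r => (cogarchCoeff α₀ a β δ).lin (Function.leftLim (fun t => Y t ω) r)) volume 0 b := by
    intro b hb hbv
    rw [intervalIntegrable_iff_integrableOn_Ioc_of_le hb]
    refine ⟨(cogarchCoeff α₀ a β δ).lin.continuous.comp_aestronglyMeasurable
      (aestronglyMeasurable_leftLim hYl le_rfl), .of_bounded
        (C := ‖(cogarchCoeff α₀ a β δ).lin‖ * M) ?_⟩
    filter_upwards [ae_restrict_mem measurableSet_Ioc] with w hw
    refine (ContinuousLinearMap.le_opNorm _ _).trans ?_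
    have := hlim w ⟨hw.1, hw.2.trans hbv⟩
    gcongr
  refine ⟨M, hm.mono fun x hx => hu.trans hx.1, fun w hw n _ hn =>
    arrivalTime_le_iff hm hr (hu.trans huv) hn (hu.trans hw.1), fun n hn hn' =>
    arrivalTime_lt_succ hm hr hj hu hn (hu.trans huv) hn',
    fun w hw => hM w ⟨hu.trans hw.1, hw.2⟩, fun w hw => tendsto_leftLim_of_exists
      (hYl w (hu.trans_lt hw.1)), aestronglyMeasurable_leftLim hYl hu, ?_⟩
  intro s b hs hsb hb
  have hs0 : 0 ≤ s := hu.trans hs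
  have hb0 : 0 ≤ b := hs0.trans hsb
  have h1 := hY b hb0
  have h2 := hY s hs0
  have h3 := intervalIntegral.integral_add_adjacent_intervals (hint s hs0 (hsb.trans hb))
    ((hint s hs0 (hsb.trans hb)).symm.trans (hint b hb0 hb))
  have h4 : integralQV N ζ (volatility α₀ a Y) b ω = integralQV N ζ (volatility α₀ a Y) s ω +
      ∑ n ∈ Finset.Ico (N s ω) (N b ω), (cogarchCoeff α₀ a β δ).vol
        (Function.leftLim (fun t => Y t ω) (arrivalTime N n ω)) * ζ n ω ^ 2 := by
    unfold integralQV
    rw [← Finset.sum_range_add_sum_Ico _ (hm hs0 hb0 hsb)]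
    congr 1
    refine Finset.sum_congr rfl fun n hn => ?_
    rw [Finset.mem_Ico] at hn
    rw [volatility_eq (β := β) (δ := δ)]
    -- An arrival time `≤ 0` would be `≤ s`, and its jump would already be counted at `s`.
    by_contra! h
    have := (arrivalTime_le_iff hm hr hb0 hn.2 hs0).1 (h.trans hs0)
    omega
  simp only [cogarchCoeff_lin] at h3
  simp only [cogarchCoeff_lin]
  rw [h1, h2, h4, ← h3, add_smul]
  simp only [cogarchCoeff]
  abel

lemma priceIncrement_eq (hm : MonotoneOn (fun t => N t ω) (Set.Ici 0))
    (hr : ∀ t, 0 ≤ t → ContinuousWithinAt (fun u => N u ω) (Set.Ici t) t)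
    {l t : ℝ} (ht : 0 ≤ t) (hl : 0 ≤ l) :
    priceIncrement δ N ζ (volatility α₀ a Y) l t ω =
      pathIntegral (cogarchCoeff α₀ a β δ) (fun t => N t ω) (fun n => ζ n ω)
        (fun n => arrivalTime N n ω) (Function.leftLim fun t => Y t ω) t (t + l) := by
  unfold priceIncrement integralS pathIntegral
  congr 1
  · congr 1
    rw [intervalIntegral.integral_of_le (by linarith), intervalIntegral.integral_of_le (by linarith)]
    refine setIntegral_congr_fun measurableSet_Ioc fun r hr => ?_
    simp only
    rw [volatility_eq (β := β) (δ := δ) (ht.trans_lt hr.1)]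
  · refine Finset.sum_congr rfl fun n hn => ?_
    simp only [Finset.mem_Ico] at hn
    simp only
    rw [volatility_eq (β := β) (δ := δ)]
    by_contra! h
    have := (arrivalTime_le_iff hm hr (ht.trans (by linarith)) hn.2 ht).1 (h.trans ht)
    omega

lemma drivingProcess_sub (hm : MonotoneOn (fun t => N t ω) (Set.Ici 0)) {s t : ℝ} (hs : 0 ≤ s)
    (hst : s ≤ t) : drivingProcess δ N ζ t ω - drivingProcess δ N ζ s ω =
      δ * (t - s) + ∑ n ∈ Finset.Ico (N s ω) (N t ω), ζ n ω := by
  unfold drivingProcess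
  rw [← Finset.sum_range_add_sum_Ico _ (hm hs (hs.trans hst) hst)]
  ring

end State

end SLDCogarch

namespace SLDCogarch

/-! ### Independence of tuples -/

section Indep

variable {Ω : Type*} [MeasurableSpace Ω] {μ : Measure Ω} [IsProbabilityMeasure μ]
  {A B C D : Type*} [MeasurableSpace A] [MeasurableSpace B] [MeasurableSpace C] [MeasurableSpace D]

/-- The joint law is a product of three laws, and products of measures are associative. -/
lemma indepFun_prodMk_of_indepFun {X : Ω → A} {Y : Ω → B} {Z : Ω → C} (hX : AEMeasurable X μ)
    (hY : AEMeasurable Y μ) (hZ : AEMeasurable Z μ)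
    (h1 : IndepFun X (fun ω => (Y ω, Z ω)) μ) (h2 : IndepFun Y Z μ) :
    IndepFun (fun ω => (X ω, Y ω)) Z μ := by
  have := Measure.isProbabilityMeasure_map hX
  have := Measure.isProbabilityMeasure_map hY
  have := Measure.isProbabilityMeasure_map hZ
  have h3 : IndepFun X Y μ := h1.comp measurable_id measurable_fst
  rw [indepFun_iff_map_prod_eq_prod_map_map (by fun_prop) (by fun_prop)] at h1 h2 h3 ⊢
  rw [h3]
  have h4 : μ.map (fun ω => ((X ω, Y ω), Z ω)) =
      (μ.map fun ω => (X ω, (Y ω, Z ω))).map MeasurableEquiv.prodAssoc.symm := by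
    rw [AEMeasurable.map_map_of_aemeasurable (MeasurableEquiv.measurable _).aemeasurable
      (by fun_prop)]
    rfl
  rw [h4, h1, h2, ← (measurePreserving_prodAssoc (μ.map X) (μ.map Y) (μ.map Z)).map_eq,
    MeasurableEquiv.map_symm_map]

/-- All four variables are independent up to the grouping `(X₁, X₂)`, `(Y₁, Y₂)`; regrouping one
variable at a time exchanges the roles. -/
lemma indepFun_prodMk_prodMk_of_blocks {X₁ : Ω → A} {X₂ : Ω → B} {Y₁ : Ω → C} {Y₂ : Ω → D}
    (hX₁ : AEMeasurable X₁ μ) (hX₂ : AEMeasurable X₂ μ) (hY₁ : AEMeasurable Y₁ μ)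
    (hY₂ : AEMeasurable Y₂ μ) (hXY : IndepFun (fun ω => (X₁ ω, X₂ ω)) (fun ω => (Y₁ ω, Y₂ ω)) μ)
    (hX : IndepFun X₁ X₂ μ) (hY : IndepFun Y₁ Y₂ μ) :
    IndepFun (fun ω => (X₁ ω, Y₁ ω)) (fun ω => (X₂ ω, Y₂ ω)) μ := by
  have h1 := indepFun_prodMk_of_indepFun (hX₁.prodMk hX₂) hY₁ hY₂ hXY hY
  have h2 : IndepFun Y₁ (fun ω => (X₁ ω, X₂ ω)) μ :=
    (hXY.comp measurable_id measurable_fst).symm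
  have h3 := indepFun_prodMk_of_indepFun hY₁ hX₁ hX₂ h2 hX
  have h4 : IndepFun Y₂ (fun ω => (X₂ ω, (Y₁ ω, X₁ ω))) μ :=
    
    (h1.comp (φ := fun z : (A × B) × C => (z.1.2, (z.2, z.1.1))) (by fun_prop) measurable_id).symm
  have h5 := indepFun_prodMk_of_indepFun hY₂ hX₂ (hY₁.prodMk hX₁) h4 h3.symm
  exact (h5.comp (φ := Prod.swap) (ψ := Prod.swap) measurable_swap measurable_swap).symm

lemma measure_eq_tsum_inter_fiber {K : Ω → ℕ} (hK : Measurable K) (s : Set Ω) :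
    μ s = ∑' m, μ (K ⁻¹' {m} ∩ s) := by
  have h := measure_iUnion (μ := μ.restrict s) (f := fun m => K ⁻¹' {m})
    (fun i j hij => Set.disjoint_left.2 fun ω hi hj => hij (by
      simp only [Set.mem_preimage, Set.mem_singleton_iff] at hi hj; omega))
    (fun m => hK (measurableSet_singleton m))
  have h2 : (⋃ m, K ⁻¹' {m}) = Set.univ := by
    ext ω; simp
  rw [h2, Measure.restrict_apply_univ] at h
  rw [h]
  exact tsum_congr fun m => Measure.restrict_apply (hK (measurableSet_singleton m))

end Indep

/-! ### Compound Poisson laws -/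

/-- The law of a sum of `K` independent variables with law `F`, where `K` is Poisson with
mean `c`. -/
def compoundPoisson (c : ℝ≥0) (F : Measure ℝ) : Measure ℝ :=
  ((poissonMeasure c).prod (Measure.infinitePi fun _ : ℕ => F)).map
    fun p => ∑ k ∈ Finset.range p.1, p.2 k

lemma measurable_randomSum :
    Measurable fun p : ℕ × (ℕ → ℝ) => ∑ k ∈ Finset.range p.1, p.2 k :=
  measurable_from_prod_countable_right fun m =>
    Finset.measurable_sum (Finset.range m) (f := fun k (y : ℕ → ℝ) => y k)
      fun k _ => measurable_pi_apply k

instance (c : ℝ≥0) (F : Measure ℝ) [IsProbabilityMeasure F] :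
    IsProbabilityMeasure (compoundPoisson c F) :=
  Measure.isProbabilityMeasure_map measurable_randomSum.aemeasurable

/-- What matters is that the bound is linear in `c` near 0. Cancelling one factor `k + 1` with the
factorial and using `k + 1 ≤ 2 ^ k` leaves an exponential series in `2 c`. -/
lemma lintegral_sq_poissonMeasure_le (c : ℝ≥0) :
    ∫⁻ k, ENNReal.ofReal ((k : ℝ) ^ 2) ∂(poissonMeasure c) ≤ ENNReal.ofReal (c * Real.exp c) := by
  have hle : ∀ k : ℕ, ((k + 1 : ℕ) : ℝ) ^ 2 * (Real.exp (-c) * (c : ℝ) ^ (k + 1) / (k + 1).factorial)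
      ≤ c * Real.exp (-c) * ((2 * c) ^ k / k.factorial) := by
    intro k
    have h1 : ((k + 1 : ℕ) : ℝ) ≤ 2 ^ k := by exact_mod_cast Nat.lt_two_pow_self
    rw [Nat.factorial_succ]
    have h2 : (0 : ℝ) < k.factorial := by positivity
    have h3 : ((k + 1 : ℕ) : ℝ) ^ 2 * (Real.exp (-c) * (c : ℝ) ^ (k + 1) /
        ((k + 1) * k.factorial : ℕ)) = c * Real.exp (-c) * (c ^ k / k.factorial) * (k + 1 : ℕ) := by
      push_cast
      field_simp
      ring
    rw [h3, mul_pow]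
    have h4 : c * Real.exp (-c) * (c ^ k / k.factorial) * (k + 1 : ℕ) ≤
      c * Real.exp (-c) * ((c : ℝ) ^ k / k.factorial) * 2 ^ k := by gcongr
    refine h4.trans (le_of_eq (by ring))
  have hsum : HasSum (fun k : ℕ => c * Real.exp (-c) * ((2 * (c : ℝ)) ^ k / k.factorial))
      (c * Real.exp c) := by
    have h1 := (NormedSpace.expSeries_div_hasSum_exp (2 * (c : ℝ))).mul_left (c * Real.exp (-c))
    rw [← Real.exp_eq_exp_ℝ, mul_assoc, ← Real.exp_add] at h1
    rwa [show -(c : ℝ) + 2 * c = c by ring] at h1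
  rw [lintegral_countable']
  have hnn : ∀ k : ℕ, 0 ≤ c * Real.exp (-c) * ((2 * (c : ℝ)) ^ k / k.factorial) := fun k => by
    positivity
  rw [← hsum.tsum_eq, ENNReal.ofReal_tsum_of_nonneg hnn hsum.summable,
    tsum_eq_zero_add' ENNReal.summable]
  simp only [Nat.cast_zero, ne_eq, OfNat.ofNat_ne_zero, not_false_eq_true, zero_pow,
    ENNReal.ofReal_zero, zero_mul, zero_add]
  refine ENNReal.tsum_le_tsum fun k => ?_
  rw [poissonMeasure_singleton, ← ENNReal.ofReal_mul (by positivity)]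
  exact ENNReal.ofReal_le_ofReal (hle k)

/-- Cauchy–Schwarz on a sum of `k` terms costs a factor `k`, and adding the `k` equal moments costs
another; this is the Poisson second moment. -/
lemma lintegral_sq_compoundPoisson_le (c : ℝ≥0) (F : Measure ℝ) [IsProbabilityMeasure F] :
    ∫⁻ x, ENNReal.ofReal (x ^ 2) ∂(compoundPoisson c F) ≤
      ENNReal.ofReal (c * Real.exp c) * ∫⁻ z, ENNReal.ofReal (z ^ 2) ∂F := by
  rw [compoundPoisson, lintegral_map (by fun_prop) measurable_randomSum]
  rw [lintegral_prod _ (by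
    exact (Measurable.comp (g := fun x : ℝ => ENNReal.ofReal (x ^ 2)) (by fun_prop)
      measurable_randomSum).aemeasurable)]
  calc _ ≤ ∫⁻ k : ℕ, ENNReal.ofReal ((k : ℝ) ^ 2) * ∫⁻ z, ENNReal.ofReal (z ^ 2) ∂F
        ∂(poissonMeasure c) := by
        refine lintegral_mono fun k => ?_
        calc _ ≤ ∫⁻ y : ℕ → ℝ, ENNReal.ofReal k * ∑ i ∈ Finset.range k, ENNReal.ofReal (y i ^ 2)
              ∂(Measure.infinitePi fun _ : ℕ => F) := by
              refine lintegral_mono fun y => ?_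
              simp only
              rw [← ENNReal.ofReal_sum_of_nonneg (fun i _ => sq_nonneg _),
                ← ENNReal.ofReal_mul (by positivity)]
              refine ENNReal.ofReal_le_ofReal ?_
              simpa using sq_sum_le_card_mul_sum_sq (s := Finset.range k) (f := y)
          _ = _ := by
              rw [lintegral_const_mul _ (by fun_prop), lintegral_finsetSum _ (by fun_prop)]
              have h1 : ∀ i : ℕ, ∫⁻ y : ℕ → ℝ, ENNReal.ofReal (y i ^ 2)
                  ∂(Measure.infinitePi fun _ : ℕ => F) = ∫⁻ z, ENNReal.ofReal (z ^ 2) ∂F := by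
                intro i
                rw [← (measurePreserving_eval_infinitePi (fun _ : ℕ => F) i).lintegral_comp
                  (f := fun z : ℝ => ENNReal.ofReal (z ^ 2)) (by fun_prop)]
              rw [Finset.sum_congr rfl fun i _ => h1 i, Finset.sum_const, Finset.card_range,
                nsmul_eq_mul, ← mul_assoc, sq, ENNReal.ofReal_mul (by positivity),
                ENNReal.ofReal_natCast]
    _ ≤ _ := by
        rw [lintegral_mul_const _ (by fun_prop)]
        gcongr
        exact lintegral_sq_poissonMeasure_le c

end SLDCogarch

namespace SLDCogarch

/-! ### The periodic partition and the cumulative intensity -/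

namespace IsPeriodicPartition

variable {s : ℕ → ℝ} {d : ℕ} {τ : ℝ}

lemma pos (h : IsPeriodicPartition s d τ) : 0 < d := by
  by_contra! h0
  have h1 := h.period_eq
  have h2 := h.period_pos
  obtain rfl : d = 0 := by omega
  simp [h1] at h2

lemma add_period (h : IsPeriodicPartition s d τ) (i : ℕ) : s (i + d) = s i + τ := by
  induction i with
  | zero => rw [h.period_eq, Finset.sum_range_sub]; simp
  | succ i ih =>
    have := h.periodic i
    rw [add_right_comm]
    linarith

lemma add_mul_period (h : IsPeriodicPartition s d τ) (i k : ℕ) :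
    s (i + k * d) = s i + k * τ := by
  induction k with
  | zero => simp
  | succ k ih =>
    rw [Nat.succ_mul, ← add_assoc, h.add_period, ih]
    push_cast; ring

lemma nonneg (h : IsPeriodicPartition s d τ) (i : ℕ) : 0 ≤ s i :=
  h.zero ▸ h.strictMono.monotone (Nat.zero_le i)

lemma exists_le (h : IsPeriodicPartition s d τ) (t : ℝ) : ∃ k, t ≤ s k := by
  obtain ⟨k, hk⟩ := exists_nat_ge (t / τ)
  refine ⟨0 + k * d, ?_⟩
  rw [h.add_mul_period, h.zero, zero_add]
  exact (div_le_iff₀ h.period_pos).1 hk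

lemma exists_mem_Ioc (h : IsPeriodicPartition s d τ) {t : ℝ} (ht : 0 < t) :
    ∃ i, t ∈ Set.Ioc (s i) (s (i + 1)) := by
  classical
  have hk := Nat.find_spec (h.exists_le t)
  have hk0 : Nat.find (h.exists_le t) ≠ 0 := fun h0 => by
    rw [h0, h.zero] at hk; linarith
  obtain ⟨m, hm⟩ := Nat.exists_eq_succ_of_ne_zero hk0
  refine ⟨m, not_le.1 (Nat.find_min (h.exists_le t) (by omega)), ?_⟩
  rw [hm] at hk
  exact hk

lemma eq_of_mem_Ioc (h : IsPeriodicPartition s d τ) {t : ℝ} {i j : ℕ}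
    (hi : t ∈ Set.Ioc (s i) (s (i + 1))) (hj : t ∈ Set.Ioc (s j) (s (j + 1))) : i = j := by
  have h1 : i < j + 1 := h.strictMono.lt_iff_lt.1 (hi.1.trans_le hj.2)
  have h2 : j < i + 1 := h.strictMono.lt_iff_lt.1 (hj.1.trans_le hi.2)
  omega

/-- The phase of the `i`-th interval of the partition. -/
def phase (h : IsPeriodicPartition s d τ) (i : ℕ) : Fin d := ⟨i % d, Nat.mod_lt _ h.pos⟩

lemma phase_add (h : IsPeriodicPartition s d τ) (i : ℕ) : h.phase (i + d) = h.phase i := by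
  simp [phase]

lemma mem_phaseSet_iff (h : IsPeriodicPartition s d τ) {t : ℝ} {i : ℕ} {j : Fin d}
    (ht : t ∈ Set.Ioc (s i) (s (i + 1))) : t ∈ phaseSet s d j ↔ j = h.phase i := by
  simp only [phaseSet, Set.mem_iUnion]
  constructor
  · rintro ⟨k, hk⟩
    have := h.eq_of_mem_Ioc ht hk
    ext
    simp [phase, this, Nat.mod_eq_of_lt j.2]
  · rintro rfl
    refine ⟨i / d, ?_⟩
    have h1 : (h.phase i : ℕ) + i / d * d = i := Nat.mod_add_div' i d
    rwa [h1]

lemma sum_indicator_phaseSet (h : IsPeriodicPartition s d τ) {t : ℝ} {i : ℕ}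
    (ht : t ∈ Set.Ioc (s i) (s (i + 1))) (x : Fin d → ℝ) :
    ∑ j : Fin d, (phaseSet s d j).indicator (fun _ => x j) t = x (h.phase i) := by
  rw [Finset.sum_eq_single (h.phase i)]
  · exact Set.indicator_of_mem ((h.mem_phaseSet_iff ht).2 rfl) _
  · exact fun j _ hj => Set.indicator_of_notMem (fun hm => hj ((h.mem_phaseSet_iff ht).1 hm)) _
  · simp

lemma intensity_add_period (h : IsPeriodicPartition s d τ) (lam : Fin d → ℝ) {t : ℝ}
    (ht : 0 < t) : intensity s d lam (t + τ) = intensity s d lam t := by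
  obtain ⟨i, hi⟩ := h.exists_mem_Ioc ht
  have hi' : t + τ ∈ Set.Ioc (s (i + d)) (s (i + d + 1)) := by
    rw [add_right_comm i d 1, h.add_period, h.add_period]
    exact ⟨by linarith [hi.1], by linarith [hi.2]⟩
  unfold intensity
  rw [h.sum_indicator_phaseSet hi, h.sum_indicator_phaseSet hi', h.phase_add]

end IsPeriodicPartition

section Intensity

variable {s : ℕ → ℝ} {d : ℕ} {τ : ℝ} {lam : Fin d → ℝ}

lemma measurable_intensity : Measurable (intensity s d lam) := by
  refine Finset.measurable_sum _ fun j _ => ?_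
  exact measurable_const.indicator (MeasurableSet.iUnion fun _ => measurableSet_Ioc)

lemma intensity_nonneg (hl : ∀ j, 0 ≤ lam j) (t : ℝ) : 0 ≤ intensity s d lam t :=
  Finset.sum_nonneg fun j _ => Set.indicator_nonneg (fun _ _ => hl j) t

lemma intensity_le (hl : ∀ j, 0 ≤ lam j) (t : ℝ) : intensity s d lam t ≤ ∑ j, lam j :=
  Finset.sum_le_sum fun j _ => Set.indicator_le_self' (fun _ _ => hl j) t

lemma intervalIntegrable_intensity (hl : ∀ j, 0 ≤ lam j) (a b : ℝ) :
    IntervalIntegrable (intensity s d lam) volume a b := by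
  refine (intervalIntegrable_const (c := ∑ j, lam j)).mono_fun
    measurable_intensity.aestronglyMeasurable (.of_forall fun t => ?_)
  simp only [Real.norm_of_nonneg (intensity_nonneg hl t)]
  exact (intensity_le hl t).trans (le_abs_self _)

lemma cumIntensity_sub (hl : ∀ j, 0 ≤ lam j) (u v : ℝ) :
    cumIntensity s d lam v - cumIntensity s d lam u = ∫ t in u..v, intensity s d lam t :=
  intervalIntegral.integral_interval_sub_left (intervalIntegrable_intensity hl _ _)
    (intervalIntegrable_intensity hl _ _)

lemma cumIntensity_sub_le (hl : ∀ j, 0 ≤ lam j) {u v : ℝ} (huv : u ≤ v) :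
    cumIntensity s d lam v - cumIntensity s d lam u ≤ (∑ j, lam j) * (v - u) := by
  rw [cumIntensity_sub hl]
  refine (intervalIntegral.integral_mono_on huv (intervalIntegrable_intensity hl _ _)
    intervalIntegrable_const fun t _ => intensity_le hl t).trans (le_of_eq ?_)
  rw [intervalIntegral.integral_const, smul_eq_mul, mul_comm]

lemma cumIntensity_sub_add_period (h : IsPeriodicPartition s d τ) (hl : ∀ j, 0 ≤ lam j)
    {u v : ℝ} (hu : 0 ≤ u) (huv : u ≤ v) :
    cumIntensity s d lam (v + τ) - cumIntensity s d lam (u + τ) =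
      cumIntensity s d lam v - cumIntensity s d lam u := by
  rw [cumIntensity_sub hl, cumIntensity_sub hl,
    ← intervalIntegral.integral_comp_add_right (fun t => intensity s d lam t) τ,
    intervalIntegral.integral_of_le huv, intervalIntegral.integral_of_le huv]
  exact setIntegral_congr_fun measurableSet_Ioc fun t ht =>
    h.intensity_add_period lam (hu.trans_lt ht.1)

end Intensity

/-! ### The increments of the driving process in terms of the count and the marks -/

section Increments

variable {Ω : Type*} {s : ℕ → ℝ} {d : ℕ} {τ : ℝ} {N : ℝ → Ω → ℕ} {Z : Fin d → ℕ → Ω → ℝ} {ω : Ω}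
  {δ : ℝ}

/-- The partition intervals are open on the left and closed on the right, like the sets of arrivals
counted between two times. -/
lemma jumpSize_eq (h : IsPeriodicPartition s d τ)
    (hm : MonotoneOn (fun t => N t ω) (Set.Ici 0))
    (hr : ∀ t, 0 ≤ t → ContinuousWithinAt (fun u => N u ω) (Set.Ici t) t)
    {i : ℕ} {n : ℕ} (h1 : N (s i) ω ≤ n) (h2 : n < N (s (i + 1)) ω) :
    jumpSize s d N Z n ω = Z (h.phase i) n ω := by
  refine h.sum_indicator_phaseSet ⟨?_, ?_⟩ fun j => Z j n ω
  · by_contra! h3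
    have := (arrivalTime_le_iff hm hr (h.nonneg _) h2 (h.nonneg i)).1 h3
    omega
  · exact (arrivalTime_le_iff hm hr (h.nonneg _) h2 (h.nonneg _)).2 h2

lemma drivingProcess_sub_eq (h : IsPeriodicPartition s d τ)
    (hm : MonotoneOn (fun t => N t ω) (Set.Ici 0))
    (hr : ∀ t, 0 ≤ t → ContinuousWithinAt (fun u => N u ω) (Set.Ici t) t)
    {i : ℕ} {u v : ℝ} (hu : s i ≤ u) (huv : u ≤ v) (hv : v ≤ s (i + 1)) :
    drivingProcess δ N (jumpSize s d N Z) v ω - drivingProcess δ N (jumpSize s d N Z) u ω =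
      δ * (v - u) + ∑ n ∈ Finset.Ico (N u ω) (N v ω), Z (h.phase i) n ω := by
  have hu0 : 0 ≤ u := (h.nonneg i).trans hu
  rw [drivingProcess_sub hm hu0 huv]
  congr 1
  refine Finset.sum_congr rfl fun n hn => ?_
  rw [Finset.mem_Ico] at hn
  exact jumpSize_eq h hm hr ((hm (h.nonneg i) hu0 hu).trans hn.1)
    (hn.2.trans_le (hm (hu0.trans huv) (h.nonneg _) hv))

/-- The driving process as a function of the counting path `η` and the marks `z`, with `K`
intervals of the partition taken into account. -/
def drivingFunctional (h : IsPeriodicPartition s d τ) (δ : ℝ) (K : ℕ) (r : ℝ)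
    (η : ℝ≥0 → ℕ) (z : Fin d × ℕ → ℝ) : ℝ :=
  δ * r + ∑ i ∈ Finset.range K, ∑ n ∈ Finset.Ico (η (min (s i) r).toNNReal)
    (η (min (s (i + 1)) r).toNNReal), z (h.phase i, n)

lemma drivingProcess_eq (h : IsPeriodicPartition s d τ) (h0 : N 0 ω = 0)
    (hm : MonotoneOn (fun t => N t ω) (Set.Ici 0))
    (hr : ∀ t, 0 ≤ t → ContinuousWithinAt (fun u => N u ω) (Set.Ici t) t)
    {K : ℕ} {r : ℝ} (hr0 : 0 ≤ r) (hrK : r ≤ s K) :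
    drivingProcess δ N (jumpSize s d N Z) r ω =
      drivingFunctional h δ K r (fun t => N t ω) fun i => Z i.1 i.2 ω := by
  have h1 : ∀ i, 0 ≤ min (s i) r := fun i => le_min (h.nonneg i) hr0
  have h2 : ∀ i, min (s i) r ≤ min (s (i + 1)) r := fun i =>
    min_le_min_right r (h.strictMono.monotone (Nat.le_succ i))
  unfold drivingFunctional
  simp only [Real.coe_toNNReal _ (h1 _)]
  have key : ∀ k, drivingProcess δ N (jumpSize s d N Z) (min (s k) r) ω = δ * min (s k) r +
      ∑ i ∈ Finset.range k, ∑ n ∈ Finset.Ico (N (min (s i) r) ω) (N (min (s (i + 1)) r) ω),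
        Z (h.phase i) n ω := by
    intro k
    induction k with
    | zero =>
      rw [h.zero, min_eq_left hr0]
      simp [drivingProcess, h0]
    | succ k ih =>
      rw [Finset.sum_range_succ]
      have h3 : drivingProcess δ N (jumpSize s d N Z) (min (s (k + 1)) r) ω -
          drivingProcess δ N (jumpSize s d N Z) (min (s k) r) ω =
          δ * (min (s (k + 1)) r - min (s k) r) +
            ∑ n ∈ Finset.Ico (N (min (s k) r) ω) (N (min (s (k + 1)) r) ω),
              Z (h.phase k) n ω := by
        rcases le_total (s k) r with h4 | h4
        · rw [min_eq_left h4]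
          exact drivingProcess_sub_eq h hm hr le_rfl
            (le_min (h.strictMono.monotone (Nat.le_succ k)) h4) (min_le_left _ _)
        · rw [min_eq_right h4, min_eq_right (h4.trans (h.strictMono.monotone (Nat.le_succ k)))]
          simp
      linarith
  have := key K
  rwa [min_eq_right hrK] at this

lemma measurable_drivingFunctional (h : IsPeriodicPartition s d τ) (δ : ℝ) (K : ℕ) (r : ℝ) :
    Measurable fun p : (ℝ≥0 → ℕ) × (Fin d × ℕ → ℝ) => drivingFunctional h δ K r p.1 p.2 := by
  refine measurable_const.add (Finset.measurable_sum _ fun i _ => ?_)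
  have h1 : Measurable fun p : (ℕ × ℕ) × (ℕ → ℝ) => ∑ n ∈ Finset.Ico p.1.1 p.1.2, p.2 n :=
    measurable_from_prod_countable_right fun m =>
      Finset.measurable_sum (Finset.Ico m.1 m.2) (f := fun k (y : ℕ → ℝ) => y k)
        fun k _ => measurable_pi_apply k
  exact h1.comp (g := fun p : (ℕ × ℕ) × (ℕ → ℝ) => ∑ n ∈ Finset.Ico p.1.1 p.1.2, p.2 n)
    (f := fun p : (ℝ≥0 → ℕ) × (Fin d × ℕ → ℝ) => ((p.1 (min (s i) r).toNNReal,
      p.1 (min (s (i + 1)) r).toNNReal), fun n => p.2 (h.phase i, n))) (by fun_prop)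

end Increments

end SLDCogarch

namespace SLDCogarch

/-! ### Past and future of the driving process within a phase -/

/-- Independence of the increments of `N` is used along monotone sequences of times, so a finite set
of times has to be listed in order, starting at 0. -/
lemma exists_monotone_enumeration (J : Finset ℝ≥0) :
    ∃ (t : ℕ → ℝ≥0) (c : ℕ), Monotone t ∧ t 0 = 0 ∧ (∀ x ∈ J, ∃ k ≤ c, t k = x) ∧
      (t c = 0 ∨ t c ∈ J) := by
  induction J using Finset.induction_on_max with
  | empty => exact ⟨fun _ => 0, 0, monotone_const, rfl, by simp, Or.inl rfl⟩
  | insert a J ha ih =>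
    obtain ⟨t, c, hm, h0, hJ, hc⟩ := ih
    have hca : t c ≤ a := by
      rcases hc with h | h
      · rw [h]; exact zero_le
      · exact (ha _ h).le
    refine ⟨fun k => if k ≤ c then t k else a, c + 1, ?_, by simp [h0], ?_, ?_⟩
    · intro i j hij
      simp only
      split_ifs with h1 h2
      · exact hm hij
      · exact (hm h1).trans hca
      · omega
      · exact le_rfl
    · intro x hx
      rcases Finset.mem_insert.1 hx with rfl | hx
      · exact ⟨c + 1, le_rfl, by simp⟩
      · obtain ⟨k, hk, rfl⟩ := hJ x hx
        exact ⟨k, by omega, by simp [hk]⟩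
    · right; simp

variable {Ω : Type*} [MeasurableSpace Ω] {μ : Measure Ω} [IsProbabilityMeasure μ]

/-- It suffices to look at finitely many times. Listed in order and followed by `u` and `v`, they
turn the past into partial sums of increments, while `N v - N u` is a further independent increment.
-/
lemma IsPoissonProcess.indepFun_past {Λ : ℝ → ℝ} {N : ℝ → Ω → ℕ} (hN : IsPoissonProcess μ Λ N)
    {u v : ℝ≥0} (huv : u ≤ v) :
    IndepFun (fun ω (r : ℝ≥0) => N (min r u : ℝ≥0) ω) (fun ω => N v ω - N u ω) μ := by
  have hmeas : ∀ r : ℝ≥0, Measurable (N r) := fun r => hN.measurable r r.2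
  refine IndepFun.process_indepFun (fun r => hmeas _) ((hmeas v).sub (hmeas u)) fun I => ?_
  obtain ⟨t₀, c, hm, h0, hJ, hc⟩ := exists_monotone_enumeration (I.image fun r => min r u)
  have hcu : t₀ c ≤ u := by
    rcases hc with h | h
    · rw [h]; exact zero_le
    · obtain ⟨r, -, hr⟩ := Finset.mem_image.1 h
      rw [← hr]; exact min_le_right _ _
  -- The increments `0, ..., c` cover the time up to `u`, and the increment of index `c + 1` runs
  -- from `u` to `v`.
  set t : ℕ → ℝ≥0 := fun k => if k ≤ c then t₀ k else if k = c + 1 then u else v with ht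
  have htm : Monotone t := by
    refine monotone_nat_of_le_succ fun k => ?_
    simp only [ht]
    split_ifs with h1 h2 h3 h4 h5
    · exact hm (Nat.le_succ k)
    · exact (hm h1).trans hcu
    · omega
    · omega
    · omega
    · exact huv
    · omega
    · omega
    · exact le_rfl
  set W : ℕ → Ω → ℕ := fun i ω => N (t (i + 1)) ω - N (t i) ω with hW
  have hWm : ∀ i, Measurable (W i) := fun i => (hmeas _).sub (hmeas _)
  have hWi : iIndepFun W μ := hN.indep_increments.nat htm
  have hdisj : Disjoint (Finset.range (c + 1)) {c + 1} := by simp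
  have hind := hWi.indepFun_finset _ _ hdisj hWm
  have hk : ∀ r : I, ∃ k ≤ c, t₀ k = min (r : ℝ≥0) u := fun r =>
    hJ _ (Finset.mem_image_of_mem _ r.2)
  choose k hkc hkr using hk
  have hpast : Measurable fun (w : Finset.range (c + 1) → ℕ) (r : I) =>
      ∑ i : Fin (k r), w ⟨i, Finset.mem_range.2 (by have := hkc r; omega)⟩ := by
    refine measurable_pi_lambda _ fun r => ?_
    exact Finset.measurable_sum _ fun i _ => measurable_pi_apply _
  have hfut : Measurable fun (w : ({c + 1} : Finset ℕ) → ℕ) => w ⟨c + 1, by simp⟩ :=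
    measurable_pi_apply _
  refine (hind.comp hpast hfut).congr ?_ ?_
  · filter_upwards [hN.mono, hN.zero] with ω hmono hzero
    ext r
    simp only [Function.comp]
    have h1 : min (r : ℝ≥0) u = t (k r) := by
      simp only [ht, hkc r, if_true]; exact (hkr r).symm
    rw [h1]
    have h2 : ∀ j, ∑ i ∈ Finset.range j, W i ω = N (t j) ω := by
      intro j
      induction j with
      | zero => simp [ht, h0, hzero]
      | succ j ih =>
        rw [Finset.sum_range_succ, ih]
        have : N (t j) ω ≤ N (t (j + 1)) ω := hmono (t j).2 (t (j + 1)).2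
          (by exact_mod_cast htm (Nat.le_succ j))
        simp only [hW]
        omega
    rw [← h2, Finset.sum_range]
  · refine .of_forall fun ω => ?_
    simp [hW, ht]

/-! ### Independence and law of an increment inside one phase -/

section Base

variable {s : ℕ → ℝ} {d : ℕ} {τ : ℝ} {lam : Fin d → ℝ} {F : Fin d → Measure ℝ}
  {N : ℝ → Ω → ℕ} {Z : Fin d → ℕ → Ω → ℝ}

namespace IsSLCP

/-- A measurable version of the driving process. -/
def version (hS : IsSLCP μ s d τ lam F N Z) (δ : ℝ) (r : ℝ) (ω : Ω) : ℝ :=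
  drivingFunctional hS.partition δ (hS.partition.exists_le r).choose r
    (fun t => N t ω) fun i => Z i.1 i.2 ω

variable (hS : IsSLCP μ s d τ lam F N Z) (δ : ℝ)
include hS

lemma isProbabilityMeasure_mark (j : Fin d) : IsProbabilityMeasure (F j) :=
  (hS.marks_law j 0).isProbabilityMeasure_iff.1 inferInstance

lemma measurable_count_path : Measurable fun ω (t : ℝ≥0) => N t ω :=
  measurable_pi_lambda _ fun t => hS.poisson.measurable t t.2

lemma measurable_marks : Measurable fun ω (i : Fin d × ℕ) => Z i.1 i.2 ω :=
  measurable_pi_lambda _ fun i => hS.marks_measurable i.1 i.2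

lemma measurable_version (r : ℝ) : Measurable (hS.version δ r) :=
  Measurable.comp (g := fun p : (ℝ≥0 → ℕ) × (Fin d × ℕ → ℝ) =>
      drivingFunctional hS.partition δ (hS.partition.exists_le r).choose r p.1 p.2)
    (f := fun ω => (fun t : ℝ≥0 => N t ω, fun i : Fin d × ℕ => Z i.1 i.2 ω))
    (measurable_drivingFunctional hS.partition δ _ r)
    (hS.measurable_count_path.prodMk hS.measurable_marks)

lemma version_ae_eq :
    ∀ᵐ ω ∂μ, ∀ r, 0 ≤ r → drivingProcess δ N (jumpSize s d N Z) r ω = hS.version δ r ω := by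
  filter_upwards [hS.poisson.zero, hS.poisson.mono, hS.poisson.right_cont] with ω h0 hm hr r hr0
  exact drivingProcess_eq hS.partition h0 hm hr hr0 (hS.partition.exists_le r).choose_spec

/-- With `m` the count at the present time, these are the marks already consumed and the marks still
to come in phase `j`. -/
lemma indepFun_marks (m : ℕ) (j : Fin d) :
    IndepFun (fun ω (i : Fin d × ℕ) => if i.2 < m then Z i.1 i.2 ω else 0)
      (fun ω k => Z j (m + k) ω) μ := by
  have h := indep_iSup_of_disjoint (S := {i : Fin d × ℕ | i.2 < m}) (T := {i | m ≤ i.2})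
    (fun i : Fin d × ℕ => (hS.marks_measurable i.1 i.2).comap_le) hS.marks_indep
    (Set.disjoint_left.2 fun i (hi : i.2 < m) (hi' : m ≤ i.2) => absurd hi (not_lt.2 hi'))
  refine indep_of_indep_of_le h ?_ ?_
  · refine Measurable.comap_le ((@measurable_pi_iff _ _ _ (_) _ _).2 fun i => ?_)
    by_cases hi : i.2 < m
    · simp only [hi, if_true]
      exact Measurable.mono (comap_measurable (Z i.1 i.2)) (le_biSup (f := fun i : Fin d × ℕ =>
        MeasurableSpace.comap (Z i.1 i.2) inferInstance) hi) le_rfl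
    · simp only [hi, if_false]
      exact measurable_const
  · refine Measurable.comap_le ((@measurable_pi_iff _ _ _ (_) _ _).2 fun k => ?_)
    exact Measurable.mono (comap_measurable (Z j (m + k))) (le_biSup (f := fun i : Fin d × ℕ =>
      MeasurableSpace.comap (Z i.1 i.2) inferInstance) (i := (j, m + k)) (Nat.le_add_right m k))
      le_rfl

lemma hasLaw_marks (m : ℕ) (j : Fin d) :
    HasLaw (fun ω k => Z j (m + k) ω) (Measure.infinitePi fun _ => F j) μ := by
  have h1 : iIndepFun (fun (k : ℕ) => Z j (m + k)) μ :=
    hS.marks_indep.precomp (g := fun k : ℕ => (j, m + k)) fun a b hab => by simpa using hab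
  refine ⟨(measurable_pi_lambda _ fun k => hS.marks_measurable j _).aemeasurable, ?_⟩
  rw [h1.map_fun_eq_infinitePi_map fun k => hS.marks_measurable j _]
  congr 1
  ext1 k
  exact (hS.marks_law j (m + k)).map_eq

/-- Conditionally on the count at time `u`, the past and the increment over an interval inside a
phase are expressed by independent blocks of data. -/
lemma indepFun_blocks {u v : ℝ≥0} (huv : u ≤ v) (m : ℕ) (j : Fin d) :
    IndepFun (fun ω => ((fun r : ℝ≥0 => N (min r u : ℝ≥0) ω),
        fun i : Fin d × ℕ => if i.2 < m then Z i.1 i.2 ω else 0))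
      (fun ω => (N v ω - N u ω, fun k => Z j (m + k) ω)) μ := by
  have hNm : ∀ r : ℝ≥0, Measurable (N r) := fun r => hS.poisson.measurable r r.2
  refine indepFun_prodMk_prodMk_of_blocks
    (measurable_pi_lambda _ fun r => hNm _).aemeasurable
    ((hNm v).sub (hNm u)).aemeasurable (measurable_pi_lambda _ fun i => ?_).aemeasurable
    (measurable_pi_lambda _ fun k => hS.marks_measurable _ _).aemeasurable ?_
    (hS.poisson.indepFun_past huv) (hS.indepFun_marks m j)
  · split_ifs
    · exact hS.marks_measurable _ _
    · exact measurable_const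
  · refine hS.marks_indep_count.comp
      (φ := fun η : ℝ≥0 → ℕ => ((fun r : ℝ≥0 => η (min r u)), η v - η u))
      (ψ := fun z : Fin d × ℕ → ℝ => ((fun i : Fin d × ℕ => if i.2 < m then z i else 0),
        fun k => z (j, m + k))) ?_ ?_
    · exact (measurable_pi_lambda _ fun r => measurable_pi_apply _).prodMk
        ((measurable_pi_apply v).sub (measurable_pi_apply u))
    · refine (measurable_pi_lambda _ fun i => ?_).prodMk
        (measurable_pi_lambda _ fun k => measurable_pi_apply _)
      split_ifs
      · exact measurable_pi_apply _
      · exact measurable_const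

/-- On `{N u = m}` the past depends on the stopped count and the marks of index below `m`, and the
increment on `N v - N u` and the marks of phase `i` from index `m` on. These blocks are independent
and the law of the second is the same for every `m`, so summing over `m` gives the product. -/
lemma measure_past_inter_increment {u v : ℝ≥0} {i : ℕ} (hu : s i ≤ u) (huv : u ≤ v)
    (hv : v ≤ s (i + 1)) {A : Set (ℝ≥0 → ℝ)} (hA : MeasurableSet A) {B : Set ℝ}
    (hB : MeasurableSet B) :
    μ ((fun ω (r : ℝ≥0) => hS.version δ (min r u : ℝ≥0) ω) ⁻¹' A ∩
      (fun ω => hS.version δ v ω - hS.version δ u ω) ⁻¹' B) =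
    μ ((fun ω (r : ℝ≥0) => hS.version δ (min r u : ℝ≥0) ω) ⁻¹' A) *
      (compoundPoisson (cumIntensity s d lam v - cumIntensity s d lam u).toNNReal
        (F (hS.partition.phase i))).map (fun x => δ * (v - u) + x) B := by
  set j := hS.partition.phase i with hj
  have := hS.isProbabilityMeasure_mark j
  have hNm : ∀ r : ℝ≥0, Measurable (N r) := fun r => hS.poisson.measurable r r.2
  set Kr : ℝ≥0 → ℕ := fun r => (hS.partition.exists_le ((min r u : ℝ≥0) : ℝ)).choose with hKr
  set H : (ℝ≥0 → ℕ) × (Fin d × ℕ → ℝ) → ℝ≥0 → ℝ := fun p r =>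
    drivingFunctional hS.partition δ (Kr r) (min r u : ℝ≥0) p.1 p.2 with hH
  have hHm : Measurable H := measurable_pi_lambda _ fun r =>
    measurable_drivingFunctional hS.partition δ _ _
  set P : Ω → ℝ≥0 → ℕ := fun ω r => N (min r u : ℝ≥0) ω with hP
  set Q : ℕ → Ω → Fin d × ℕ → ℝ := fun m ω i => if i.2 < m then Z i.1 i.2 ω else 0 with hQ
  set X : ℕ × (ℕ → ℝ) → ℝ := fun p => δ * (v - u) + ∑ k ∈ Finset.range p.1, p.2 k with hX
  have hXm : Measurable X := measurable_randomSum.const_add _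
  set ρ := (compoundPoisson (cumIntensity s d lam v - cumIntensity s d lam u).toNNReal
        (F j)).map (fun x => δ * ((v : ℝ) - u) + x) with hρ
  -- the law of the increment given the count
  have hlaw : ∀ m, μ ((fun ω => X (N v ω - N u ω, fun k => Z j (m + k) ω)) ⁻¹' B) = ρ B := by
    intro m
    have h1 : HasLaw (fun ω => (N v ω - N u ω, fun k => Z j (m + k) ω))
        ((poissonMeasure (cumIntensity s d lam v - cumIntensity s d lam u).toNNReal).prod
          (Measure.infinitePi fun _ => F j)) μ := by
      refine IndepFun.hasLaw_prod (hS.poisson.law u v u.2 (by exact_mod_cast huv))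
        (hS.hasLaw_marks m j) ?_
      exact hS.marks_indep_count.comp (φ := fun η : ℝ≥0 → ℕ => η v - η u)
        (ψ := fun z : Fin d × ℕ → ℝ => fun k => z (j, m + k))
        ((measurable_pi_apply v).sub (measurable_pi_apply u))
        (measurable_pi_lambda _ fun k => measurable_pi_apply _)
    have h2 : ρ = ((poissonMeasure (cumIntensity s d lam v - cumIntensity s d lam u).toNNReal).prod
          (Measure.infinitePi fun _ => F j)).map X := by
      rw [hρ, compoundPoisson, Measure.map_map (by fun_prop) measurable_randomSum]
      rfl
    rw [h2, ← h1.map_eq, Measure.map_map hXm, Measure.map_apply (hXm.comp ?_) hB]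
    · rfl
    all_goals exact (((hNm v).sub (hNm u)).prodMk
      (measurable_pi_lambda _ fun k => hS.marks_measurable _ _))
  have hQm : ∀ m, Measurable (Q m) := fun m => measurable_pi_lambda _ fun i => by
    simp only [hQ]
    split_ifs
    · exact hS.marks_measurable _ _
    · exact measurable_const
  have hfiber : ∀ m, μ (N u ⁻¹' {m} ∩ ((fun ω (r : ℝ≥0) => hS.version δ (min r u : ℝ≥0) ω) ⁻¹' A ∩
      (fun ω => hS.version δ v ω - hS.version δ u ω) ⁻¹' B)) =
      μ (N u ⁻¹' {m} ∩ (fun ω (r : ℝ≥0) => hS.version δ (min r u : ℝ≥0) ω) ⁻¹' A) * ρ B := by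
    intro m
    have hpast : ∀ᵐ ω ∂μ, N u ω = m →
        (fun r : ℝ≥0 => hS.version δ (min r u : ℝ≥0) ω) = H (P ω, Q m ω) := by
      filter_upwards [hS.poisson.mono] with ω hm hNu
      ext r
      simp only [hH, version, drivingFunctional]
      congr 1
      refine Finset.sum_congr rfl fun k _ => ?_
      -- The functional at time `min r u` reads the count only at times up to `u`, so stopping the
      -- count at `u` changes nothing.
      have hmin : ∀ x : ℝ, 0 ≤ x → min (min x ((min r u : ℝ≥0) : ℝ)).toNNReal u =
          (min x ((min r u : ℝ≥0) : ℝ)).toNNReal := fun x hx => by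
        apply min_eq_left
        rw [Real.toNNReal_le_iff_le_coe]
        exact (min_le_right _ _).trans (by exact_mod_cast min_le_right _ _)
      simp only [hP, hQ, hmin _ (hS.partition.nonneg _)]
      refine Finset.sum_congr rfl fun n hn => ?_
      rw [Finset.mem_Ico] at hn
      have h3 : n < m := by
        refine hn.2.trans_le (hNu ▸ hm (NNReal.coe_nonneg _) (NNReal.coe_nonneg _) ?_)
        rw [← hmin _ (hS.partition.nonneg _)]
        exact_mod_cast min_le_right _ _
      simp [h3]
    have hinc : ∀ᵐ ω ∂μ, N u ω = m → hS.version δ v ω - hS.version δ u ω =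
        X (N v ω - N u ω, fun k => Z j (m + k) ω) := by
      filter_upwards [hS.poisson.mono, hS.poisson.right_cont, hS.version_ae_eq δ]
        with ω hm hr hver hNu
      rw [← hver v v.2, ← hver u u.2, drivingProcess_sub_eq hS.partition hm hr hu
        (by exact_mod_cast huv) hv, Finset.sum_Ico_eq_sum_range, hNu]
    have e1 : (N u ⁻¹' {m} ∩ ((fun ω (r : ℝ≥0) => hS.version δ (min r u : ℝ≥0) ω) ⁻¹' A ∩
        (fun ω => hS.version δ v ω - hS.version δ u ω) ⁻¹' B) : Set Ω) =ᵐ[μ]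
        ((fun ω => (P ω, Q m ω)) ⁻¹' {p | p.1 u = m ∧ H p ∈ A} ∩
        (fun ω => (N v ω - N u ω, fun k => Z j (m + k) ω)) ⁻¹' (X ⁻¹' B) : Set Ω) := by
      filter_upwards [hpast, hinc] with ω h1 h2
      refine propext ?_
      change (N u ω = m ∧ _ ∈ A ∧ _ ∈ B) ↔
        ((N (min u u : ℝ≥0) ω = m ∧ H (P ω, Q m ω) ∈ A) ∧ X _ ∈ B)
      rw [min_self]
      constructor
      · rintro ⟨h3, h4, h5⟩
        rw [← h1 h3, ← h2 h3]
        exact ⟨⟨h3, h4⟩, h5⟩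
      · rintro ⟨⟨h3, h4⟩, h5⟩
        rw [← h1 h3] at h4
        rw [← h2 h3] at h5
        exact ⟨h3, h4, h5⟩
    have e2 : (N u ⁻¹' {m} ∩ (fun ω (r : ℝ≥0) => hS.version δ (min r u : ℝ≥0) ω) ⁻¹' A : Set Ω)
        =ᵐ[μ] ((fun ω => (P ω, Q m ω)) ⁻¹' {p | p.1 u = m ∧ H p ∈ A} : Set Ω) := by
      filter_upwards [hpast] with ω h1
      refine propext ?_
      change (N u ω = m ∧ _ ∈ A) ↔ (N (min u u : ℝ≥0) ω = m ∧ H (P ω, Q m ω) ∈ A)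
      rw [min_self]
      constructor
      · rintro ⟨h3, h4⟩
        rw [← h1 h3]
        exact ⟨h3, h4⟩
      · rintro ⟨h3, h4⟩
        rw [← h1 h3] at h4
        exact ⟨h3, h4⟩
    have hms : MeasurableSet {p : (ℝ≥0 → ℕ) × (Fin d × ℕ → ℝ) | p.1 u = m ∧ H p ∈ A} :=
      MeasurableSet.inter ((show Measurable fun p : (ℝ≥0 → ℕ) × (Fin d × ℕ → ℝ) => p.1 u by
        fun_prop) (measurableSet_singleton m)) (hHm hA)
    rw [measure_congr e1, measure_congr e2,
      (hS.indepFun_blocks huv m j).measure_inter_preimage_eq_mul _ _ hms (hXm hB), ← hlaw m]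
    rfl
  rw [measure_eq_tsum_inter_fiber (hNm u), measure_eq_tsum_inter_fiber (μ := μ) (hNm u)
    ((fun ω (r : ℝ≥0) => hS.version δ (min r u : ℝ≥0) ω) ⁻¹' A), ← ENNReal.tsum_mul_right]
  exact tsum_congr hfiber

end IsSLCP

end Base

end SLDCogarch

namespace SLDCogarch

variable {Ω : Type*} [MeasurableSpace Ω] {μ : Measure Ω} [IsProbabilityMeasure μ]

/-! ### The driving process over arbitrary intervals -/

/-- A process whose increments are independent of the past `𝓕`, centred, of variance at most `C`
per unit of time, and with a `τ`-periodic law. -/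
structure IsDriver (μ : Measure Ω) (𝓕 : ℝ → MeasurableSpace Ω) (X : ℝ → Ω → ℝ) (τ C : ℝ) :
    Prop where
  le : ∀ t, 𝓕 t ≤ ‹MeasurableSpace Ω›
  mono : ∀ u v, 0 ≤ u → u ≤ v → 𝓕 u ≤ 𝓕 v
  adapted : ∀ u v, 0 ≤ u → u ≤ v → Measurable[𝓕 v] (X u)
  indep : ∀ u v, 0 ≤ u → u ≤ v →
    Indep (𝓕 u) (MeasurableSpace.comap (fun ω => X v ω - X u ω) inferInstance) μ
  ident : ∀ u v, 0 ≤ u → u ≤ v →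
    IdentDistrib (fun ω => X v ω - X u ω) (fun ω => X (v + τ) ω - X (u + τ) ω) μ μ
  memLp : ∀ u v, 0 ≤ u → u ≤ v → MemLp (fun ω => X v ω - X u ω) 2 μ
  mean : ∀ u v, 0 ≤ u → u ≤ v → ∫ ω, (X v ω - X u ω) ∂μ = 0
  sq_le : ∀ u v, 0 ≤ u → u ≤ v → ∫ ω, (X v ω - X u ω) ^ 2 ∂μ ≤ C * (v - u)
  nonneg : 0 ≤ C

/-- Induction on the number of partition points needed to reach `v`, splitting off the last
interval. It carries facts about compound Poisson increments to intervals that cross several phases.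
-/
lemma IsPeriodicPartition.interval_induction {s : ℕ → ℝ} {d : ℕ} {τ : ℝ}
    (h : IsPeriodicPartition s d τ) {P : ℝ≥0 → ℝ≥0 → Prop}
    (base : ∀ (i : ℕ) (u v : ℝ≥0), s i ≤ u → u ≤ v → v ≤ s (i + 1) → P u v)
    (trans : ∀ u w v, u ≤ w → w ≤ v → P u w → P w v → P u v) {u v : ℝ≥0} (huv : u ≤ v) :
    P u v := by
  have key : ∀ k : ℕ, ∀ u v : ℝ≥0, u ≤ v → v ≤ s k → P u v := by
    intro k
    induction k with
    | zero =>
      intro u v huv hv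
      refine base 0 u v (by rw [h.zero]; exact u.2) huv
        (hv.trans (h.strictMono.monotone (Nat.zero_le _)))
    | succ k ih =>
      intro u v huv hv
      rcases le_total (v : ℝ) (s k) with h1 | h1
      · exact ih u v huv h1
      rcases le_total (s k) u with h2 | h2
      · exact base k u v h2 huv hv
      · let w : ℝ≥0 := ⟨s k, h.nonneg k⟩
        exact trans u w v h2 h1 (ih u w h2 le_rfl) (base k w v le_rfl h1 hv)
  obtain ⟨k, hk⟩ := h.exists_le v
  exact key k u v huv hk

namespace IsSLCP

variable {s : ℕ → ℝ} {d : ℕ} {τ : ℝ} {lam : Fin d → ℝ} {F : Fin d → Measure ℝ}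
  {N : ℝ → Ω → ℕ} {Z : Fin d → ℕ → Ω → ℝ} (hS : IsSLCP μ s d τ lam F N Z) (δ : ℝ)
include hS

lemma measurable_past (u : ℝ≥0) :
    Measurable fun ω (r : ℝ≥0) => hS.version δ (min r u : ℝ≥0) ω :=
  measurable_pi_lambda _ fun _ => hS.measurable_version δ _

lemma measurable_increment (u v : ℝ) :
    Measurable fun ω => hS.version δ v ω - hS.version δ u ω :=
  (hS.measurable_version δ v).sub (hS.measurable_version δ u)

lemma hasLaw_increment {u v : ℝ≥0} {i : ℕ} (hu : s i ≤ u) (huv : u ≤ v) (hv : v ≤ s (i + 1)) :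
    HasLaw (fun ω => hS.version δ v ω - hS.version δ u ω)
      ((compoundPoisson (cumIntensity s d lam v - cumIntensity s d lam u).toNNReal
        (F (hS.partition.phase i))).map (fun x => δ * (v - u) + x)) μ := by
  refine ⟨(hS.measurable_increment δ u v).aemeasurable, ?_⟩
  ext B hB
  have := hS.measure_past_inter_increment δ hu huv hv MeasurableSet.univ hB
  rw [Set.preimage_univ, Set.univ_inter, measure_univ, one_mul] at this
  rw [Measure.map_apply (hS.measurable_increment δ u v) hB, this]

lemma indepFun_past_increment {u v : ℝ≥0} (huv : u ≤ v) :
    IndepFun (fun ω (r : ℝ≥0) => hS.version δ (min r u : ℝ≥0) ω)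
      (fun ω => hS.version δ v ω - hS.version δ u ω) μ := by
  refine hS.partition.interval_induction (P := fun u v => IndepFun
    (fun ω (r : ℝ≥0) => hS.version δ (min r u : ℝ≥0) ω)
      (fun ω => hS.version δ v ω - hS.version δ u ω) μ) (fun i u v hu huv hv => ?_)
    (fun u w v huw hwv h1 h2 => ?_) huv
  · rw [indepFun_iff_measure_inter_preimage_eq_mul]
    intro A B hA hB
    rw [hS.measure_past_inter_increment δ hu huv hv hA hB, ← (hS.hasLaw_increment δ hu huv hv).map_eq,
      Measure.map_apply (hS.measurable_increment δ u v) hB]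
  -- The later increment is independent of the past of `w`, which contains both the earlier
  -- increment and the past of `u`; associativity of independence then moves both increments to one
  -- side.
  · have h3 : IndepFun (fun ω => hS.version δ v ω - hS.version δ w ω)
        (fun ω => (hS.version δ w ω - hS.version δ u ω,
          fun (r : ℝ≥0) => hS.version δ (min r u : ℝ≥0) ω)) μ := by
      have := (h2.comp (φ := fun x : ℝ≥0 → ℝ => (x w - x u, fun r : ℝ≥0 => x (min r u)))
        (by fun_prop) measurable_id).symm
      refine this.congr .rfl (.of_forall fun ω => ?_)
      simp only [Function.comp, min_self, min_eq_left huw, min_assoc]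
    have h4 := indepFun_prodMk_of_indepFun (hS.measurable_increment δ w v).aemeasurable
      (hS.measurable_increment δ u w).aemeasurable (hS.measurable_past δ u).aemeasurable h3 h1.symm
    have h5 := (h4.comp (φ := fun x : ℝ × ℝ => x.1 + x.2) (by fun_prop) measurable_id).symm
    refine h5.congr .rfl (.of_forall fun ω => ?_)
    simp only [Function.comp]
    ring

lemma indepFun_increment_increment {u w v : ℝ≥0} (huw : u ≤ w) (hwv : w ≤ v) :
    IndepFun (fun ω => hS.version δ w ω - hS.version δ u ω)
      (fun ω => hS.version δ v ω - hS.version δ w ω) μ := by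
  have := (hS.indepFun_past_increment δ hwv).comp (φ := fun x : ℝ≥0 → ℝ => x w - x u)
    (by fun_prop) measurable_id
  refine this.congr (.of_forall fun ω => ?_) .rfl
  simp only [Function.comp, min_self, min_eq_left huw]

lemma identDistrib_increment {t : ℝ≥0} (ht : (t : ℝ) = τ) {u v : ℝ≥0} (huv : u ≤ v) :
    IdentDistrib (fun ω => hS.version δ v ω - hS.version δ u ω)
      (fun ω => hS.version δ (v + t : ℝ≥0) ω - hS.version δ (u + t : ℝ≥0) ω) μ μ := by
  refine hS.partition.interval_induction (P := fun u v => IdentDistrib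
      (fun ω => hS.version δ v ω - hS.version δ u ω)
      (fun ω => hS.version δ (v + t : ℝ≥0) ω - hS.version δ (u + t : ℝ≥0) ω) μ μ)
    (fun i u v hu huv hv => ?_) (fun u w v huw hwv h1 h2 => ?_) huv
  · have h1 := hS.hasLaw_increment δ hu huv hv
    have h2 := hS.hasLaw_increment δ (i := i + d) (u := u + t) (v := v + t)
      (by rw [hS.partition.add_period]; push_cast; linarith) (by gcongr)
      (by rw [add_right_comm, hS.partition.add_period]; push_cast; linarith)
    rw [hS.partition.phase_add] at h2
    push_cast at h2
    rw [ht, cumIntensity_sub_add_period (u := u) (v := v) hS.partition hS.intensity_nonneg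
      u.2 (by exact_mod_cast huv), add_sub_add_right_eq_sub] at h2
    have := h1.identDistrib h2
    push_cast
    rwa [ht]
  · have h3 := hS.indepFun_increment_increment δ huw hwv
    have h4 := hS.indepFun_increment_increment δ (u := u + t) (w := w + t) (v := v + t)
      (by gcongr) (by gcongr)
    have h5 := (h1.prodMk h2 h3 h4).comp (u := fun x : ℝ × ℝ => x.1 + x.2) (by fun_prop)
    have e1 : ∀ u w v : ℝ≥0, (fun x : ℝ × ℝ => x.1 + x.2) ∘ (fun ω => (hS.version δ w ω - hS.version δ u ω,
        hS.version δ v ω - hS.version δ w ω)) = fun ω => hS.version δ v ω - hS.version δ u ω := by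
      intro u w v
      ext ω
      simp only [Function.comp]
      ring
    rwa [e1, e1] at h5

/-- Each contribution is linear in `v - u`: the length is at most `τ`, which absorbs one factor of
the squared drift and bounds the exponential of the Poisson mean. -/
lemma lintegral_sq_increment_le {u v : ℝ≥0} {i : ℕ} (hu : s i ≤ u) (huv : u ≤ v)
    (hv : v ≤ s (i + 1)) :
    ∫⁻ ω, ENNReal.ofReal ((hS.version δ v ω - hS.version δ u ω) ^ 2) ∂μ ≤
      ENNReal.ofReal ((2 * δ ^ 2 * τ + 2 * ((∑ j, lam j) * Real.exp ((∑ j, lam j) * τ)) *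
        ∑ j, ∫ z, z ^ 2 ∂(F j)) * (v - u)) := by
  set L := ∑ j, lam j with hL
  have hL0 : 0 ≤ L := Finset.sum_nonneg fun j _ => hS.intensity_nonneg j
  set j := hS.partition.phase i
  have := hS.isProbabilityMeasure_mark j
  set c := (cumIntensity s d lam v - cumIntensity s d lam u).toNNReal with hc
  set h : ℝ := v - u with hh
  have hh0 : 0 ≤ h := sub_nonneg.2 (by exact_mod_cast huv)
  have hhτ : h ≤ τ := by
    have h1 : s (i + 1) ≤ s (i + d) := hS.partition.strictMono.monotone (by
      have := hS.partition.pos; omega)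
    rw [hS.partition.add_period] at h1
    linarith
  have hcL : (c : ℝ) ≤ L * h := by
    rw [hc, Real.coe_toNNReal']
    exact max_le (cumIntensity_sub_le hS.intensity_nonneg (by exact_mod_cast huv)) (by positivity)
  have hcL' : (c : ℝ) ≤ L * τ := hcL.trans (by gcongr)
  set m := ∫ z, z ^ 2 ∂(F j) with hm
  have hm0 : 0 ≤ m := integral_nonneg fun z => sq_nonneg z
  have hmle : m ≤ ∑ j, ∫ z, z ^ 2 ∂(F j) :=
    Finset.single_le_sum (f := fun j => ∫ z, z ^ 2 ∂(F j))
      (fun j _ => integral_nonneg fun z => sq_nonneg z) (Finset.mem_univ j)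
  have hlint : ∫⁻ z, ENNReal.ofReal (z ^ 2) ∂(F j) = ENNReal.ofReal m :=
    (ofReal_integral_eq_lintegral_ofReal (hS.second_moment j) (.of_forall fun z => sq_nonneg z)).symm
  have hlaw := hS.hasLaw_increment δ hu huv hv
  have h1 : ∫⁻ ω, ENNReal.ofReal ((hS.version δ v ω - hS.version δ u ω) ^ 2) ∂μ =
      ∫⁻ x, ENNReal.ofReal ((δ * h + x) ^ 2) ∂(compoundPoisson c (F j)) := by
    rw [← lintegral_map (μ := compoundPoisson c (F j)) (f := fun y : ℝ => ENNReal.ofReal (y ^ 2))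
      (g := fun x => δ * h + x) (by fun_prop) (by fun_prop), ← hlaw.map_eq,
      lintegral_map (by fun_prop) (hS.measurable_increment δ u v)]
  rw [h1]
  calc _ ≤ ∫⁻ x, ENNReal.ofReal (2 * (δ * h) ^ 2) + ENNReal.ofReal 2 * ENNReal.ofReal (x ^ 2)
          ∂(compoundPoisson c (F j)) := by
        refine lintegral_mono fun x => ?_
        rw [← ENNReal.ofReal_mul (by norm_num), ← ENNReal.ofReal_add (by positivity) (by positivity)]
        exact ENNReal.ofReal_le_ofReal (by nlinarith [sq_nonneg (δ * h - x)])
    _ = ENNReal.ofReal (2 * (δ * h) ^ 2) +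
          ENNReal.ofReal 2 * ∫⁻ x, ENNReal.ofReal (x ^ 2) ∂(compoundPoisson c (F j)) := by
        rw [lintegral_add_left (by fun_prop), lintegral_const, measure_univ, mul_one,
          lintegral_const_mul _ (by fun_prop)]
    _ ≤ ENNReal.ofReal (2 * (δ * h) ^ 2) +
          ENNReal.ofReal 2 * (ENNReal.ofReal (c * Real.exp c) * ENNReal.ofReal m) := by
        gcongr
        rw [← hlint]
        exact lintegral_sq_compoundPoisson_le c (F j)
    _ = ENNReal.ofReal (2 * (δ * h) ^ 2 + 2 * ((c * Real.exp c) * m)) := by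
        rw [← ENNReal.ofReal_mul (by positivity), ← ENNReal.ofReal_mul (by positivity),
          ← ENNReal.ofReal_add (by positivity) (by positivity)]
    _ ≤ _ := by
        refine ENNReal.ofReal_le_ofReal ?_
        have h2 : (c : ℝ) * Real.exp c * m ≤
            L * h * Real.exp (L * τ) * ∑ j, ∫ z, z ^ 2 ∂(F j) := by gcongr
        have h3 : 2 * (δ * h) ^ 2 ≤ 2 * δ ^ 2 * τ * h := by
          have : δ ^ 2 * (h * h) ≤ δ ^ 2 * (τ * h) := by gcongr
          nlinarith
        nlinarith

lemma memLp_increment {u v : ℝ≥0} (huv : u ≤ v) :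
    MemLp (fun ω => hS.version δ v ω - hS.version δ u ω) 2 μ := by
  refine hS.partition.interval_induction (P := fun u v => MemLp
      (fun ω => hS.version δ v ω - hS.version δ u ω) 2 μ)
    (fun i u v hu huv hv => ?_) (fun u w v huw hwv h1 h2 => ?_) huv
  · rw [memLp_two_iff_integrable_sq (hS.measurable_increment δ u v).aestronglyMeasurable]
    refine ⟨((hS.measurable_increment δ u v).pow_const 2).aestronglyMeasurable, ?_⟩
    rw [hasFiniteIntegral_iff_ofReal (.of_forall fun ω => sq_nonneg _)]
    exact (hS.lintegral_sq_increment_le δ hu huv hv).trans_lt ENNReal.ofReal_lt_top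
  · refine (h1.add h2).ae_eq (.of_forall fun ω => ?_)
    simp only [Pi.add_apply]
    ring

variable (hmean : ∀ t, 0 ≤ t → ∫ ω, drivingProcess δ N (jumpSize s d N Z) t ω ∂μ = 0)
include hmean

/-- The driver starts at 0 almost surely, so square-integrable increments make it integrable and its
integral can be split. -/
lemma integral_increment (u v : ℝ≥0) :
    ∫ ω, (hS.version δ v ω - hS.version δ u ω) ∂μ = 0 := by
  have h0 : ∀ᵐ ω ∂μ, hS.version δ 0 ω = 0 := by
    filter_upwards [hS.version_ae_eq δ, hS.poisson.zero] with ω h1 h2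
    rw [← h1 0 le_rfl]
    simp [drivingProcess, h2]
  have h1 : ∀ w : ℝ≥0, Integrable (hS.version δ w) μ := fun w => by
    refine ((hS.memLp_increment δ (zero_le (a := w))).integrable one_le_two).congr ?_
    filter_upwards [h0] with ω h
    simp [h]
  have h2 : ∀ w : ℝ≥0, ∫ ω, hS.version δ w ω ∂μ = 0 := fun w => by
    rw [← hmean w w.2]
    refine integral_congr_ae ?_
    filter_upwards [hS.version_ae_eq δ] with ω h
    exact (h w w.2).symm
  rw [integral_sub (h1 v) (h1 u), h2, h2, sub_zero]

/-- Centred independent increments are orthogonal, so second moments add over adjacent intervals and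
the constant valid in each phase is valid throughout. -/
lemma integral_sq_increment_le {u v : ℝ≥0} (huv : u ≤ v) :
    ∫ ω, (hS.version δ v ω - hS.version δ u ω) ^ 2 ∂μ ≤
      (2 * δ ^ 2 * τ + 2 * ((∑ j, lam j) * Real.exp ((∑ j, lam j) * τ)) *
        ∑ j, ∫ z, z ^ 2 ∂(F j)) * (v - u) := by
  set C := 2 * δ ^ 2 * τ + 2 * ((∑ j, lam j) * Real.exp ((∑ j, lam j) * τ)) *
        ∑ j, ∫ z, z ^ 2 ∂(F j) with hC
  have hC0 : 0 ≤ C := by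
    have h1 : 0 ≤ ∑ j, lam j := Finset.sum_nonneg fun j _ => hS.intensity_nonneg j
    have h2 : 0 ≤ ∑ j, ∫ z, z ^ 2 ∂(F j) :=
      Finset.sum_nonneg fun j _ => integral_nonneg fun z => sq_nonneg z
    have h3 := hS.partition.period_pos
    positivity
  refine hS.partition.interval_induction (P := fun u v =>
    ∫ ω, (hS.version δ v ω - hS.version δ u ω) ^ 2 ∂μ ≤ C * (v - u))
    (fun i u v hu huv hv => ?_) (fun u w v huw hwv h1 h2 => ?_) huv
  · have h1 := hS.lintegral_sq_increment_le δ hu huv hv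
    have h2 : (0 : ℝ) ≤ v - u := sub_nonneg.2 (by exact_mod_cast huv)
    rw [← ofReal_integral_eq_lintegral_ofReal (hS.memLp_increment δ huv).integrable_sq
      (.of_forall fun ω => sq_nonneg _)] at h1
    exact (ENNReal.ofReal_le_ofReal_iff (by positivity)).1 h1
  · have m1 := hS.memLp_increment δ huw
    have m2 := hS.memLp_increment δ hwv
    have h3 := hS.indepFun_increment_increment δ huw hwv
    have h4 := h3.integral_fun_mul_eq_mul_integral m1.aestronglyMeasurable m2.aestronglyMeasurable
    rw [hS.integral_increment δ hmean u w, zero_mul] at h4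
    have h5 : ∀ ω, (hS.version δ v ω - hS.version δ u ω) ^ 2 =
        (hS.version δ w ω - hS.version δ u ω) ^ 2 + (hS.version δ v ω - hS.version δ w ω) ^ 2 +
        2 * ((hS.version δ w ω - hS.version δ u ω) * (hS.version δ v ω - hS.version δ w ω)) :=
      fun ω => by ring
    rw [integral_congr_ae (.of_forall h5), integral_add, integral_add, integral_const_mul, h4]
    · linarith
    · exact m1.integrable_sq
    · exact m2.integrable_sq
    · exact m1.integrable_sq.add m2.integrable_sq
    · exact (m1.integrable_mul m2).const_mul 2

/-- The driving process has independent increments with respect to the filtration generated by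
itself and a variable `Y₀` that is independent of it. -/
lemma isDriver {A : Type*} [MeasurableSpace A] {Y₀ : Ω → A} (hY : Measurable Y₀)
    (hind : IndepFun Y₀ (fun ω (t : ℝ≥0) => drivingProcess δ N (jumpSize s d N Z) t ω) μ) :
    ∃ C, IsDriver μ (fun t => MeasurableSpace.comap (fun ω => (Y₀ ω, fun (r : ℝ≥0) =>
      hS.version δ (min r t.toNNReal : ℝ≥0) ω)) inferInstance) (hS.version δ) τ C := by
  have hτ := hS.partition.period_pos.le
  have cast_le : ∀ {u v : ℝ}, u ≤ v → u.toNNReal ≤ v.toNNReal := fun h => Real.toNNReal_le_toNNReal h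
  refine ⟨2 * δ ^ 2 * τ + 2 * ((∑ j, lam j) * Real.exp ((∑ j, lam j) * τ)) *
        ∑ j, ∫ z, z ^ 2 ∂(F j), ?_, ?_, ?_, ?_, ?_, ?_, ?_, ?_, ?_⟩
  · exact fun t => (hY.prodMk (hS.measurable_past δ _)).comap_le
  · intro u v hu huv
    have h1 : (fun ω => (Y₀ ω, fun (r : ℝ≥0) => hS.version δ (min r u.toNNReal : ℝ≥0) ω)) =
        (fun p : A × (ℝ≥0 → ℝ) => (p.1, fun r : ℝ≥0 => p.2 (min r u.toNNReal))) ∘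
        (fun ω => (Y₀ ω, fun (r : ℝ≥0) => hS.version δ (min r v.toNNReal : ℝ≥0) ω)) := by
      ext ω : 1
      simp only [Function.comp, min_assoc, min_eq_left (cast_le huv)]
    rw [h1, ← MeasurableSpace.comap_comp]
    exact MeasurableSpace.comap_mono (Measurable.comap_le (by fun_prop))
  · intro u v hu huv
    have h1 : hS.version δ u = (fun p : A × (ℝ≥0 → ℝ) => p.2 u.toNNReal) ∘
        (fun ω => (Y₀ ω, fun (r : ℝ≥0) => hS.version δ (min r v.toNNReal : ℝ≥0) ω)) := by
      ext ω
      simp only [Function.comp, min_eq_left (cast_le huv), Real.coe_toNNReal _ hu]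
    rw [h1]
    exact Measurable.comp (by fun_prop) (comap_measurable _)
  · intro u v hu huv
    have h1 : IndepFun Y₀ (fun ω (t : ℝ≥0) => hS.version δ t ω) μ := by
      refine hind.congr .rfl ?_
      filter_upwards [hS.version_ae_eq δ] with ω h
      ext t
      exact h t t.2
    have h2 := h1.comp (φ := id) (ψ := fun x : ℝ≥0 → ℝ => ((fun r : ℝ≥0 => x (min r u.toNNReal)),
      x v.toNNReal - x u.toNNReal)) measurable_id (by fun_prop)
    have h3 := indepFun_prodMk_of_indepFun hY.aemeasurable
      (hS.measurable_past δ u.toNNReal).aemeasurable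
      (hS.measurable_increment δ u.toNNReal v.toNNReal).aemeasurable h2
      (hS.indepFun_past_increment δ (cast_le huv))
    rw [Real.coe_toNNReal _ hu, Real.coe_toNNReal _ (hu.trans huv)] at h3
    exact h3
  · intro u v hu huv
    have := hS.identDistrib_increment δ (Real.coe_toNNReal _ hτ) (cast_le huv)
    simpa only [NNReal.coe_add, Real.coe_toNNReal _ hu, Real.coe_toNNReal _ (hu.trans huv),
      Real.coe_toNNReal _ hτ] using this
  · intro u v hu huv
    have := hS.memLp_increment δ (cast_le huv)
    rwa [Real.coe_toNNReal _ hu, Real.coe_toNNReal _ (hu.trans huv)] at this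
  · intro u v hu huv
    have := hS.integral_increment δ hmean u.toNNReal v.toNNReal
    rwa [Real.coe_toNNReal _ hu, Real.coe_toNNReal _ (hu.trans huv)] at this
  · intro u v hu huv
    have := hS.integral_sq_increment_le δ hmean (cast_le huv)
    rwa [Real.coe_toNNReal _ hu, Real.coe_toNNReal _ (hu.trans huv)] at this
  · have h1 : 0 ≤ ∑ j, lam j := Finset.sum_nonneg fun j _ => hS.intensity_nonneg j
    have h2 : 0 ≤ ∑ j, ∫ z, z ^ 2 ∂(F j) :=
      Finset.sum_nonneg fun j _ => integral_nonneg fun z => sq_nonneg z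
    positivity

end IsSLCP

end SLDCogarch

namespace SLDCogarch

variable {Ω : Type*} [MeasurableSpace Ω] {μ : Measure Ω} [IsProbabilityMeasure μ]

/-! ### Limits of identically distributed or centred variables -/

lemma identDistrib_of_tendsto_ae {A : Type*} [TopologicalSpace A]
    [TopologicalSpace.PseudoMetrizableSpace A] [MeasurableSpace A] [BorelSpace A]
    {f f' : ℕ → Ω → A} {g g' : Ω → A} (h : ∀ n, IdentDistrib (f n) (f' n) μ μ)
    (hf : ∀ᵐ ω ∂μ, Tendsto (fun n => f n ω) atTop (𝓝 (g ω)))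
    (hf' : ∀ᵐ ω ∂μ, Tendsto (fun n => f' n ω) atTop (𝓝 (g' ω))) : IdentDistrib g g' μ μ := by
  have hg := aemeasurable_of_tendsto_metrizable_ae atTop (fun n => (h n).aemeasurable_fst) hf
  have hg' := aemeasurable_of_tendsto_metrizable_ae atTop (fun n => (h n).aemeasurable_snd) hf'
  have := Measure.isProbabilityMeasure_map hg
  have := Measure.isProbabilityMeasure_map hg'
  refine ⟨hg, hg', ext_of_forall_integral_eq_of_IsFiniteMeasure fun φ => ?_⟩
  have key : ∀ (k : ℕ → Ω → A) (l : Ω → A), (∀ n, AEMeasurable (k n) μ) →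
      (∀ᵐ ω ∂μ, Tendsto (fun n => k n ω) atTop (𝓝 (l ω))) → AEMeasurable l μ →
      Tendsto (fun n => ∫ ω, φ (k n ω) ∂μ) atTop (𝓝 (∫ x, φ x ∂(μ.map l))) := by
    intro k l hk hkl hl
    rw [integral_map hl (φ.continuous.measurable.aestronglyMeasurable)]
    refine tendsto_integral_of_dominated_convergence (fun _ => ‖φ‖)
      (fun n => (φ.continuous.measurable.comp_aemeasurable (hk n)).aestronglyMeasurable)
      (integrable_const _) (fun n => .of_forall fun ω => φ.norm_coe_le_norm _) ?_
    filter_upwards [hkl] with ω hω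
    exact (φ.continuous.tendsto _).comp hω
  have h1 := key f g (fun n => (h n).aemeasurable_fst) hf hg
  have h2 := key f' g' (fun n => (h n).aemeasurable_snd) hf' hg'
  refine tendsto_nhds_unique h1 (h2.congr fun n => ?_)
  exact ((h n).comp φ.continuous.measurable).integral_eq.symm

lemma abs_sub_clamp_le (x : ℝ) {M : ℝ} (hM : 0 < M) :
    |x - max (-M) (min x M)| ≤ x ^ 2 / M := by
  rw [le_div_iff₀ hM]
  rcases le_total x M with h1 | h1
  · rw [min_eq_left h1]
    rcases le_total (-M) x with h2 | h2
    · rw [max_eq_right h2]; simp; positivity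
    · rw [max_eq_left h2, abs_of_nonpos (by linarith)]
      nlinarith
  · rw [min_eq_right h1, max_eq_right (by linarith), abs_of_nonneg (by linarith)]
    nlinarith

/-- A bound in `L²` gives uniform integrability: clamping at level `M` changes each mean by at most
`K / M`. The clamped means converge by dominated convergence, and then `M` tends to infinity. -/
lemma integral_eq_zero_of_tendsto_ae {f : ℕ → Ω → ℝ} {g : Ω → ℝ} {K : ℝ}
    (hf : ∀ n, MemLp (f n) 2 μ) (h0 : ∀ n, ∫ ω, f n ω ∂μ = 0)
    (hK : ∀ n, ∫ ω, f n ω ^ 2 ∂μ ≤ K)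
    (hlim : ∀ᵐ ω ∂μ, Tendsto (fun n => f n ω) atTop (𝓝 (g ω))) (hg : Integrable g μ) :
    ∫ ω, g ω ∂μ = 0 := by
  have hcont : ∀ M : ℝ, Continuous fun x : ℝ => max (-M) (min x M) := fun M => by fun_prop
  have habs : ∀ (M : ℝ), 0 ≤ M → ∀ x, ‖max (-M) (min x M)‖ ≤ M := fun M hM x => by
    rw [Real.norm_eq_abs, abs_le]
    exact ⟨le_max_left _ _, max_le (by linarith) (min_le_right _ _)⟩
  have hM : ∀ M : ℝ, 0 < M → |∫ ω, max (-M) (min (g ω) M) ∂μ| ≤ K / M := by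
    intro M hM
    have h1 : Tendsto (fun n => ∫ ω, max (-M) (min (f n ω) M) ∂μ) atTop
        (𝓝 (∫ ω, max (-M) (min (g ω) M) ∂μ)) := by
      refine tendsto_integral_of_dominated_convergence (fun _ => M)
        (fun n => (hcont M).comp_aestronglyMeasurable (hf n).aestronglyMeasurable)
        (integrable_const _) (fun n => .of_forall fun ω => habs M hM.le _) ?_
      filter_upwards [hlim] with ω hω
      exact ((hcont M).tendsto _).comp hω
    refine le_of_tendsto h1.abs (.of_forall fun n => ?_)
    have h2 : Integrable (fun ω => max (-M) (min (f n ω) M)) μ :=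
      Integrable.of_bound ((hcont M).comp_aestronglyMeasurable (hf n).aestronglyMeasurable) M
        (.of_forall fun ω => habs M hM.le _)
    have h3 : |∫ ω, (f n ω - max (-M) (min (f n ω) M)) ∂μ| ≤ K / M := by
      refine (abs_integral_le_integral_abs).trans ?_
      refine (integral_mono (((hf n).integrable one_le_two).sub h2).abs
        ((hf n).integrable_sq.div_const M) fun ω => abs_sub_clamp_le _ hM).trans ?_
      rw [integral_div]
      have := hK n
      gcongr
    rw [integral_sub ((hf n).integrable one_le_two) h2, h0 n, zero_sub, abs_neg] at h3
    exact h3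
  have h4 : Tendsto (fun n : ℕ => ∫ ω, max (-((n : ℝ) + 1)) (min (g ω) ((n : ℝ) + 1)) ∂μ) atTop
      (𝓝 (∫ ω, g ω ∂μ)) := by
    refine tendsto_integral_of_dominated_convergence (fun ω => |g ω|)
      (fun n => (hcont _).comp_aestronglyMeasurable hg.aestronglyMeasurable)
      hg.abs (fun n => .of_forall fun ω => ?_) (.of_forall fun ω => ?_)
    · rw [Real.norm_eq_abs, abs_le]
      have hn : (0 : ℝ) ≤ (n : ℝ) + 1 := by positivity
      exact ⟨le_max_of_le_right (le_min (neg_abs_le _) (by linarith [abs_nonneg (g ω)])),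
        max_le (by linarith [abs_nonneg (g ω)]) ((min_le_left _ _).trans (le_abs_self _))⟩
    · refine tendsto_const_nhds.congr' ?_
      obtain ⟨m, hm⟩ := exists_nat_ge |g ω|
      filter_upwards [eventually_ge_atTop m] with n hn
      have h5 : |g ω| ≤ (n : ℝ) + 1 := hm.trans (by
        have : (m : ℝ) ≤ n := by exact_mod_cast hn
        linarith)
      rw [min_eq_left (le_of_abs_le h5), max_eq_right (neg_le_of_abs_le h5)]
  have h5 : Tendsto (fun n : ℕ => K / ((n : ℝ) + 1)) atTop (𝓝 0) := by
    have := (tendsto_one_div_add_atTop_nhds_zero_nat (𝕜 := ℝ)).const_mul K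
    simpa [div_eq_mul_inv] using this
  have h6 : Tendsto (fun n : ℕ => |∫ ω, max (-((n : ℝ) + 1)) (min (g ω) ((n : ℝ) + 1)) ∂μ|) atTop
      (𝓝 0) :=
    squeeze_zero (fun _ => abs_nonneg _) (fun n => hM _ (by positivity)) h5
  exact abs_eq_zero.1 (tendsto_nhds_unique h4.abs h6)

/-! ### The random Euler scheme -/

variable {E : Type*} [NormedAddCommGroup E] [NormedSpace ℝ E]
  [MeasurableSpace E] [BorelSpace E] [SecondCountableTopology E]
  {𝓕 : ℝ → MeasurableSpace Ω} {X : ℝ → Ω → ℝ} {τ C : ℝ} (c : Coeff E)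

/-- The Euler scheme driven by the increments of the process `X` on the grid of step `h`
after `u`. -/
def Coeff.randomEuler (X : ℝ → Ω → ℝ) (u h : ℝ) (z : Ω → E × ℝ) (k : ℕ) (ω : Ω) : E × ℝ :=
  c.euler h (gridIncrement (fun t => X t ω) u h) (z ω) k

lemma Coeff.measurable_step (h : ℝ) :
    Measurable fun p : (E × ℝ) × ℝ => c.step h p.2 p.1 := by
  have : Continuous fun p : (E × ℝ) × ℝ => c.step h p.2 p.1 := by
    unfold Coeff.step Coeff.stateStep Coeff.vol
    fun_prop
  exact this.measurable

namespace IsDriver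

variable {c} (hD : IsDriver μ 𝓕 X τ C)
include hD

lemma indepFun {A : Type*} [MeasurableSpace A] {f : Ω → A} {u v : ℝ} (hu : 0 ≤ u) (huv : u ≤ v)
    (hf : Measurable[𝓕 u] f) : IndepFun f (fun ω => X v ω - X u ω) μ :=
  indep_of_indep_of_le_left (hD.indep u v hu huv) hf.comap_le

lemma measurable_of {A : Type*} [MeasurableSpace A] {f : Ω → A} {u : ℝ}
    (hf : Measurable[𝓕 u] f) : Measurable f := hf.mono (hD.le u) le_rfl

lemma measurable_gridIncrement {u h : ℝ} (hu : 0 ≤ u) (hh : 0 ≤ h) (k : ℕ) :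
    Measurable[𝓕 (u + (k + 1 : ℕ) * h)] fun ω => gridIncrement (fun t => X t ω) u h k := by
  have h1 : 0 ≤ u + k * h := by positivity
  have h2 : u + k * h ≤ u + (k + 1 : ℕ) * h := by push_cast; nlinarith
  exact (hD.adapted _ _ (h1.trans h2) le_rfl).sub (hD.adapted _ _ h1 h2)

lemma measurable_randomEuler {u h : ℝ} (hu : 0 ≤ u) (hh : 0 ≤ h) {z : Ω → E × ℝ}
    (hz : Measurable[𝓕 u] z) (k : ℕ) :
    Measurable[𝓕 (u + k * h)] (c.randomEuler X u h z k) := by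
  induction k with
  | zero => rw [Nat.cast_zero, zero_mul, add_zero]; exact hz
  | succ k ih =>
    have h1 : 0 ≤ u + k * h := by positivity
    have h2 : u + k * h ≤ u + (k + 1 : ℕ) * h := by push_cast; nlinarith
    exact (c.measurable_step h).comp
      ((ih.mono (hD.mono _ _ h1 h2) le_rfl).prodMk (hD.measurable_gridIncrement hu hh k))

/-- Each step adds an increment that is independent of the current pair and has the same law in both
periods. The passenger `W` keeps the joint law with an earlier quantity. -/
lemma identDistrib_randomEuler (hτ : 0 ≤ τ) {B : Type*} [MeasurableSpace B] {u h : ℝ}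
    (hu : 0 ≤ u) (hh : 0 ≤ h) {W W' : Ω → B}
    {z z' : Ω → E × ℝ} (hW : Measurable[𝓕 u] W) (hW' : Measurable[𝓕 (u + τ)] W')
    (hz : Measurable[𝓕 u] z) (hz' : Measurable[𝓕 (u + τ)] z')
    (hid : IdentDistrib (fun ω => (W ω, z ω)) (fun ω => (W' ω, z' ω)) μ μ) (k : ℕ) :
    IdentDistrib (fun ω => (W ω, c.randomEuler X u h z k ω))
      (fun ω => (W' ω, c.randomEuler X (u + τ) h z' k ω)) μ μ := by
  induction k with
  | zero => exact hid
  | succ k ih =>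
    have h1 : 0 ≤ u + k * h := by positivity
    have h2 : u + k * h ≤ u + (k + 1 : ℕ) * h := by push_cast; nlinarith
    have h3 : u ≤ u + k * h := by nlinarith [mul_nonneg (Nat.cast_nonneg (α := ℝ) k) hh]
    have e1 : u + k * h + τ = u + τ + k * h := by ring
    have e2 : u + (k + 1 : ℕ) * h + τ = u + τ + (k + 1 : ℕ) * h := by ring
    have i1 := hD.indepFun h1 h2 ((hW.mono (hD.mono _ _ hu h3) le_rfl).prodMk
      (hD.measurable_randomEuler (c := c) hu hh hz k))
    have i2 := hD.indepFun (u := u + τ + k * h) (v := u + τ + (k + 1 : ℕ) * h)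
      (by positivity) (by linarith)
      ((hW'.mono (hD.mono _ _ (by positivity) (by linarith)) le_rfl).prodMk
      (hD.measurable_randomEuler (c := c) (by positivity) hh hz' k))
    have i3 := hD.ident _ _ h1 h2
    rw [e1, e2] at i3
    have i4 := ih.prodMk i3 i1 i2
    exact i4.comp (u := fun p : (B × (E × ℝ)) × ℝ => (p.1.1, c.step h p.2 p.1.2))
      ((measurable_fst.comp measurable_fst).prodMk ((c.measurable_step h).comp
        ((measurable_snd.comp measurable_fst).prodMk measurable_snd)))

end IsDriver

/-- `Y` solves the equation with coefficients `c` driven by `X`, and `I u v` is the integral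
`∫_{(u,v]} √V dX`, in the sense that both are limits of the Euler scheme. -/
def IsEulerLimit (μ : Measure Ω) (c : Coeff E) (X : ℝ → Ω → ℝ) (Y : ℝ → Ω → E)
    (I : ℝ → ℝ → Ω → ℝ) : Prop :=
  ∀ u v, 0 ≤ u → u ≤ v → ∀ᵐ ω ∂μ, Tendsto (fun n : ℕ =>
    c.randomEuler X u ((v - u) / (n + 1 : ℕ)) (fun ω => (Y u ω, 0)) (n + 1) ω) atTop
      (𝓝 (Y v ω, I u v ω))

/-- `f` has an `𝓕 t`-measurable version. -/
def HasVersion {A : Type*} [MeasurableSpace A] (μ : Measure Ω) (m : MeasurableSpace Ω)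
    (f : Ω → A) : Prop := ∃ g : Ω → A, Measurable[m] g ∧ f =ᵐ[μ] g

lemma grid_end (u v : ℝ) (n : ℕ) : u + (n + 1 : ℕ) * ((v - u) / (n + 1 : ℕ)) = v := by
  have : ((n + 1 : ℕ) : ℝ) ≠ 0 := by positivity
  field_simp
  ring

lemma randomEuler_congr {z z' : Ω → E × ℝ} {ω : Ω} (h : z ω = z' ω) (u s : ℝ) (k : ℕ) :
    c.randomEuler X u s z k ω = c.randomEuler X u s z' k ω := by
  simp only [Coeff.randomEuler, h]

variable {c} [CompleteSpace E] {Y : ℝ → Ω → E} {I : ℝ → ℝ → Ω → ℝ}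

lemma IsEulerLimit.tendsto_of_ae_eq (hE : IsEulerLimit μ c X Y I) {u v : ℝ} (hu : 0 ≤ u)
    (huv : u ≤ v) {y : Ω → E} (hy : Y u =ᵐ[μ] y) :
    ∀ᵐ ω ∂μ, Tendsto (fun n : ℕ =>
      c.randomEuler X u ((v - u) / (n + 1 : ℕ)) (fun ω => (y ω, 0)) (n + 1) ω) atTop
      (𝓝 (Y v ω, I u v ω)) := by
  filter_upwards [hE u v hu huv, hy] with ω h1 h2
  refine h1.congr fun n => randomEuler_congr c ?_ _ _ _
  simp only [h2]

/-- An Euler scheme started from the adapted version is adapted. `limUnder` chooses a limit that is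
measurable for the same σ-algebra even on the null set without convergence. -/
lemma IsDriver.hasVersion_step (hD : IsDriver μ 𝓕 X τ C) (hE : IsEulerLimit μ c X Y I)
    {u v : ℝ} (hu : 0 ≤ u) (huv : u ≤ v) (hY : HasVersion μ (𝓕 u) (Y u)) :
    HasVersion μ (𝓕 v) (Y v) ∧ HasVersion μ (𝓕 v) (I u v) := by
  obtain ⟨y, hy, hYy⟩ := hY
  have h1 := hE.tendsto_of_ae_eq hu huv hYy
  have h2 : ∀ n : ℕ, Measurable[𝓕 v]
      (c.randomEuler X u ((v - u) / (n + 1 : ℕ)) (fun ω => (y ω, 0)) (n + 1)) := by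
    intro n
    have := hD.measurable_randomEuler (c := c) (u := u) (h := (v - u) / (n + 1 : ℕ)) hu
      (div_nonneg (by linarith) (by positivity)) (z := fun ω => (y ω, 0))
      (hy.prodMk measurable_const) (n + 1)
    rwa [grid_end] at this
  have h3 := @StronglyMeasurable.limUnder _ _ _ (𝓕 v) _ _ atTop _ _ _ _ fun n =>
    (h2 n).stronglyMeasurable
  refine ⟨⟨_, measurable_fst.comp h3.measurable, ?_⟩, ⟨_, measurable_snd.comp h3.measurable, ?_⟩⟩
  · filter_upwards [h1] with ω hω
    simp only [Function.comp, hω.limUnder_eq]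
  · filter_upwards [h1] with ω hω
    simp only [Function.comp, hω.limUnder_eq]

lemma IsDriver.identDistrib_step (hD : IsDriver μ 𝓕 X τ C) (hτ : 0 ≤ τ)
    (hE : IsEulerLimit μ c X Y I) {u v : ℝ} (hu : 0 ≤ u) (huv : u ≤ v)
    (hY : HasVersion μ (𝓕 u) (Y u)) (hY' : HasVersion μ (𝓕 (u + τ)) (Y (u + τ)))
    {W W' : Ω → ℝ} (hW : HasVersion μ (𝓕 u) W) (hW' : HasVersion μ (𝓕 (u + τ)) W')
    (hid : IdentDistrib (fun ω => (W ω, Y u ω)) (fun ω => (W' ω, Y (u + τ) ω)) μ μ) :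
    IdentDistrib (fun ω => (W ω, (Y v ω, I u v ω)))
      (fun ω => (W' ω, (Y (v + τ) ω, I (u + τ) (v + τ) ω))) μ μ := by
  obtain ⟨y, hy, hYy⟩ := hY
  obtain ⟨y', hy', hYy'⟩ := hY'
  obtain ⟨w, hw, hWw⟩ := hW
  obtain ⟨w', hw', hWw'⟩ := hW'
  have h1 := hE.tendsto_of_ae_eq hu huv hYy
  have h2 := hE.tendsto_of_ae_eq (u := u + τ) (v := v + τ) (by positivity) (by linarith) hYy'
  have hid2 : IdentDistrib (fun ω => (w ω, y ω)) (fun ω => (w' ω, y' ω)) μ μ := by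
    refine ⟨hid.aemeasurable_fst.congr (hWw.prodMk hYy),
      hid.aemeasurable_snd.congr (hWw'.prodMk hYy'), ?_⟩
    rw [← Measure.map_congr (hWw.prodMk hYy), ← Measure.map_congr (hWw'.prodMk hYy')]
    exact hid.map_eq
  have hid3 : IdentDistrib (fun ω => (w ω, (y ω, (0 : ℝ)))) (fun ω => (w' ω, (y' ω, (0 : ℝ)))) μ μ :=
    hid2.comp (u := fun p : ℝ × E => (p.1, (p.2, (0 : ℝ)))) (by fun_prop)
  refine identDistrib_of_tendsto_ae (fun n => hD.identDistrib_randomEuler (c := c) hτ hu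
    (h := (v - u) / (n + 1 : ℕ)) (div_nonneg (by linarith) (by positivity)) hw hw'
    (hy.prodMk measurable_const) (hy'.prodMk measurable_const) hid3 (n + 1)) ?_ ?_
  · filter_upwards [h1, hWw] with ω hω hw
    rw [hw]
    exact tendsto_const_nhds.prodMk_nhds hω
  · filter_upwards [h2, hWw'] with ω hω hw
    rw [hw]
    rw [add_sub_add_right_eq_sub] at hω
    exact tendsto_const_nhds.prodMk_nhds hω

end SLDCogarch

namespace SLDCogarch

variable {Ω : Type*} [MeasurableSpace Ω] {μ : Measure Ω} [IsProbabilityMeasure μ]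
  {E : Type*} [NormedAddCommGroup E] [NormedSpace ℝ E]
  [MeasurableSpace E] [BorelSpace E] [SecondCountableTopology E]
  {𝓕 : ℝ → MeasurableSpace Ω} {X : ℝ → Ω → ℝ} {τ C : ℝ} {c : Coeff E}

/-! ### Moments of the Euler scheme -/

/-- The rate of growth of the first moment of the Euler scheme. -/
def Coeff.growthRate (c : Coeff E) (C T : ℝ) : ℝ :=
  ‖c.lin‖ + (‖c.form‖ * ‖c.dir‖ + |c.base| * ‖c.dir‖) * (C + c.drift ^ 2 * T)

lemma Coeff.abs_vol_le (c : Coeff E) (y : E) : |c.vol y| ≤ |c.base| + ‖c.form‖ * ‖y‖ :=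
  (abs_add_le _ _).trans (add_le_add le_rfl (c.form.le_opNorm y))

lemma Coeff.norm_stateStep_le (c : Coeff E) {h : ℝ} (hh : 0 ≤ h) (x : ℝ) (y : E) :
    ‖c.stateStep h x y‖ ≤ ‖y‖ + h * ‖c.lin‖ * ‖y‖ +
      (‖c.form‖ * ‖c.dir‖ * ‖y‖ + |c.base| * ‖c.dir‖) * (x - c.drift * h) ^ 2 := by
  refine norm_add₃_le.trans ?_
  rw [norm_smul, norm_smul, norm_mul, Real.norm_eq_abs, Real.norm_eq_abs, Real.norm_eq_abs,
    abs_of_nonneg hh, abs_of_nonneg (sq_nonneg (x - c.drift * h))]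
  have h1 := mul_le_mul_of_nonneg_left (c.lin.le_opNorm y) hh
  have h2 : |c.vol y| * (x - c.drift * h) ^ 2 * ‖c.dir‖ ≤
      (|c.base| + ‖c.form‖ * ‖y‖) * (x - c.drift * h) ^ 2 * ‖c.dir‖ := by
    have := c.abs_vol_le y
    gcongr
  nlinarith

lemma Coeff.measurable_vol (c : Coeff E) : Measurable c.vol := by
  have : Continuous c.vol := by unfold Coeff.vol; fun_prop
  exact this.measurable

namespace IsDriver

variable (hD : IsDriver μ 𝓕 X τ C)
include hD

lemma integrable_sq_sub {u v : ℝ} (hu : 0 ≤ u) (huv : u ≤ v) (a : ℝ) :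
    Integrable (fun ω => (X v ω - X u ω - a) ^ 2) μ :=
  ((hD.memLp u v hu huv).sub (memLp_const a)).integrable_sq

lemma integral_sq_sub_le {u h T : ℝ} (hu : 0 ≤ u) (hh : 0 ≤ h) (hT : h ≤ T) (δ : ℝ) :
    ∫ ω, (X (u + h) ω - X u ω - δ * h) ^ 2 ∂μ ≤ (C + δ ^ 2 * T) * h := by
  have huv : u ≤ u + h := by linarith
  have h1 : ∀ ω, (X (u + h) ω - X u ω - δ * h) ^ 2 = (X (u + h) ω - X u ω) ^ 2 -
      2 * (δ * h) * (X (u + h) ω - X u ω) + (δ * h) ^ 2 := fun ω => by ring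
  have i1 := (hD.memLp u (u + h) hu huv).integrable_sq
  have i2 := ((hD.memLp u (u + h) hu huv).integrable one_le_two).const_mul (2 * (δ * h))
  have i12 : Integrable (fun ω => (X (u + h) ω - X u ω) ^ 2 -
      2 * (δ * h) * (X (u + h) ω - X u ω)) μ := i1.sub i2
  rw [integral_congr_ae (.of_forall h1), integral_add i12 (integrable_const _),
    integral_sub i1 i2, integral_const_mul, hD.mean u (u + h) hu huv]
  have h2 := hD.sq_le u (u + h) hu huv
  simp only [mul_zero, sub_zero, integral_const, probReal_univ, smul_eq_mul, one_mul]
  have h3 : δ ^ 2 * (h * h) ≤ δ ^ 2 * (T * h) := by gcongr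
  nlinarith

lemma gridIncrement_eq (u h : ℝ) (k : ℕ) (ω : Ω) :
    gridIncrement (fun t => X t ω) u h k = X (u + k * h + h) ω - X (u + k * h) ω := by
  simp only [gridIncrement]
  push_cast
  rw [add_mul, one_mul, add_assoc]

variable {u h T R : ℝ} (hu : 0 ≤ u) (hh : 0 ≤ h) {y : Ω → E} (hy : Measurable[𝓕 u] y)
  (hR : ∀ ω, ‖y ω‖ ≤ R)
include hu hh hy hR

/-- The jump part of the new increment is independent of the current state and its square has mean
of order `h`. Hence the first moment plus 1 grows by a factor at most `1 + c.growthRate C T * h`;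
the 1 absorbs the constant term of the volatility. -/
lemma integrable_euler_state (hT : h ≤ T) (k : ℕ) :
    Integrable (fun ω => (c.randomEuler X u h (fun ω => (y ω, 0)) k ω).1) μ ∧
      ∫ ω, ‖(c.randomEuler X u h (fun ω => (y ω, 0)) k ω).1‖ ∂μ ≤
        (R + 1) * Real.exp (c.growthRate C T * (k * h)) - 1 := by
  have hT0 : 0 ≤ T := hh.trans hT
  have hC := hD.nonneg
  have hR0 : 0 ≤ R := by
    obtain ⟨ω⟩ := nonempty_of_isProbabilityMeasure μ
    exact (norm_nonneg _).trans (hR ω)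
  have hκ : 0 ≤ c.growthRate C T := by unfold Coeff.growthRate; positivity
  induction k with
  | zero =>
    have hm := hD.measurable_of hy
    have hint : Integrable y μ :=
      Integrable.of_bound hm.aestronglyMeasurable R (.of_forall hR)
    refine ⟨hint, ?_⟩
    simp only [Coeff.randomEuler, Coeff.euler]
    refine (integral_mono hint.norm (integrable_const R) hR).trans ?_
    simp
  | succ k ih =>
    obtain ⟨hi, hb⟩ := ih
    set S : Ω → E := fun ω => (c.randomEuler X u h (fun ω => (y ω, 0)) k ω).1 with hS
    have hk : 0 ≤ u + k * h := by positivity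
    have hk' : u + k * h ≤ u + k * h + h := by linarith
    set ξ : Ω → ℝ := fun ω => (X (u + k * h + h) ω - X (u + k * h) ω - c.drift * h) ^ 2 with hξ
    have hξi : Integrable ξ μ := hD.integrable_sq_sub hk hk' _
    have hξb : ∫ ω, ξ ω ∂μ ≤ (C + c.drift ^ 2 * T) * h := hD.integral_sq_sub_le hk hh hT _
    have hSm : Measurable[𝓕 (u + k * h)] S := measurable_fst.comp
      (hD.measurable_randomEuler (c := c) hu hh (hy.prodMk measurable_const) k)
    have hind : IndepFun (fun ω => ‖S ω‖) ξ μ :=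
      (hD.indepFun hk hk' hSm).comp (φ := fun y => ‖y‖)
        (ψ := fun x => (x - c.drift * h) ^ 2) (by fun_prop) (by fun_prop)
    have hprod : Integrable (fun ω => ‖S ω‖ * ξ ω) μ := hind.integrable_mul hi.norm hξi
    have hprodb := hind.integral_fun_mul_eq_mul_integral hi.norm.aestronglyMeasurable
      hξi.aestronglyMeasurable
    have hsucc : ∀ ω, (c.randomEuler X u h (fun ω => (y ω, 0)) (k + 1) ω).1 =
        c.stateStep h (X (u + k * h + h) ω - X (u + k * h) ω) (S ω) := fun ω => by
      rw [← gridIncrement_eq hD u h k ω]; rfl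
    have hle : ∀ ω, ‖(c.randomEuler X u h (fun ω => (y ω, 0)) (k + 1) ω).1‖ ≤
        (1 + h * ‖c.lin‖) * ‖S ω‖ + ‖c.form‖ * ‖c.dir‖ * (‖S ω‖ * ξ ω) +
          |c.base| * ‖c.dir‖ * ξ ω := fun ω => by
      rw [hsucc]
      refine (c.norm_stateStep_le hh _ _).trans (le_of_eq ?_)
      simp only [hξ]
      ring
    have j1 := hi.norm.const_mul (1 + h * ‖c.lin‖)
    have j2 := hprod.const_mul (‖c.form‖ * ‖c.dir‖)
    have j3 := hξi.const_mul (|c.base| * ‖c.dir‖)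
    have j12 : Integrable (fun ω => (1 + h * ‖c.lin‖) * ‖S ω‖ +
        ‖c.form‖ * ‖c.dir‖ * (‖S ω‖ * ξ ω)) μ := j1.add j2
    have hm : Measurable fun ω => (c.randomEuler X u h (fun ω => (y ω, 0)) (k + 1) ω).1 :=
      hD.measurable_of (measurable_fst.comp
        (hD.measurable_randomEuler (c := c) hu hh (hy.prodMk measurable_const) (k + 1)))
    have hint : Integrable (fun ω => (c.randomEuler X u h (fun ω => (y ω, 0)) (k + 1) ω).1) μ := by
      refine (j12.add j3).mono' hm.aestronglyMeasurable (.of_forall fun ω => ?_)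
      simpa using hle ω
    refine ⟨hint, ?_⟩
    have h1 := integral_mono hint.norm (j12.add j3) hle
    have h2 : ∫ ω, ((1 + h * ‖c.lin‖) * ‖S ω‖ + ‖c.form‖ * ‖c.dir‖ * (‖S ω‖ * ξ ω) +
          |c.base| * ‖c.dir‖ * ξ ω) ∂μ = (1 + h * ‖c.lin‖) * ∫ ω, ‖S ω‖ ∂μ +
          ‖c.form‖ * ‖c.dir‖ * ((∫ ω, ‖S ω‖ ∂μ) * ∫ ω, ξ ω ∂μ) +
          |c.base| * ‖c.dir‖ * ∫ ω, ξ ω ∂μ := by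
      rw [integral_add j12 j3, integral_add j1 j2, integral_const_mul, integral_const_mul,
        integral_const_mul, hprodb]
    have h3 := h1.trans h2.le
    set e := ∫ ω, ‖S ω‖ ∂μ with he
    have he0 : 0 ≤ e := integral_nonneg fun ω => norm_nonneg _
    set x := ∫ ω, ξ ω ∂μ with hx
    have hx0 : 0 ≤ x := integral_nonneg fun ω => sq_nonneg _
    have h4 : (1 + h * ‖c.lin‖) * e + ‖c.form‖ * ‖c.dir‖ * (e * x) + |c.base| * ‖c.dir‖ * x ≤
        (1 + c.growthRate C T * h) * (e + 1) - 1 := by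
      have a1 : ‖c.form‖ * ‖c.dir‖ * (e * x) ≤
          ‖c.form‖ * ‖c.dir‖ * ((e + 1) * ((C + c.drift ^ 2 * T) * h)) := by
        gcongr
        linarith
      have a2 : |c.base| * ‖c.dir‖ * x ≤
          |c.base| * ‖c.dir‖ * ((e + 1) * ((C + c.drift ^ 2 * T) * h)) := by
        have : (C + c.drift ^ 2 * T) * h ≤ (e + 1) * ((C + c.drift ^ 2 * T) * h) :=
          le_mul_of_one_le_left (by positivity) (by linarith)
        gcongr
        exact hξb.trans this
      have a3 : 0 ≤ h * ‖c.lin‖ := by positivity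
      unfold Coeff.growthRate
      nlinarith
    have h5 : (1 + c.growthRate C T * h) * (e + 1) ≤
        (R + 1) * Real.exp (c.growthRate C T * ((k + 1 : ℕ) * h)) := by
      have b1 : 1 + c.growthRate C T * h ≤ Real.exp (c.growthRate C T * h) := by
        linarith [Real.add_one_le_exp (c.growthRate C T * h)]
      have b2 : c.growthRate C T * ((k + 1 : ℕ) * h) =
          c.growthRate C T * (k * h) + c.growthRate C T * h := by push_cast; ring
      rw [b2, Real.exp_add]
      calc _ ≤ Real.exp (c.growthRate C T * h) *
            ((R + 1) * Real.exp (c.growthRate C T * (k * h))) := by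
            gcongr
            linarith
        _ = _ := by ring
    linarith

/-- The square of `√V` is affine in the state up to absolute value, so a first moment of the state
is enough. -/
lemma memLp_sqrt_vol (hT : h ≤ T) (k : ℕ) :
    MemLp (fun ω => √(c.vol (c.randomEuler X u h (fun ω => (y ω, 0)) k ω).1)) 2 μ ∧
      ∫ ω, √(c.vol (c.randomEuler X u h (fun ω => (y ω, 0)) k ω).1) ^ 2 ∂μ ≤
        |c.base| + ‖c.form‖ * ((R + 1) * Real.exp (c.growthRate C T * (k * h))) := by
  obtain ⟨hi, hb⟩ := hD.integrable_euler_state (c := c) hu hh hy hR hT k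
  set S : Ω → E := fun ω => (c.randomEuler X u h (fun ω => (y ω, 0)) k ω).1 with hS
  have hSm : Measurable S := hD.measurable_of (measurable_fst.comp
      (hD.measurable_randomEuler (c := c) hu hh (hy.prodMk measurable_const) k))
  have hm : Measurable fun ω => √(c.vol (S ω)) := (c.measurable_vol.comp hSm).sqrt
  have hdom : Integrable (fun ω => |c.base| + ‖c.form‖ * ‖S ω‖) μ :=
    (integrable_const _).add (hi.norm.const_mul _)
  have hle : ∀ ω, √(c.vol (S ω)) ^ 2 ≤ |c.base| + ‖c.form‖ * ‖S ω‖ := fun ω => by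
    refine le_trans ?_ (c.abs_vol_le (S ω))
    rcases le_total 0 (c.vol (S ω)) with h1 | h1
    · rw [Real.sq_sqrt h1]; exact le_abs_self _
    · rw [Real.sqrt_eq_zero_of_nonpos h1]; simp
  have hint : Integrable (fun ω => √(c.vol (S ω)) ^ 2) μ :=
    hdom.mono' (hm.pow_const 2).aestronglyMeasurable (.of_forall fun ω => by
      rw [Real.norm_of_nonneg (sq_nonneg _)]; exact hle ω)
  refine ⟨(memLp_two_iff_integrable_sq hm.aestronglyMeasurable).2 hint, ?_⟩
  refine (integral_mono hint hdom hle).trans ?_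
  rw [integral_add (integrable_const _) (hi.norm.const_mul _), integral_const_mul]
  simp only [integral_const, probReal_univ, smul_eq_mul, one_mul]
  have : ∫ ω, ‖S ω‖ ∂μ ≤ (R + 1) * Real.exp (c.growthRate C T * (k * h)) := by linarith
  gcongr

/-- Itô isometry in discrete form: the cross term vanishes because the new increment is centred and
independent, and each step adds at most a constant times `C * h`. The bound depends on `k * h` only,
hence is uniform in the mesh. -/
lemma memLp_euler_integral (k : ℕ) (hT : h ≤ T) (hkT : k * h ≤ T) :
    MemLp (fun ω => (c.randomEuler X u h (fun ω => (y ω, 0)) k ω).2) 2 μ ∧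
      ∫ ω, (c.randomEuler X u h (fun ω => (y ω, 0)) k ω).2 ^ 2 ∂μ ≤
        (|c.base| + ‖c.form‖ * ((R + 1) * Real.exp (c.growthRate C T * T))) * C * (k * h) := by
  have hT0 : 0 ≤ T := hh.trans hT
  have hC := hD.nonneg
  have hR0 : 0 ≤ R := by
    obtain ⟨ω⟩ := nonempty_of_isProbabilityMeasure μ
    exact (norm_nonneg _).trans (hR ω)
  have hκ : 0 ≤ c.growthRate C T := by unfold Coeff.growthRate; positivity
  induction k with
  | zero => simp [Coeff.randomEuler, Coeff.euler]
  | succ k ih =>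
    have hkT' : k * h ≤ T := le_trans (by push_cast; nlinarith) hkT
    obtain ⟨hi, hb⟩ := ih hkT'
    obtain ⟨hvi, hvb⟩ := hD.memLp_sqrt_vol (c := c) hu hh hy hR hT k
    have hk : 0 ≤ u + k * h := by positivity
    have hk' : u + k * h ≤ u + k * h + h := by linarith
    set e := c.randomEuler X u h (fun ω => (y ω, 0)) k with he
    have hem : Measurable[𝓕 (u + k * h)] e :=
      hD.measurable_randomEuler (c := c) hu hh (hy.prodMk measurable_const) k
    set D : Ω → ℝ := fun ω => X (u + k * h + h) ω - X (u + k * h) ω with hDdef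
    have hDL : MemLp D 2 μ := hD.memLp _ _ hk hk'
    have hD0 : ∫ ω, D ω ∂μ = 0 := hD.mean _ _ hk hk'
    have hDsq : ∫ ω, D ω ^ 2 ∂μ ≤ C * h := by
      have := hD.sq_le _ _ hk hk'
      rwa [add_sub_cancel_left] at this
    have hind : IndepFun e D μ := hD.indepFun hk hk' hem
    have hsucc : ∀ ω, (c.randomEuler X u h (fun ω => (y ω, 0)) (k + 1) ω).2 =
        (e ω).2 + √(c.vol (e ω).1) * D ω := fun ω => by
      simp only [hDdef]
      rw [← gridIncrement_eq hD u h k ω]; rfl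
    have hvm : Measurable fun p : E × ℝ => √(c.vol p.1) :=
      (c.measurable_vol.comp measurable_fst).sqrt
    have ind1 : IndepFun (fun ω => √(c.vol (e ω).1) ^ 2) (fun ω => D ω ^ 2) μ :=
      hind.comp (φ := fun p : E × ℝ => √(c.vol p.1) ^ 2) (ψ := fun x => x ^ 2)
        (hvm.pow_const 2) (by fun_prop)
    have ind2 : IndepFun (fun ω => (e ω).2 * √(c.vol (e ω).1)) D μ :=
      hind.comp (φ := fun p : E × ℝ => p.2 * √(c.vol p.1)) (ψ := id)
        (measurable_snd.mul hvm) measurable_id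
    have i1 : Integrable (fun ω => √(c.vol (e ω).1) ^ 2 * D ω ^ 2) μ :=
      ind1.integrable_mul hvi.integrable_sq hDL.integrable_sq
    have i2 : Integrable (fun ω => (e ω).2 * √(c.vol (e ω).1) * D ω) μ :=
      ind2.integrable_mul (hi.integrable_mul hvi) (hDL.integrable one_le_two)
    have m1 : MemLp (fun ω => √(c.vol (e ω).1) * D ω) 2 μ := by
      have hm : AEStronglyMeasurable (fun ω => √(c.vol (e ω).1) * D ω) μ :=
        hvi.aestronglyMeasurable.mul hDL.aestronglyMeasurable
      refine (memLp_two_iff_integrable_sq hm).2 (i1.congr (.of_forall fun ω => ?_))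
      simp only [mul_pow]
    have m2 : MemLp (fun ω => (c.randomEuler X u h (fun ω => (y ω, 0)) (k + 1) ω).2) 2 μ :=
      (hi.add m1).ae_eq (.of_forall fun ω => (hsucc ω).symm)
    refine ⟨m2, ?_⟩
    have hsq : ∀ ω, (c.randomEuler X u h (fun ω => (y ω, 0)) (k + 1) ω).2 ^ 2 =
        (e ω).2 ^ 2 + 2 * ((e ω).2 * √(c.vol (e ω).1) * D ω) + √(c.vol (e ω).1) ^ 2 * D ω ^ 2 :=
      fun ω => by rw [hsucc]; ring
    have e1 := ind1.integral_fun_mul_eq_mul_integral hvi.integrable_sq.aestronglyMeasurable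
      hDL.integrable_sq.aestronglyMeasurable
    have e2 := ind2.integral_fun_mul_eq_mul_integral
      (hi.integrable_mul hvi).aestronglyMeasurable hDL.aestronglyMeasurable
    rw [hD0, mul_zero] at e2
    have i3 : Integrable (fun ω => (e ω).2 ^ 2 + 2 * ((e ω).2 * √(c.vol (e ω).1) * D ω)) μ :=
      hi.integrable_sq.add (i2.const_mul 2)
    rw [integral_congr_ae (.of_forall hsq), integral_add i3 i1,
      integral_add hi.integrable_sq (i2.const_mul 2), integral_const_mul, e1, e2]
    have hvb' : ∫ ω, √(c.vol (e ω).1) ^ 2 ∂μ ≤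
        |c.base| + ‖c.form‖ * ((R + 1) * Real.exp (c.growthRate C T * T)) := by
      refine hvb.trans ?_
      gcongr
    have hfin : (∫ ω, √(c.vol (e ω).1) ^ 2 ∂μ) * ∫ ω, D ω ^ 2 ∂μ ≤
        (|c.base| + ‖c.form‖ * ((R + 1) * Real.exp (c.growthRate C T * T))) * (C * h) := by
      have : 0 ≤ ∫ ω, D ω ^ 2 ∂μ := integral_nonneg fun ω => sq_nonneg _
      gcongr
    push_cast
    nlinarith

lemma integral_mul_euler_eq_zero {W : Ω → ℝ} (hW : Measurable[𝓕 u] W) {K : ℝ}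
    (hWK : ∀ ω, |W ω| ≤ K) (k : ℕ) :
    ∫ ω, W ω * (c.randomEuler X u h (fun ω => (y ω, 0)) k ω).2 ∂μ = 0 := by
  induction k with
  | zero => simp [Coeff.randomEuler, Coeff.euler]
  | succ k ih =>
    obtain ⟨hvi, -⟩ := hD.memLp_sqrt_vol (c := c) hu hh hy hR le_rfl k
    -- Only square integrability is wanted here, so any `T` above both `h` and `k * h` will do.
    obtain ⟨hi, -⟩ := hD.memLp_euler_integral (c := c) (T := max h (k * h)) hu hh hy hR k
      (le_max_left _ _) (le_max_right _ _)
    have hk : 0 ≤ u + k * h := by positivity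
    have hku : u ≤ u + k * h := by
      have : 0 ≤ k * h := by positivity
      linarith
    have hk' : u + k * h ≤ u + k * h + h := by linarith
    set e := c.randomEuler X u h (fun ω => (y ω, 0)) k with he
    have hem : Measurable[𝓕 (u + k * h)] e :=
      hD.measurable_randomEuler (c := c) hu hh (hy.prodMk measurable_const) k
    set D : Ω → ℝ := fun ω => X (u + k * h + h) ω - X (u + k * h) ω with hDdef
    have hDL : MemLp D 2 μ := hD.memLp _ _ hk hk'
    have hD0 : ∫ ω, D ω ∂μ = 0 := hD.mean _ _ hk hk'
    have hWb : ∀ᵐ ω ∂μ, ‖W ω‖ ≤ K := .of_forall hWK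
    have hWm : AEStronglyMeasurable W μ := (hD.measurable_of hW).aestronglyMeasurable
    have hind : IndepFun (fun ω => W ω * √(c.vol (e ω).1)) D μ :=
      (hD.indepFun hk hk' ((hW.mono (hD.mono _ _ hu hku) le_rfl).prodMk hem)).comp
        (φ := fun p : ℝ × (E × ℝ) => p.1 * √(c.vol p.2.1)) (ψ := id)
        (measurable_fst.mul (c.measurable_vol.comp (measurable_fst.comp measurable_snd)).sqrt)
        measurable_id
    have i1 : Integrable (fun ω => W ω * (e ω).2) μ :=
      (hi.integrable one_le_two).bdd_mul hWm hWb
    have i2 : Integrable (fun ω => W ω * √(c.vol (e ω).1)) μ :=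
      (hvi.integrable one_le_two).bdd_mul hWm hWb
    have i3 : Integrable (fun ω => W ω * √(c.vol (e ω).1) * D ω) μ :=
      hind.integrable_mul i2 (hDL.integrable one_le_two)
    have e2 := hind.integral_fun_mul_eq_mul_integral i2.aestronglyMeasurable
      hDL.aestronglyMeasurable
    rw [hD0, mul_zero] at e2
    have hsucc : ∀ ω, W ω * (c.randomEuler X u h (fun ω => (y ω, 0)) (k + 1) ω).2 =
        W ω * (e ω).2 + W ω * √(c.vol (e ω).1) * D ω := fun ω => by
      have : (c.randomEuler X u h (fun ω => (y ω, 0)) (k + 1) ω).2 =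
        (e ω).2 + √(c.vol (e ω).1) * D ω := by
        simp only [hDdef]
        rw [← gridIncrement_eq hD u h k ω]; rfl
      rw [this]; ring
    rw [integral_congr_ae (.of_forall hsucc), integral_add i1 i3, ih, e2, add_zero]

end IsDriver

variable [CompleteSpace E] {Y : ℝ → Ω → E} {I : ℝ → ℝ → Ω → ℝ}

/-- The integral `∫_{(u,v]} √V dX` has conditional expectation zero given the past of `u`. -/
theorem IsDriver.integral_mul_eq_zero (hD : IsDriver μ 𝓕 X τ C) (hE : IsEulerLimit μ c X Y I)
    {u v : ℝ} (hu : 0 ≤ u) (huv : u ≤ v) (hY : HasVersion μ (𝓕 u) (Y u)) {W : Ω → ℝ}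
    (hW : HasVersion μ (𝓕 u) W) (hint : Integrable (fun ω => W ω * I u v ω) μ) :
    ∫ ω, W ω * I u v ω ∂μ = 0 := by
  classical
  obtain ⟨y, hy, hYy⟩ := hY
  obtain ⟨w, hw, hWw⟩ := hW
  have hint' : Integrable (fun ω => w ω * I u v ω) μ :=
    hint.congr (by filter_upwards [hWw] with ω h; rw [h])
  have hcongr : ∫ ω, W ω * I u v ω ∂μ = ∫ ω, w ω * I u v ω ∂μ :=
    integral_congr_ae (by filter_upwards [hWw] with ω h; rw [h])
  rw [hcongr]
  have hlim := hE.tendsto_of_ae_eq hu huv hYy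
  -- The truncation event belongs to the past of `u`, so truncated data are still admissible. On it
  -- the scheme agrees with the original one; off it the weight is zero.
  set A : ℕ → Set Ω := fun R => {ω | ‖y ω‖ ≤ R ∧ |w ω| ≤ R} with hA
  have hAm : ∀ R, MeasurableSet[𝓕 u] (A R) := fun R =>
    @MeasurableSet.inter _ (𝓕 u) _ _ ((measurable_norm.comp hy) measurableSet_Iic)
      ((measurable_norm.comp hw) measurableSet_Iic)
  have hAm' : ∀ R, MeasurableSet (A R) := fun R => hD.le u _ (hAm R)
  have hzero : ∀ R : ℕ, ∫ ω, (A R).indicator (fun ω => w ω * I u v ω) ω ∂μ = 0 := by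
    intro R
    set y' : Ω → E := (A R).indicator y with hy'
    set w' : Ω → ℝ := (A R).indicator w with hw'
    have hym : Measurable[𝓕 u] y' := hy.indicator (hAm R)
    have hwm : Measurable[𝓕 u] w' := hw.indicator (hAm R)
    have hyR : ∀ ω, ‖y' ω‖ ≤ R := fun ω => by
      by_cases h : ω ∈ A R
      · rw [hy', Set.indicator_of_mem h]; exact h.1
      · rw [hy', Set.indicator_of_notMem h]; simp
    have hwR : ∀ ω, |w' ω| ≤ R := fun ω => by
      by_cases h : ω ∈ A R
      · rw [hw', Set.indicator_of_mem h]; exact h.2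
      · rw [hw', Set.indicator_of_notMem h]; simp
    have hh : ∀ n : ℕ, 0 ≤ (v - u) / (n + 1 : ℕ) := fun n =>
      div_nonneg (by linarith) (by positivity)
    have hend : ∀ n : ℕ, (n + 1 : ℕ) * ((v - u) / (n + 1 : ℕ)) = v - u := fun n => by
      have := grid_end u v n
      linarith
    have hhT : ∀ n : ℕ, (v - u) / (n + 1 : ℕ) ≤ v - u := fun n =>
      div_le_self (by linarith) (by push_cast; linarith [Nat.cast_nonneg (α := ℝ) n])
    set g : ℕ → Ω → ℝ := fun n ω =>
      (c.randomEuler X u ((v - u) / (n + 1 : ℕ)) (fun ω => (y' ω, 0)) (n + 1) ω).2 with hg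
    have hgL := fun n : ℕ => hD.memLp_euler_integral (c := c) (T := v - u) hu (hh n) hym hyR
      (n + 1) (hhT n) (hend n).le
    have hwS : AEStronglyMeasurable w' μ := (hD.measurable_of hwm).aestronglyMeasurable
    have hfL : ∀ n, MemLp (fun ω => w' ω * g n ω) 2 μ := fun n => by
      refine MemLp.of_le_mul (c := R) (hgL n).1 (hwS.mul (hgL n).1.aestronglyMeasurable)
        (.of_forall fun ω => ?_)
      rw [norm_mul]
      gcongr
      exact hwR ω
    refine integral_eq_zero_of_tendsto_ae hfL
      (fun n => hD.integral_mul_euler_eq_zero (c := c) hu (hh n) hym hyR hwm hwR (n + 1))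
      (K := R ^ 2 * ((|c.base| + ‖c.form‖ * ((R + 1) * Real.exp (c.growthRate C (v - u) * (v - u))))
        * C * (v - u))) (fun n => ?_) ?_ (hint'.indicator (hAm' R))
    · have h1 := (hgL n).2
      rw [hend] at h1
      have h2 : ∫ ω, (w' ω * g n ω) ^ 2 ∂μ ≤ ∫ ω, (R : ℝ) ^ 2 * g n ω ^ 2 ∂μ := by
        refine integral_mono (hfL n).integrable_sq ((hgL n).1.integrable_sq.const_mul _) fun ω => ?_
        simp only [mul_pow]
        have : w' ω ^ 2 ≤ (R : ℝ) ^ 2 := sq_le_sq' (neg_le_of_abs_le (hwR ω)) (le_of_abs_le (hwR ω))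
        gcongr
      rw [integral_const_mul] at h2
      refine h2.trans ?_
      gcongr
    · filter_upwards [hlim] with ω hω
      by_cases h : ω ∈ A R
      · rw [Set.indicator_of_mem h, hw', Set.indicator_of_mem h]
        refine (Tendsto.const_mul (w ω) ((continuous_snd.tendsto _).comp hω)).congr fun n => ?_
        simp only [Function.comp, hg]
        rw [randomEuler_congr c (z := fun ω => (y' ω, (0 : ℝ))) (z' := fun ω => (y ω, (0 : ℝ)))]
        rw [hy', Set.indicator_of_mem h]
      · rw [Set.indicator_of_notMem h, hw', Set.indicator_of_notMem h]
        simp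
  -- The events exhaust the space, and the assumed integrability of the product is what removes the
  -- truncation.
  have hlimR : Tendsto (fun R : ℕ => ∫ ω, (A R).indicator (fun ω => w ω * I u v ω) ω ∂μ) atTop
      (𝓝 (∫ ω, w ω * I u v ω ∂μ)) := by
    refine tendsto_integral_of_dominated_convergence (fun ω => ‖w ω * I u v ω‖)
      (fun R => hint'.aestronglyMeasurable.indicator (hAm' R)) hint'.norm
      (fun R => .of_forall fun ω => norm_indicator_le_norm_self _ _) (.of_forall fun ω => ?_)
    refine tendsto_const_nhds.congr' ?_
    obtain ⟨m, hm⟩ := exists_nat_ge (max ‖y ω‖ |w ω|)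
    filter_upwards [eventually_ge_atTop m] with R hR
    have h1 : (m : ℝ) ≤ R := by exact_mod_cast hR
    have h2 : ω ∈ A R :=
      ⟨((le_max_left _ _).trans hm).trans h1, ((le_max_right _ _).trans hm).trans h1⟩
    rw [Set.indicator_of_mem h2]
  simp only [hzero] at hlimR
  exact tendsto_nhds_unique hlimR tendsto_const_nhds

end SLDCogarch

namespace SLDCogarch

/-! ### Bounded Lipschitz functions -/

section BddLip

variable {E : Type*} [NormedAddCommGroup E]

/-- `φ` is bounded by `M` and has Lipschitz constant `L`. -/
structure IsBddLip (M L : ℝ) (φ : E → ℝ) : Prop where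
  abs_le : ∀ y, |φ y| ≤ M
  lip : ∀ y y', |φ y - φ y'| ≤ L * ‖y - y'‖

lemma IsBddLip.continuous {M L : ℝ} {φ : E → ℝ} (h : IsBddLip M L φ) : Continuous φ :=
  (LipschitzWith.of_dist_le' (K := L) fun y y' => by
    rw [Real.dist_eq, dist_eq_norm]; exact h.lip y y').continuous

/-- An Arzelà–Ascoli argument with pointwise limits: Tychonoff gives a subsequence that converges on
a dense sequence, and the common Lipschitz constant extends convergence to every point. -/
lemma exists_subseq_tendsto_of_isBddLip [SecondCountableTopology E] {M L : ℝ} {ψ : ℕ → E → ℝ}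
    (h : ∀ n, IsBddLip M L (ψ n)) :
    ∃ (ψ' : E → ℝ) (θ : ℕ → ℕ), StrictMono θ ∧ IsBddLip M L ψ' ∧
      ∀ y, Tendsto (fun n => ψ (θ n) y) atTop (𝓝 (ψ' y)) := by
  set D := TopologicalSpace.denseSeq E
  have hcomp : IsCompact (Set.pi Set.univ fun _ : ℕ => Set.Icc (-M) M) :=
    isCompact_univ_pi fun _ => isCompact_Icc
  obtain ⟨l, -, θ, hθ, hl⟩ := hcomp.tendsto_subseq (x := fun n i => ψ n (D i))
    fun n i _ => abs_le.1 ((h n).abs_le _)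
  have hl' : ∀ i, Tendsto (fun n => ψ (θ n) (D i)) atTop (𝓝 (l i)) := fun i =>
    (tendsto_pi_nhds.1 hl) i
  have hL : 0 ≤ |L| := abs_nonneg L
  have hcauchy : ∀ y, ∃ a, Tendsto (fun n => ψ (θ n) y) atTop (𝓝 a) := by
    intro y
    refine cauchySeq_tendsto_of_complete (Metric.cauchySeq_iff'.2 fun ε hε => ?_)
    obtain ⟨i, hi⟩ := (TopologicalSpace.denseRange_denseSeq E).exists_dist_lt y
      (show 0 < ε / (4 * (|L| + 1)) by positivity)
    have hi' : |L| * ‖y - D i‖ ≤ ε / 4 := by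
      rw [dist_eq_norm] at hi
      calc |L| * ‖y - D i‖ ≤ (|L| + 1) * (ε / (4 * (|L| + 1))) := by gcongr; linarith
        _ = ε / 4 := by field_simp
    have hb : ∀ n, |ψ n y - ψ n (D i)| ≤ ε / 4 := fun n =>
      (((h n).lip _ _).trans (mul_le_mul_of_nonneg_right (le_abs_self L) (norm_nonneg _))).trans hi'
    obtain ⟨n₀, hn₀⟩ := Metric.cauchySeq_iff'.1 (hl' i).cauchySeq (ε / 4) (by positivity)
    refine ⟨n₀, fun n hn => ?_⟩
    have h1 := hn₀ n hn
    have h2 := hb (θ n)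
    have h3 := hb (θ n₀)
    rw [Real.dist_eq] at h1 ⊢
    rw [abs_lt] at h1
    rw [abs_le] at h2 h3
    rw [abs_lt]
    constructor <;> linarith
  choose ψ' hψ' using hcauchy
  refine ⟨ψ', θ, hθ, ⟨fun y => le_of_tendsto (hψ' y).abs (.of_forall fun n => (h _).abs_le y),
    fun y y' => le_of_tendsto ((hψ' y).sub (hψ' y')).abs (.of_forall fun n => (h _).lip y y')⟩, hψ'⟩

lemma isBddLip_of_lipschitzWith {φ : E → ℝ} {B : ℝ} (hB : ∀ x y, dist (φ x) (φ y) ≤ B)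
    {K : ℝ≥0} (hK : LipschitzWith K φ) : IsBddLip (|φ 0| + B) K φ := by
  refine ⟨fun y => ?_, fun y y' => ?_⟩
  · have := hB y 0
    rw [Real.dist_eq] at this
    have h2 := abs_add_le (φ 0) (φ y - φ 0)
    rw [add_sub_cancel] at h2
    linarith
  · have := hK.dist_le_mul y y'
    rwa [Real.dist_eq, dist_eq_norm] at this

end BddLip

/-! ### Invariance of the periodic law -/

variable {Ω : Type*} [MeasurableSpace Ω] {μ : Measure Ω} [IsProbabilityMeasure μ]
  {E : Type*} [NormedAddCommGroup E] [NormedSpace ℝ E]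
  [MeasurableSpace E] [BorelSpace E] [SecondCountableTopology E] [CompleteSpace E]
  {𝓕 : ℝ → MeasurableSpace Ω} {X : ℝ → Ω → ℝ} {τ C : ℝ} {c : Coeff E}

lemma IndepFun.integral_comp_eq {A B : Type*} [MeasurableSpace A] [MeasurableSpace B]
    {f : Ω → A} {g : Ω → B} (h : IndepFun f g μ) (hf : Measurable f) (hg : Measurable g)
    {k : A × B → ℝ} (hk : Measurable k) {M : ℝ} (hM : ∀ p, |k p| ≤ M) :
    ∫ ω, k (f ω, g ω) ∂μ = ∫ ω, ∫ y, k (f ω, y) ∂(μ.map g) ∂μ := by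
  have := Measure.isProbabilityMeasure_map (μ := μ) hf.aemeasurable
  have := Measure.isProbabilityMeasure_map (μ := μ) hg.aemeasurable
  rw [← integral_map (hf.prodMk hg).aemeasurable (φ := fun ω => (f ω, g ω)) (f := k)
      hk.aestronglyMeasurable,
    (indepFun_iff_map_prod_eq_prod_map_map hf.aemeasurable hg.aemeasurable).1 h,
    integral_prod _ (Integrable.of_bound hk.aestronglyMeasurable M (.of_forall hM)),
    integral_map hf.aemeasurable]
  exact (StronglyMeasurable.integral_prod_right (f := fun x y => k (x, y))
    hk.stronglyMeasurable).aestronglyMeasurable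

lemma Coeff.continuous_stateStep (c : Coeff E) (h : ℝ) :
    Continuous fun p : E × ℝ => c.stateStep h p.2 p.1 := by
  unfold Coeff.stateStep Coeff.vol
  fun_prop

namespace IsDriver

variable (hD : IsDriver μ 𝓕 X τ C)
include hD

lemma identDistrib_nat_mul (hτ : 0 ≤ τ) {u v : ℝ} (hu : 0 ≤ u) (huv : u ≤ v) (m : ℕ) :
    IdentDistrib (fun ω => X v ω - X u ω) (fun ω => X (v + m * τ) ω - X (u + m * τ) ω) μ μ := by
  induction m with
  | zero => simpa using IdentDistrib.refl (hD.memLp u v hu huv).aestronglyMeasurable.aemeasurable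
  | succ m ih =>
    have := hD.ident (u + m * τ) (v + m * τ) (by positivity) (by linarith)
    rw [add_assoc, add_assoc] at this
    push_cast
    rw [add_one_mul]
    exact ih.trans this

/-- The Lipschitz factor of one step is affine in the squared jump part, whose mean is of order `h`;
averaging gives a factor `1 + O(h)`. -/
lemma isBddLip_integral_stateStep {u h T : ℝ} (hu : 0 ≤ u) (hh : 0 ≤ h) (hT : h ≤ T) {M L : ℝ}
    (hL : 0 ≤ L) {φ : E → ℝ} (hφ : IsBddLip M L φ) :
    IsBddLip M (L * (1 + c.growthRate C T * h)) fun y =>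
      ∫ x, φ (c.stateStep h x y) ∂(μ.map fun ω => X (u + h) ω - X u ω) := by
  have huh : u ≤ u + h := by linarith
  have hm : AEMeasurable (fun ω => X (u + h) ω - X u ω) μ :=
    (hD.memLp u (u + h) hu huh).aestronglyMeasurable.aemeasurable
  have hφm : ∀ y, Continuous fun x => φ (c.stateStep h x y) := fun y =>
    hφ.continuous.comp ((c.continuous_stateStep h).comp (by fun_prop : Continuous fun x => (y, x)))
  have hi : ∀ y, Integrable (fun ω => φ (c.stateStep h (X (u + h) ω - X u ω) y)) μ := fun y =>
    Integrable.of_bound ((hφm y).measurable.comp_aemeasurable hm).aestronglyMeasurable M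
      (.of_forall fun ω => hφ.abs_le _)
  have hmap : ∀ y, ∫ x, φ (c.stateStep h x y) ∂(μ.map fun ω => X (u + h) ω - X u ω) =
      ∫ ω, φ (c.stateStep h (X (u + h) ω - X u ω) y) ∂μ := fun y =>
    integral_map hm (hφm y).aestronglyMeasurable
  simp only [hmap]
  refine ⟨fun y => ?_, fun y y' => ?_⟩
  · have := norm_integral_le_of_norm_le_const (μ := μ) (C := M)
      (f := fun ω => φ (c.stateStep h (X (u + h) ω - X u ω) y)) (.of_forall fun ω => hφ.abs_le _)
    simpa using this
  · rw [← integral_sub (hi y) (hi y')]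
    have hsq := hD.integrable_sq_sub hu huh (c.drift * h)
    have hb : ∀ ω, |φ (c.stateStep h (X (u + h) ω - X u ω) y) -
        φ (c.stateStep h (X (u + h) ω - X u ω) y')| ≤
        L * ‖y - y'‖ * (1 + h * ‖c.lin‖) + L * ‖y - y'‖ * (‖c.form‖ * ‖c.dir‖) *
          (X (u + h) ω - X u ω - c.drift * h) ^ 2 := fun ω => by
      refine (hφ.lip _ _).trans ?_
      have := mul_le_mul_of_nonneg_left
        (c.norm_stateStep_sub_le hh (X (u + h) ω - X u ω) y y') hL
      linarith
    have hdom : Integrable (fun ω => L * ‖y - y'‖ * (1 + h * ‖c.lin‖) + L * ‖y - y'‖ *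
        (‖c.form‖ * ‖c.dir‖) * (X (u + h) ω - X u ω - c.drift * h) ^ 2) μ :=
      (integrable_const _).add (hsq.const_mul _)
    refine abs_integral_le_integral_abs.trans ?_
    refine (integral_mono ((hi y).sub (hi y')).abs hdom hb).trans ?_
    rw [integral_add (integrable_const _) (hsq.const_mul _), integral_const, integral_const_mul]
    simp only [probReal_univ, smul_eq_mul, one_mul]
    have h1 := hD.integral_sq_sub_le hu hh hT c.drift
    have h2 : L * ‖y - y'‖ * (‖c.form‖ * ‖c.dir‖) *
        (∫ ω, (X (u + h) ω - X u ω - c.drift * h) ^ 2 ∂μ) ≤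
        L * ‖y - y'‖ * (‖c.form‖ * ‖c.dir‖) * ((C + c.drift ^ 2 * T) * h) := by gcongr
    have h3 : 0 ≤ L * ‖y - y'‖ * (|c.base| * ‖c.dir‖ * (C + c.drift ^ 2 * T) * h) := by
      have := hD.nonneg
      have : 0 ≤ T := hh.trans hT
      positivity
    unfold Coeff.growthRate
    linarith

/-- Backward recursion: the last step is integrated out first. By periodicity of the increment laws
the resulting `ψ` does not depend on the period `m`. -/
lemma exists_integral_euler_eq (hτ : 0 ≤ τ) {h T : ℝ} (hh : 0 ≤ h) (hT : h ≤ T) {M : ℝ} (k : ℕ) :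
    ∀ {L : ℝ}, 0 ≤ L → ∀ {φ : E → ℝ}, IsBddLip M L φ →
    ∃ ψ : E → ℝ, IsBddLip M (L * (1 + c.growthRate C T * h) ^ k) ψ ∧
      ∀ (m : ℕ) (z : Ω → E), Measurable[𝓕 (m * τ)] z →
        ∫ ω, φ (c.randomEuler X (m * τ) h (fun ω => (z ω, 0)) k ω).1 ∂μ = ∫ ω, ψ (z ω) ∂μ := by
  have hκ : 0 ≤ c.growthRate C T := by
    have := hD.nonneg
    have : 0 ≤ T := hh.trans hT
    unfold Coeff.growthRate; positivity
  induction k with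
  | zero => exact fun _ φ hφ => ⟨φ, by simpa using hφ, fun _ _ _ => rfl⟩
  | succ k ih =>
    intro L hL φ hφ
    have hk : 0 ≤ k * h := by positivity
    have hkh : k * h ≤ k * h + h := by linarith
    have hφ1 := hD.isBddLip_integral_stateStep (c := c) hk hh hT hL hφ
    obtain ⟨ψ, hψ, hψi⟩ := ih (by positivity) hφ1
    refine ⟨ψ, by rwa [pow_succ', ← mul_assoc], fun m z hz => ?_⟩
    rw [← hψi m z hz]
    have hm : 0 ≤ m * τ := by positivity
    have hmk : 0 ≤ m * τ + k * h := by positivity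
    set e := c.randomEuler X (m * τ) h (fun ω => (z ω, 0)) k with he
    have hem := hD.measurable_randomEuler (c := c) hm hh (hz.prodMk (measurable_const (a := (0:ℝ)))) k
    have hem1 : Measurable[𝓕 (m * τ + k * h)] fun ω => (e ω).1 := measurable_fst.comp hem
    have hind := hD.indepFun hmk (by linarith : m * τ + k * h ≤ m * τ + k * h + h) hem1
    have hDm : Measurable fun ω => X (m * τ + k * h + h) ω - X (m * τ + k * h) ω :=
      (hD.measurable_of (hD.adapted _ _ (by linarith) le_rfl)).sub
        (hD.measurable_of (hD.adapted _ _ hmk le_rfl))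
    have hid := (hD.identDistrib_nat_mul hτ hk hkh m).map_eq
    have e1 : k * h + h + m * τ = m * τ + k * h + h := by ring
    rw [e1, add_comm (k * h) (m * τ)] at hid
    rw [hid]
    rw [← IndepFun.integral_comp_eq hind (hD.measurable_of hem1) hDm
      (k := fun p => φ (c.stateStep h p.2 p.1))
      (hφ.continuous.comp (c.continuous_stateStep h)).measurable (fun p => hφ.abs_le _)]
    refine integral_congr_ae (.of_forall fun ω => ?_)
    simp only
    rw [← gridIncrement_eq hD _ h k ω]
    rfl

variable {Y : ℝ → Ω → E} {I : ℝ → ℝ → Ω → ℝ}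

lemma hasVersion_nat_mul (hτ : 0 ≤ τ) (hE : IsEulerLimit μ c X Y I)
    (hY : HasVersion μ (𝓕 0) (Y 0)) (m : ℕ) : HasVersion μ (𝓕 (m * τ)) (Y (m * τ)) :=
  (hD.hasVersion_step hE le_rfl (by positivity) hY).1

/-- The transition over a period is the same for all periods and maps bounded Lipschitz functions
to bounded Lipschitz functions. -/
lemma exists_transition (hτ : 0 ≤ τ) (hE : IsEulerLimit μ c X Y I)
    (hY : HasVersion μ (𝓕 0) (Y 0)) {M L : ℝ} (hL : 0 ≤ L) {φ : E → ℝ} (hφ : IsBddLip M L φ) :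
    ∃ (L' : ℝ) (ψ : E → ℝ), IsBddLip M L' ψ ∧
      ∀ m : ℕ, ∫ ω, φ (Y ((m + 1 : ℕ) * τ) ω) ∂μ = ∫ ω, ψ (Y (m * τ) ω) ∂μ := by
  have hκ : 0 ≤ c.growthRate C τ := by
    have := hD.nonneg
    unfold Coeff.growthRate; positivity
  have hh : ∀ n : ℕ, 0 ≤ τ / (n + 1 : ℕ) := fun n => by positivity
  have hhT : ∀ n : ℕ, τ / (n + 1 : ℕ) ≤ τ := fun n =>
    div_le_self hτ (by push_cast; linarith [Nat.cast_nonneg (α := ℝ) n])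
  choose ψ hψ hψi using fun n : ℕ =>
    hD.exists_integral_euler_eq (c := c) hτ (hh n) (hhT n) (n + 1) hL hφ
  have hψ' : ∀ n, IsBddLip M (L * Real.exp (c.growthRate C τ * τ)) (ψ n) := fun n => by
    refine ⟨(hψ n).abs_le, fun y y' => ((hψ n).lip y y').trans ?_⟩
    -- The compounded factor stays below an exponential, so all the `ψ n` share one Lipschitz
    -- constant and a subsequence converges. It is extracted before `m` is fixed, so the limit
    -- serves all periods.
    have h1 : (1 + c.growthRate C τ * (τ / (n + 1 : ℕ))) ^ (n + 1) ≤
        Real.exp (c.growthRate C τ * τ) := by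
      have h2 : c.growthRate C τ * τ = (n + 1 : ℕ) * (c.growthRate C τ * (τ / (n + 1 : ℕ))) := by
        field_simp
      rw [h2, Real.exp_nat_mul]
      have h3 := Real.add_one_le_exp (c.growthRate C τ * (τ / (n + 1 : ℕ)))
      have h4 := mul_nonneg hκ (hh n)
      gcongr
      linarith
    gcongr
  obtain ⟨ψ', θ, hθ, hψ'', hlim⟩ := exists_subseq_tendsto_of_isBddLip hψ'
  refine ⟨_, ψ', hψ'', fun m => ?_⟩
  obtain ⟨y, hy, hYy⟩ := hD.hasVersion_nat_mul hτ hE hY m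
  have hm : (0 : ℝ) ≤ m * τ := by positivity
  have hm' : (m : ℝ) * τ ≤ (m + 1 : ℕ) * τ := by push_cast; linarith
  have hsub : ((m + 1 : ℕ) : ℝ) * τ - m * τ = τ := by push_cast; ring
  have h1 := hE.tendsto_of_ae_eq hm hm' hYy
  rw [hsub] at h1
  have hem := fun n : ℕ => hD.measurable_of
    (hD.measurable_randomEuler (c := c) hm (hh n) (hy.prodMk (measurable_const (a := (0:ℝ)))) (n + 1))
  have hlim1 : Tendsto (fun n : ℕ => ∫ ω, φ (c.randomEuler X (m * τ) (τ / (n + 1 : ℕ))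
      (fun ω => (y ω, 0)) (n + 1) ω).1 ∂μ) atTop (𝓝 (∫ ω, φ (Y ((m + 1 : ℕ) * τ) ω) ∂μ)) := by
    refine tendsto_integral_of_dominated_convergence (fun _ => M)
      (fun n => (hφ.continuous.measurable.comp (measurable_fst.comp (hem n))).aestronglyMeasurable)
      (integrable_const _) (fun n => .of_forall fun ω => hφ.abs_le _) ?_
    filter_upwards [h1] with ω hω
    exact ((hφ.continuous.comp continuous_fst).tendsto _).comp hω
  have hlim2 : Tendsto (fun n : ℕ => ∫ ω, ψ (θ n) (y ω) ∂μ) atTop (𝓝 (∫ ω, ψ' (y ω) ∂μ)) := by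
    refine tendsto_integral_of_dominated_convergence (fun _ => M)
      (fun n => ((hψ' _).continuous.measurable.comp (hD.measurable_of hy)).aestronglyMeasurable)
      (integrable_const _) (fun n => .of_forall fun ω => (hψ' _).abs_le _)
      (.of_forall fun ω => hlim _)
  have h2 : ∫ ω, ψ' (Y (m * τ) ω) ∂μ = ∫ ω, ψ' (y ω) ∂μ :=
    integral_congr_ae (by filter_upwards [hYy] with ω h; rw [h])
  rw [h2]
  refine tendsto_nhds_unique (hlim1.comp hθ.tendsto_atTop) (hlim2.congr fun n => ?_)
  exact (hψi (θ n) m y hy).symm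

/-- If the state converges in distribution to its initial law along the periods, then this law is
invariant under the transition over a period. -/
theorem identDistrib_period (hτ : 0 ≤ τ) (hE : IsEulerLimit μ c X Y I)
    (hY : HasVersion μ (𝓕 0) (Y 0))
    (hconv : TendstoInDistribution (fun m : ℕ => Y (0 + m * τ)) atTop (Y 0) (fun _ => μ) μ) :
    IdentDistrib (Y 0) (Y τ) μ μ := by
  simp only [zero_add] at hconv
  have hm : ∀ m : ℕ, AEMeasurable (Y (m * τ)) μ := hconv.forall_aemeasurable
  have hm0 := hconv.aemeasurable_limit
  have hm1 : AEMeasurable (Y τ) μ := by simpa using hm 1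
  have hlim : ∀ {M L : ℝ} {φ : E → ℝ}, 0 ≤ L → IsBddLip M L φ →
      Tendsto (fun m : ℕ => ∫ ω, φ (Y (m * τ) ω) ∂μ) atTop (𝓝 (∫ ω, φ (Y 0 ω) ∂μ)) := by
    intro M L φ hL hφ
    have := tendsto_iff_forall_lipschitz_integral_tendsto.1 hconv.tendsto φ
      ⟨M + M, fun x y => by
        rw [Real.dist_eq]
        exact (abs_sub _ _).trans (add_le_add (hφ.abs_le x) (hφ.abs_le y))⟩
      ⟨_, LipschitzWith.of_dist_le' (K := L) fun y y' => by
        rw [Real.dist_eq, dist_eq_norm]; exact hφ.lip y y'⟩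
    simp only [ProbabilityMeasure.coe_mk] at this
    rw [integral_map hm0 hφ.continuous.aestronglyMeasurable] at this
    refine this.congr fun m => ?_
    rw [integral_map (hm m) hφ.continuous.aestronglyMeasurable]
  have heq : ∀ {M L : ℝ} {φ : E → ℝ}, 0 ≤ L → IsBddLip M L φ →
      ∫ ω, φ (Y 0 ω) ∂μ = ∫ ω, φ (Y τ ω) ∂μ := by
    intro M L φ hL hφ
    obtain ⟨L', ψ, hψ, hψi⟩ := hD.exists_transition hτ hE hY hL hφ
    have hψ1 : IsBddLip M |L'| ψ := ⟨hψ.abs_le, fun y y' =>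
      (hψ.lip y y').trans (mul_le_mul_of_nonneg_right (le_abs_self _) (norm_nonneg _))⟩
    have h1 := ((hlim hL hφ).comp (tendsto_add_atTop_nat 1))
    have h2 := hlim (abs_nonneg _) hψ1
    -- The means of `φ` at period `m + 1` equal those of `ψ` at period `m`, so in the limit `φ` and
    -- `ψ` have the same mean under the law of `Y 0`. The case `m = 0` then replaces `ψ` at time 0
    -- by `φ` at time `τ`.
    have h3 := tendsto_nhds_unique h1 (h2.congr fun m => (hψi m).symm)
    have h4 := hψi 0
    simp only [zero_add, Nat.cast_one, one_mul, Nat.cast_zero, zero_mul] at h4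
    rw [h3, h4]
  have i0 := Measure.isProbabilityMeasure_map hm0
  have i1 := Measure.isProbabilityMeasure_map hm1
  refine ⟨hm0, hm1, ?_⟩
  set ν₀ : ProbabilityMeasure E := ⟨μ.map (Y 0), i0⟩
  set ν₁ : ProbabilityMeasure E := ⟨μ.map (Y τ), i1⟩
  -- Bounded Lipschitz functions determine the law: equal integrals make the constant sequence `ν₀`
  -- converge to `ν₁`, and weak limits are unique.
  have key : Tendsto (fun _ : ℕ => ν₀) atTop (𝓝 ν₁) := by
    refine tendsto_iff_forall_lipschitz_integral_tendsto.2 ?_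
    rintro φ ⟨B, hB⟩ ⟨K, hK⟩
    have hφ := isBddLip_of_lipschitzWith hB hK
    simp only [ν₀, ν₁, ProbabilityMeasure.coe_mk]
    rw [integral_map hm0 hφ.continuous.aestronglyMeasurable,
      integral_map hm1 hφ.continuous.aestronglyMeasurable, heq K.2 hφ]
    exact tendsto_const_nhds
  have hν : ν₀ = ν₁ := tendsto_nhds_unique tendsto_const_nhds key
  exact congrArg Subtype.val hν

end IsDriver

end SLDCogarch

namespace SLDCogarch

/-! ### Consequences for the increments of the integral -/

section Abstract

variable {Ω : Type*} [MeasurableSpace Ω] {μ : Measure Ω} [IsProbabilityMeasure μ]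
  {E : Type*} [NormedAddCommGroup E] [NormedSpace ℝ E]
  [MeasurableSpace E] [BorelSpace E] [SecondCountableTopology E] [CompleteSpace E]
  {𝓕 : ℝ → MeasurableSpace Ω} {X : ℝ → Ω → ℝ} {τ C : ℝ} {c : Coeff E}
  {Y : ℝ → Ω → E} {I : ℝ → ℝ → Ω → ℝ}

lemma hasVersion_const (u a : ℝ) : HasVersion μ (𝓕 u) fun _ => a :=
  ⟨fun _ => a, @measurable_const _ _ _ (𝓕 u) a, .rfl⟩

namespace IsDriver

variable (hD : IsDriver μ 𝓕 X τ C) (hE : IsEulerLimit μ c X Y I) (hY : HasVersion μ (𝓕 0) (Y 0))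
include hD hE hY

lemma hasVersion_state {t : ℝ} (ht : 0 ≤ t) : HasVersion μ (𝓕 t) (Y t) :=
  (hD.hasVersion_step hE le_rfl ht hY).1

lemma hasVersion_integral {u v w : ℝ} (hu : 0 ≤ u) (huv : u ≤ v) (hvw : v ≤ w) :
    HasVersion μ (𝓕 w) (I u v) := by
  obtain ⟨g, hg, hgI⟩ := (hD.hasVersion_step hE hu huv (hD.hasVersion_state hE hY hu)).2
  exact ⟨g, hg.mono (hD.mono v w (hu.trans huv) hvw) le_rfl, hgI⟩

lemma integral_integral_eq_zero {u v : ℝ} (hu : 0 ≤ u) (huv : u ≤ v)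
    (hint : Integrable (I u v) μ) : ∫ ω, I u v ω ∂μ = 0 := by
  have := hD.integral_mul_eq_zero hE hu huv (hD.hasVersion_state hE hY hu)
    (W := fun _ => 1) (hasVersion_const _ 1) (by simpa using hint)
  simpa using this

lemma integral_mul_integral_eq_zero {t l h : ℝ} (ht : 0 ≤ t) (hl : 0 ≤ l) (hlh : l ≤ h)
    (hint : Integrable (fun ω => I t (t + l) ω * I (t + h) (t + h + l) ω) μ) :
    ∫ ω, I t (t + l) ω * I (t + h) (t + h + l) ω ∂μ = 0 := by
  have hth : 0 ≤ t + h := by linarith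
  exact hD.integral_mul_eq_zero hE hth (by linarith) (hD.hasVersion_state hE hY hth)
    (hD.hasVersion_integral hE hY ht (by linarith) (by linarith)) hint

/-- The equality in law is carried from 0 to `t`, across the first window, over the gap to `t + h`,
and across the second window. From `t + l` on the first integral travels along as the passenger `W`,
which is possible since `l ≤ h`. -/
lemma identDistrib_integral_pair (hτ : 0 ≤ τ) (hid : IdentDistrib (Y 0) (Y τ) μ μ) {t l h : ℝ}
    (ht : 0 ≤ t) (hl : 0 ≤ l) (hlh : l ≤ h) :
    IdentDistrib (fun ω => (I t (t + l) ω, I (t + h) (t + h + l) ω))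
      (fun ω => (I (t + τ) (t + l + τ) ω, I (t + h + τ) (t + h + l + τ) ω)) μ μ := by
  have hv : ∀ {u : ℝ}, 0 ≤ u → HasVersion μ (𝓕 u) (Y u) := fun hu => hD.hasVersion_state hE hY hu
  have step : ∀ {u v : ℝ} {W W' : Ω → ℝ}, 0 ≤ u → u ≤ v → HasVersion μ (𝓕 u) W →
      HasVersion μ (𝓕 (u + τ)) W' →
      IdentDistrib (fun ω => (W ω, Y u ω)) (fun ω => (W' ω, Y (u + τ) ω)) μ μ →
      IdentDistrib (fun ω => (W ω, (Y v ω, I u v ω)))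
        (fun ω => (W' ω, (Y (v + τ) ω, I (u + τ) (v + τ) ω))) μ μ := fun hu huv hW hW' hid =>
    hD.identDistrib_step hτ hE hu huv (hv hu) (hv (by positivity)) hW hW' hid
  have h0 : IdentDistrib (fun ω => ((0 : ℝ), Y 0 ω)) (fun ω => ((0 : ℝ), Y (0 + τ) ω)) μ μ := by
    rw [zero_add]
    exact hid.comp (u := fun y => ((0 : ℝ), y)) (by fun_prop)
  have h1 : IdentDistrib (fun ω => ((0 : ℝ), Y t ω)) (fun ω => ((0 : ℝ), Y (t + τ) ω)) μ μ :=
    (step le_rfl ht (hasVersion_const _ _) (hasVersion_const _ _) h0).comp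
      (u := fun p : ℝ × (E × ℝ) => (p.1, p.2.1)) (by fun_prop)
  have h2 : IdentDistrib (fun ω => (I t (t + l) ω, Y (t + l) ω))
      (fun ω => (I (t + τ) (t + l + τ) ω, Y (t + l + τ) ω)) μ μ :=
    (step ht (by linarith) (hasVersion_const _ _) (hasVersion_const _ _) h1).comp
      (u := fun p : ℝ × (E × ℝ) => (p.2.2, p.2.1)) (by fun_prop)
  have hW : ∀ {w : ℝ}, t + l ≤ w → HasVersion μ (𝓕 w) (I t (t + l)) := fun hw =>
    hD.hasVersion_integral hE hY ht (by linarith) hw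
  have hW' : ∀ {w : ℝ}, t + l ≤ w → HasVersion μ (𝓕 (w + τ)) (I (t + τ) (t + l + τ)) := fun hw =>
    hD.hasVersion_integral hE hY (by positivity) (by linarith) (by linarith)
  have h3 : IdentDistrib (fun ω => (I t (t + l) ω, Y (t + h) ω))
      (fun ω => (I (t + τ) (t + l + τ) ω, Y (t + h + τ) ω)) μ μ :=
    (step (by linarith) (by linarith) (hW le_rfl) (hW' le_rfl) h2).comp
      (u := fun p : ℝ × (E × ℝ) => (p.1, p.2.1)) (by fun_prop)
  exact (step (by linarith) (by linarith) (hW (by linarith)) (hW' (by linarith)) h3).comp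
    (u := fun p : ℝ × (E × ℝ) => (p.1, p.2.2)) (by fun_prop)

end IsDriver

lemma CovExists.of_identDistrib {A A' B B' : Ω → ℝ}
    (h : IdentDistrib (fun ω => (A ω, B ω)) (fun ω => (A' ω, B' ω)) μ μ) (hc : CovExists A B μ) :
    CovExists A' B' μ :=
  ⟨(h.comp measurable_fst).integrable_iff.1 hc.1, (h.comp measurable_snd).integrable_iff.1 hc.2.1,
    (h.comp (measurable_fst.mul measurable_snd)).integrable_iff.1 hc.2.2⟩

lemma covariance_eq_of_identDistrib {A A' B B' : Ω → ℝ}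
    (h : IdentDistrib (fun ω => (A ω, B ω)) (fun ω => (A' ω, B' ω)) μ μ) :
    covariance A B μ = covariance A' B' μ := by
  have h1 : ∫ ω, A ω ∂μ = ∫ ω, A' ω ∂μ := (h.comp measurable_fst).integral_eq
  have h2 : ∫ ω, B ω ∂μ = ∫ ω, B' ω ∂μ := (h.comp measurable_snd).integral_eq
  unfold covariance
  rw [h1, h2]
  exact (h.comp (u := fun p : ℝ × ℝ => (p.1 - ∫ ω, A' ω ∂μ) * (p.2 - ∫ ω, B' ω ∂μ))
    (by fun_prop)).integral_eq

end Abstract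

/-! ### From the pathwise limit to the COGARCH processes -/

section Cogarch

variable {Ω : Type*} [MeasurableSpace Ω] {μ : Measure Ω} [IsProbabilityMeasure μ]
  {s : ℕ → ℝ} {d : ℕ} {τ : ℝ} {lam : Fin d → ℝ} {F : Fin d → Measure ℝ}
  {N : ℝ → Ω → ℕ} {Z : Fin d → ℕ → Ω → ℝ} {q : ℕ} {α₀ δ : ℝ} {a β : Fin q → ℝ}
  {Y : ℝ → Ω → Fin q → ℝ}

/-- The state and price processes of a COGARCH process are limits of the Euler scheme. -/
lemma IsStateProcess.isEulerLimit (hS : IsSLCP μ s d τ lam F N Z)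
    (hY : IsStateProcess μ α₀ a β δ N (jumpSize s d N Z) Y) :
    IsEulerLimit μ (cogarchCoeff α₀ a β δ) (hS.version δ) Y
      (fun u v => priceIncrement δ N (jumpSize s d N Z) (volatility α₀ a Y) (v - u) u) := by
  intro u v hu huv
  filter_upwards [hS.poisson.mono, hS.poisson.right_cont, hS.poisson.unit_jump, hY.right_cont,
    hY.left_lim, hY.equation, hS.version_ae_eq δ] with ω hm hr hj hYr hYl heq hX
  obtain ⟨M, hM⟩ := exists_isPathSolution (δ := δ) hm hr hj hYr hYl heq hu huv
  have hlim := hM.tendsto_euler huv (S := fun t => drivingProcess δ N (jumpSize s d N Z) t ω)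
    (fun x y hx hxy _ => drivingProcess_sub hm (hu.trans hx) hxy) 0
  rw [zero_add] at hlim
  rw [priceIncrement_eq (β := β) hm hr hu (by linarith), add_sub_cancel]
  refine hlim.congr fun n => ?_
  have hh : 0 ≤ (v - u) / ((n + 1 : ℕ) : ℝ) := div_nonneg (by linarith) (by positivity)
  -- The measurable version agrees with the driver at all times simultaneously on one event of full
  -- measure, so both drive the same scheme.
  have hg : gridIncrement (fun t => drivingProcess δ N (jumpSize s d N Z) t ω) u
      ((v - u) / (n + 1 : ℕ)) = gridIncrement (fun t => hS.version δ t ω) u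
      ((v - u) / (n + 1 : ℕ)) := by
    ext k
    simp only [gridIncrement]
    rw [hX _ (by positivity), hX _ (by positivity)]
  rw [hg]
  rfl

end Cogarch

end SLDCogarch

end

theorem corollary3p4 {Ω : Type*} [MeasurableSpace Ω] (μ : Measure Ω) [IsProbabilityMeasure μ]
    (s : ℕ → ℝ) (d : ℕ) (τ : ℝ) (lam : Fin d → ℝ) (F : Fin d → Measure ℝ)
    (N : ℝ → Ω → ℕ) (Z : Fin d → ℕ → Ω → ℝ) (hS : SLDCogarch.IsSLCP μ s d τ lam F N Z)
    (δ : ℝ) (S : ℝ → Ω → ℝ)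
    (hS_def : S = SLDCogarch.drivingProcess δ N (SLDCogarch.jumpSize s d N Z))
    (p q : ℕ) (α₀ : ℝ) (a β : Fin q → ℝ) (hparam : SLDCogarch.IsCogarchParam p q α₀ a β)
    (Y : ℝ → Ω → Fin q → ℝ)
    (hY : SLDCogarch.IsStateProcess μ α₀ a β δ N (SLDCogarch.jumpSize s d N Z) Y)
    (V : ℝ → Ω → ℝ) (hV_def : V = SLDCogarch.volatility α₀ a Y)
    (hV : ∀ᵐ ω ∂μ, ∀ t, 0 ≤ t → 0 ≤ V t ω)
    (G : ℝ → ℝ → Ω → ℝ)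
    (hG_def : G = SLDCogarch.priceIncrement δ N (SLDCogarch.jumpSize s d N Z) V)
    (heig : SLDCogarch.DistinctStableEigenvalues β)
    (hlog : SLDCogarch.LogMomentCondition a β s d τ lam F)
    (hmean : ∀ t, 0 ≤ t → ∫ ω, S t ω ∂μ = 0) :
    ∀ t h l : ℝ, 0 ≤ t → 0 < l → l ≤ h →
      ((Integrable (G l t) μ → ∫ ω, G l t ω ∂μ = 0) ∧
        (SLDCogarch.CovExists (G l t) (G l (t + h)) μ →
          covariance (G l t) (G l (t + h)) μ = 0)) ∧
      (SLDCogarch.HasLimitLaw μ τ Y →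
        (∫⁻ ω, ENNReal.ofReal (G l t ω ^ 2) ∂μ = ∫⁻ ω, ENNReal.ofReal (G l (t + τ) ω ^ 2) ∂μ) ∧
        (SLDCogarch.CovExists (fun ω => G l t ω ^ 2) (fun ω => G l (t + h) ω ^ 2) μ →
          SLDCogarch.CovExists (fun ω => G l (t + τ) ω ^ 2) (fun ω => G l (t + h + τ) ω ^ 2) μ ∧
          covariance (fun ω => G l t ω ^ 2) (fun ω => G l (t + h) ω ^ 2) μ =
            covariance (fun ω => G l (t + τ) ω ^ 2) (fun ω => G l (t + h + τ) ω ^ 2) μ)) := by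
  intro t h l ht hl hlh
  obtain ⟨C, hD⟩ := hS.isDriver δ (by simpa only [hS_def] using hmean) (hY.measurable 0 le_rfl)
    hY.initial_indep
  have hE := hY.isEulerLimit hS
  have hτ := hS.partition.period_pos.le
  have hY0 : SLDCogarch.HasVersion μ (MeasurableSpace.comap (fun ω => (Y 0 ω, fun r : ℝ≥0 =>
      hS.version δ (min r (0 : ℝ).toNNReal : ℝ≥0) ω)) inferInstance) (Y 0) :=
    ⟨Y 0, measurable_fst.comp (comap_measurable _), .rfl⟩
  have hG : ∀ {u v : ℝ}, v - u = l → SLDCogarch.priceIncrement δ N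
      (SLDCogarch.jumpSize s d N Z) (SLDCogarch.volatility α₀ a Y) (v - u) u = G l u :=
    fun huv => by rw [huv, hG_def, hV_def]
  refine ⟨⟨fun hint => ?_, fun hc => ?_⟩, fun hlim => ?_⟩
  · have := hD.integral_integral_eq_zero hE hY0 ht (by linarith : t ≤ t + l)
    simp only [hG (add_sub_cancel_left t l)] at this
    exact this hint
  -- Both means vanish, so the covariance is the mean of the product, with the earlier increment
  -- acting as the past weight.
  · have h1 := hD.integral_integral_eq_zero hE hY0 ht (by linarith : t ≤ t + l)
    have h2 := hD.integral_integral_eq_zero hE hY0 (by linarith : 0 ≤ t + h)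
      (by linarith : t + h ≤ t + h + l)
    have h3 := hD.integral_mul_integral_eq_zero hE hY0 ht hl.le hlh
    simp only [hG (add_sub_cancel_left _ l)] at h1 h2 h3
    simp only [covariance, h1 hc.1, h2 hc.2.1, sub_zero, h3 hc.2.2]
  -- The limit law at phase 0 makes the law of the state invariant over one period; every other time
  -- is reached by the transitions.
  · have hid := hD.identDistrib_period hτ hE hY0 (hlim 0 ⟨le_rfl, hS.partition.period_pos⟩)
    have hpair := hD.identDistrib_integral_pair hE hY0 hτ hid ht hl.le hlh
    simp only [hG (add_sub_cancel_left _ l), add_sub_add_right_eq_sub] at hpair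
    rw [add_sub_cancel_left, add_sub_cancel_left, ← hV_def, ← hG_def] at hpair
    have hsq := hpair.comp (u := fun p : ℝ × ℝ => (p.1 ^ 2, p.2 ^ 2)) (by fun_prop)
    refine ⟨?_, fun hc => ⟨hc.of_identDistrib hsq, SLDCogarch.covariance_eq_of_identDistrib hsq⟩⟩
    exact (hpair.comp (u := fun p : ℝ × ℝ => ENNReal.ofReal (p.1 ^ 2)) (by fun_prop)).lintegral_eq
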